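/- **Lemma 4.2.** *Setting.* Let $n>k$, $d\ge 1$, $A\in\mathbb{R}^{k\times n}$, $W_i\in\mathbb{R}^{k_i\times k_{i+1}}$ for $1\le i\le d$, with $k_1=1$ and $k_{d+1}=k$, and $$\sigma(x)=W_1\phi_1(W_2\phi_2(\cdots W_d\,\phi_d(Ax)\cdots)),\qquad M(x)=\tau(\sigma(x)),$$ where the $\phi_i:\mathbb{R}\to\mathbb{R}$ act entrywise, and $\tau(t)=1$ if $t\ge 1$ and $\tau(t)=0$ otherwise. For a subspace $V\subseteq\mathbb{R}^n$ let $P_V$ be the orthogonal projection onto $V$ and $\sigma_V(x)=\sigma((I-P_V)x)$. Write $\nabla_y\sigma_V(x)$ for the derivative of $\sigma_V$ at $x$ in the direction of the unit vector $y/\|y\|_2$, and $\mathrm{Span}(A)$ for the row span of $A$. Assume, for some $\gamma,\eta>0$ and reals $L_1,\dots,L_d$: 1. each $\phi_i$ is twice differentiable, and $\phi_i(0)=0$; 2. $|\phi_i'|\le L_i$ and $|\phi_i''|\le L_i$ on $\mathbb{R}$; 3. for every subspace $V$ with $\dim V<k$, $\Pr_{g\sim\mathcal N(0,I_n)}[\sigma_V(g)\ge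 1]\ge\gamma$; 4. for every subspace $V$ with $\dim V<k$, with probability at least $\gamma$ over $g\sim\mathcal N(0,I_n)$ one has $\sigma_V(g)\ge 1$ and $|\nabla_g\sigma_V(cg)|\ge\eta$ for all $c>0$ with $\sigma_V(cg)=1$. For $\epsilon,\delta>0$ put, with $\log^+=\max(0,\log)$ and with $\|\cdot\|_2$ the spectral norm, $$S=n+k+d+\tfrac1\gamma+\sum_{i=1}^d\log^+L_i+\sum_{i=1}^d\log^+\|W_i\|_2+\log^+\|A\|_2+\log^+\tfrac1\eta+\log^+\tfrac1\epsilon+\log^+\tfrac1\delta .$$ *Computational model.* A randomized real-RAM program is a finite program that works on natural-number registers and on arrays of exact real numbers, with unit-cost arithmetic (including square roots), comparisons, loops, draws of independent $\mathcal N(0,1)$ numbers, and queries to an oracle: for a stored vector $y\in\mathbb{R}^n$ the answer $M(y)\in\{0,1\}$ is returned, at cost $n+1$. It has no other access to the network. *Claim.* There is a constant $K$ such that for all constants $c_1,c_2>0$ there is a $C_0\in\mathbb{N}$ such that for every integer $C\ge C_0$ there are a single randomized real-RAM program and a constant $T$ with the following property. Let $n$, a network as above with its $L_i,\gamma,\eta$,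 and $\epsilon,\delta>0$ be given, let $N$ be any integer with $N\ge K S^K$, and let $$c_1\,\frac{2^{-N^C}}{\epsilon}\le\epsilon_0\le c_2\,\frac{2^{-N^C}}{\epsilon}.$$ Let $V\subseteq\mathbb{R}^n$ be any subspace with $\dim V<k$, and let $x\in\mathbb{R}^n$ be such that $$\epsilon_0\,\eta\,2^{-N}\le\sigma_V(x)-1\le 2\epsilon_0\qquad\text{and}\qquad\nabla_x\sigma_V(x)>\eta/2 .$$ Then the program, given $n,k,N,\epsilon,\delta,\gamma,\eta,\epsilon_0$, the vector $x$, the matrix $P_V$ and oracle access to $M$, runs in expected time at most $T N^T$, and with probability at least $1-2^{-N/n^2}$ it outputs a vector $v\ne 0$ with $$\|P_{\mathrm{Span}(A)}v\|_2\ge(1-\epsilon)\|v\|_2\qquad\text{and}\qquad\|P_Vv\|_2\le\epsilon\|v\|_2 .$$ -/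

import Mathlib

open MeasureTheory ProbabilityTheory
open scoped Matrix ENNReal

noncomputable section

/-! ## Thresholded networks with differentiable activations -/

/-- The data of a network on `ℝⁿ` with weight matrices `W₁, …, W_d`, activations `φ₁, …, φ_d` and
innermost weight matrix `A ∈ ℝ^{k × n}`.  Indices are shifted by one: `W i` and `φ i` (for
`i < depth`) are the `(i+1)`-st weight matrix and activation.  The output is a scalar, so the first
weight matrix is a row vector.  Data of index `≥ depth` is never used. -/
structure Network (n : ℕ) where
  depth : ℕ
  depth_pos : 1 ≤ depth
  width : ℕ → ℕ
  width_zero : width 0 = 1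
  W : (i : ℕ) → Matrix (Fin (width i)) (Fin (width (i + 1))) ℝ
  φ : ℕ → ℝ → ℝ
  A : Matrix (Fin (width depth)) (Fin n) ℝ

/-- The threshold function: `τ t = 1` if `t ≥ 1`, and `τ t = 0` otherwise. -/
def threshold (t : ℝ) : ℕ := if 1 ≤ t then 1 else 0

/-- The spectral norm of a real matrix. -/
def specNorm {p q : ℕ} (B : Matrix (Fin p) (Fin q) ℝ) : ℝ :=
  ‖(Matrix.toEuclideanLin B).toContinuousLinearMap‖

namespace Network

variable {n : ℕ} (net : Network n)

/-- The number `k` of rows of the innermost weight matrix. -/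
def k : ℕ := net.width net.depth

/-- `z ↦ W₁ φ₁(W₂ φ₂(… W_j φ_j(z) …))`, activations being applied entrywise. -/
def layers : (j : ℕ) → (Fin (net.width j) → ℝ) → (Fin (net.width 0) → ℝ)
  | 0, z => z
  | j + 1, z => layers j (net.W j *ᵥ fun i => net.φ j (z i))

/-- `σ(x) = W₁ φ₁(W₂ φ₂(… W_d φ_d(A x) …))`. -/
def sigma (x : EuclideanSpace ℝ (Fin n)) : ℝ :=
  net.layers net.depth (net.A *ᵥ fun i => x i) ⟨0, by rw [net.width_zero]; exact Nat.one_pos⟩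

/-- The network function `M(x) = τ(σ(x))`. -/
def M (x : EuclideanSpace ℝ (Fin n)) : ℕ := threshold (net.sigma x)

/-- `σ_V(x) = σ((I - P_V) x)`, where `P_V` is the orthogonal projection onto `V`. -/
def sigmaV (V : Submodule ℝ (EuclideanSpace ℝ (Fin n))) (x : EuclideanSpace ℝ (Fin n)) : ℝ :=
  net.sigma (x - V.starProjection x)

/-- `Span(A)`: the row span of `A`. -/
def spanA : Submodule ℝ (EuclideanSpace ℝ (Fin n)) :=
  Submodule.span ℝ (Set.range fun i => WithLp.toLp 2 (net.A i))

/-- The standing assumptions on the network, with parameters `L`, `γ`, `η`. -/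
structure Admissible (L : ℕ → ℝ) (γ η : ℝ) : Prop where
  k_lt : net.k < n
  γ_pos : 0 < γ
  η_pos : 0 < η
  differentiable : ∀ i < net.depth, Differentiable ℝ (net.φ i)
  differentiable_deriv : ∀ i < net.depth, Differentiable ℝ (deriv (net.φ i))
  φ_zero : ∀ i < net.depth, net.φ i 0 = 0
  deriv_le : ∀ i < net.depth, ∀ t, |deriv (net.φ i) t| ≤ L i
  deriv_deriv_le : ∀ i < net.depth, ∀ t, |deriv (deriv (net.φ i)) t| ≤ L i
  nonzero : ∀ V : Submodule ℝ (EuclideanSpace ℝ (Fin n)), Module.finrank ℝ V < net.k →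
    ENNReal.ofReal γ ≤ stdGaussian (EuclideanSpace ℝ (Fin n)) {g | 1 ≤ net.sigmaV V g}
  gradient : ∀ V : Submodule ℝ (EuclideanSpace ℝ (Fin n)), Module.finrank ℝ V < net.k →
    ENNReal.ofReal γ ≤ stdGaussian (EuclideanSpace ℝ (Fin n))
      {g | (∀ c : ℝ, 0 < c → net.sigmaV V (c • g) = 1 →
              η ≤ |lineDeriv ℝ (net.sigmaV V) (c • g) (‖g‖⁻¹ • g)|) ∧
           1 ≤ net.sigmaV V g}

/-- The sum of all the parameters in which `N` has to be polynomial (`log⁺ = max 0 log`). -/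
def paramSum (L : ℕ → ℝ) (γ η ε δ : ℝ) : ℝ :=
  n + net.k + net.depth + 1 / γ
    + ∑ i ∈ Finset.range net.depth, Real.posLog (L i)
    + ∑ i ∈ Finset.range net.depth, Real.posLog (specNorm (net.W i))
    + Real.posLog (specNorm net.A)
    + Real.posLog (1 / η) + Real.posLog (1 / ε) + Real.posLog (1 / δ)

end Network

/-! ## Randomized real-RAM programs with a network oracle

A machine has registers for natural numbers and two-dimensional arrays of exact real numbers.
Programs are finite and structured.  All loops have a bound that is computed on entry, so every run
halts; this only restricts the class of algorithms. -/

namespace RAM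

/-- Natural-number expressions (subtraction is truncated). -/
inductive NExp : Type
  | const (c : ℕ)
  | reg (r : ℕ)
  | add (a b : NExp)
  | sub (a b : NExp)
  | mul (a b : NExp)

/-- Real expressions; `cell a i j` is the entry `(i, j)` of the array `a`. -/
inductive RExp : Type
  | const (q : ℚ)
  | ofNat (a : NExp)
  | cell (a : ℕ) (i j : NExp)
  | add (a b : RExp)
  | sub (a b : RExp)
  | mul (a b : RExp)
  | div (a b : RExp)
  | sqrt (a : RExp)

/-- Tests. -/
inductive Test : Type
  | le (a b : RExp)
  | leN (a b : NExp)

/-- Programs. `gauss` writes a fresh standard Gaussian into a cell; `query r a i` puts the oracle's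
answer on row `i` of the array `a` into register `r`; `loop r e p` runs `p` with register `r` set
to `0, 1, …, m - 1` in turn, where `m` is the value of `e` on entry. -/
inductive Prog : Type
  | skip
  | seq (p q : Prog)
  | setN (r : ℕ) (e : NExp)
  | setR (a : ℕ) (i j : NExp) (e : RExp)
  | gauss (a : ℕ) (i j : NExp)
  | query (r : ℕ) (a : ℕ) (i : NExp)
  | ite (t : Test) (p q : Prog)
  | loop (r : ℕ) (e : NExp) (p : Prog)

/-- Machine states: registers, arrays, number of Gaussians drawn so far, time elapsed so far. -/
structure State : Type where
  nat : ℕ → ℕ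
  arr : ℕ → ℕ → ℕ → ℝ
  drawn : ℕ
  time : ℕ

def NExp.eval (s : State) : NExp → ℕ
  | .const c => c
  | .reg r => s.nat r
  | .add a b => a.eval s + b.eval s
  | .sub a b => a.eval s - b.eval s
  | .mul a b => a.eval s * b.eval s

/-- Number of operations needed to evaluate an expression. -/
def NExp.cost : NExp → ℕ
  | .const _ => 1
  | .reg _ => 1
  | .add a b => a.cost + b.cost + 1
  | .sub a b => a.cost + b.cost + 1
  | .mul a b => a.cost + b.cost + 1

def RExp.eval (s : State) : RExp → ℝ
  | .const q => q
  | .ofNat a => a.eval s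
  | .cell a i j => s.arr a (i.eval s) (j.eval s)
  | .add a b => a.eval s + b.eval s
  | .sub a b => a.eval s - b.eval s
  | .mul a b => a.eval s * b.eval s
  | .div a b => a.eval s / b.eval s
  | .sqrt a => Real.sqrt (a.eval s)

/-- Number of operations needed to evaluate an expression. -/
def RExp.cost : RExp → ℕ
  | .const _ => 1
  | .ofNat a => a.cost + 1
  | .cell _ i j => i.cost + j.cost + 1
  | .add a b => a.cost + b.cost + 1
  | .sub a b => a.cost + b.cost + 1
  | .mul a b => a.cost + b.cost + 1
  | .div a b => a.cost + b.cost + 1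
  | .sqrt a => a.cost + 1

def Test.holds (s : State) : Test → Prop
  | .le a b => a.eval s ≤ b.eval s
  | .leN a b => a.eval s ≤ b.eval s

def Test.cost : Test → ℕ
  | .le a b => a.cost + b.cost + 1
  | .leN a b => a.cost + b.cost + 1

def State.writeN (s : State) (r v : ℕ) : State :=
  { s with nat := Function.update s.nat r v }

def State.writeR (s : State) (a i j : ℕ) (v : ℝ) : State :=
  { s with arr := fun a' i' j' => if a' = a ∧ i' = i ∧ j' = j then v else s.arr a' i' j' }

def State.tick (s : State) (c : ℕ) : State :=
  { s with time := s.time + c }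

/-- The vector in `ℝⁿ` stored in row `i` of the array `a`. -/
def State.row (s : State) (n a i : ℕ) : EuclideanSpace ℝ (Fin n) :=
  WithLp.toLp 2 fun j : Fin n => s.arr a i j

open Classical in
/-- Run a program with oracle `M` and stream of random numbers `ω`.  Each operation costs one unit
of time; a query costs `n + 1` units, and each pass through a loop one unit on top of the body. -/
def Prog.run {n : ℕ} (M : EuclideanSpace ℝ (Fin n) → ℕ) (ω : ℕ → ℝ) : Prog → State → State
  | .skip, s => s.tick 1
  | .seq p q, s => q.run M ω (p.run M ω s)
  | .setN r e, s => (s.writeN r (e.eval s)).tick (e.cost + 1)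
  | .setR a i j e, s =>
      (s.writeR a (i.eval s) (j.eval s) (e.eval s)).tick (i.cost + j.cost + e.cost + 1)
  | .gauss a i j, s =>
      { (s.writeR a (i.eval s) (j.eval s) (ω s.drawn)).tick (i.cost + j.cost + 1) with
        drawn := s.drawn + 1 }
  | .query r a i, s => (s.writeN r (M (s.row n a (i.eval s)))).tick (i.cost + n + 1)
  | .ite t p q, s =>
      if t.holds s then p.run M ω (s.tick (t.cost + 1)) else q.run M ω (s.tick (t.cost + 1))
  | .loop r e p, s =>
      (List.range (e.eval s)).foldl (fun s' m => p.run M ω ((s'.writeN r m).tick 1))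
        (s.tick (e.cost + 1))

/-- The law of the random numbers: independent standard Gaussians. -/
def coins : Measure (ℕ → ℝ) := Measure.infinitePi fun _ : ℕ => gaussianReal 0 1

/-- The initial state.  Registers `0, 1, 2` hold `n, k, N`.  Row `0` of array `0` holds
`ε, δ, γ, η, ε₀`; row `0` of array `1` holds the vector `x`; array `2` holds the matrix of the
orthogonal projection `P_V`.  Everything else is `0`. -/
def input {n : ℕ} (k N : ℕ) (ε δ γ η ε₀ : ℝ) (x : EuclideanSpace ℝ (Fin n))
    (V : Submodule ℝ (EuclideanSpace ℝ (Fin n))) : State where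
  nat := fun r => if r = 0 then n else if r = 1 then k else if r = 2 then N else 0
  arr := fun a i j =>
    if a = 0 ∧ i = 0 then
      (if j = 0 then ε else if j = 1 then δ else if j = 2 then γ else if j = 3 then η
        else if j = 4 then ε₀ else 0)
    else if a = 1 ∧ i = 0 then
      (if hj : j < n then x ⟨j, hj⟩ else 0)
    else if a = 2 then
      (if h : i < n ∧ j < n then
        V.starProjection (EuclideanSpace.single ⟨j, h.2⟩ (1 : ℝ)) ⟨i, h.1⟩ else 0)
    else 0
  drawn := 0
  time := 0

/-- The output vector: row `0` of array `3`. -/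
def State.output (s : State) (n : ℕ) : EuclideanSpace ℝ (Fin n) := s.row n 3 0

/-- The expected running time of a program, on initial state `s`. -/
def Prog.expectedTime {n : ℕ} (M : EuclideanSpace ℝ (Fin n) → ℕ) (p : Prog) (s : State) : ℝ≥0∞ :=
  ∫⁻ ω, ((p.run M ω s).time : ℝ≥0∞) ∂coins

/-- The probability that the output vector of a program, on initial state `s`, fails to have
property `P`. -/
def Prog.failProb {n : ℕ} (M : EuclideanSpace ℝ (Fin n) → ℕ) (p : Prog) (s : State)
    (P : EuclideanSpace ℝ (Fin n) → Prop) : ℝ≥0∞ :=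
  coins {ω | ¬ P ((p.run M ω s).output n)}

end RAM

end

/-! ### Footprints of programs and frame rules -/

namespace RAM

/-! Since `σ` depends on its argument only through `A`, its gradient lies in the row span of `A`.
Where `σ = 1` and the derivative along a line is not tiny, the decision boundary is a smooth
hypersurface with this gradient as normal, and the oracle locates it by bisection. Shift the line `t
↦ t • y` by `r • z`: to first order the crossing parameter drops by `r * ℓ z`, where `ℓ z` is the
derivative of `σ` in direction `z` divided by that in direction `y`. The displacements along the `n`
coordinate axes therefore form a vector `v` that almost represents `ℓ`, hence is almost a multiple
of the gradient. With `X = 2 ^ N` bounding all parameters and `r = 2 ^ (-N²)`, errors of size `r`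
times a fixed power of `X` are negligible (`exists_displacement_approx`, `displacement_predicted`).

A given random line may be useless, so each estimate is verified: a fresh Gaussian `z` is drawn, and
`v` is kept only if `⟪v, z⟫` predicts the displacement in direction `z`. If `v` has a component `b`
orthogonal to the row span that is not tiny, the displacement is constant along `b` while the
prediction has slope `‖b‖`, so the test is passed with probability at most `1 / X`. This soundness
bound, `stdGaussian_predicts_le`, asks nothing of the line.

For progress, the direction `y` is a Gaussian `g` with its projection onto the span of the `c < k`
vectors already found removed. The gradient assumption for that span makes `g` good with probability
at least `γ`, up to a Gaussian tail; then the test is passed, and `⟪v, y⟫ ≥ 1 / 2` forces `v` to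
have a definite component outside that span (`Network.attempt_succeeds`). The potential `2 ^ (k -
c)` thus decreases on average by a factor `1 - γ / 8` per round, up to false acceptances, and `N²`
rounds suffice (`coins_foldl_le`).

At the end there are `k` orthogonal vectors close to the row span. As `dim V < k`, some nonzero
combination of them is killed by `P_V`; Gram–Schmidt for the degenerate form `⟪P_V x, y⟫` finds it
exactly (`finish_spec`), and it is still close to the row span (`Found.norm_offset_le`). The running
time needs no probability: every loop bound is a polynomial in `n`, `k`, `N`. -/

/-- The registers that a program may write. -/
def Prog.regs : Prog → List ℕ
  | .skip => []
  | .seq p q => p.regs ++ q.regs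
  | .setN r _ => [r]
  | .setR _ _ _ _ => []
  | .gauss _ _ _ => []
  | .query r _ _ => [r]
  | .ite _ p q => p.regs ++ q.regs
  | .loop r _ p => r :: p.regs

/-- The arrays that a program may write. -/
def Prog.arrs : Prog → List ℕ
  | .skip => []
  | .seq p q => p.arrs ++ q.arrs
  | .setN _ _ => []
  | .setR a _ _ _ => [a]
  | .gauss a _ _ => [a]
  | .query _ _ _ => []
  | .ite _ p q => p.arrs ++ q.arrs
  | .loop _ _ p => p.arrs

/-- Whether a program contains a random draw. -/
def Prog.random : Prog → Bool
  | .skip => false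
  | .seq p q => p.random || q.random
  | .setN _ _ => false
  | .setR _ _ _ _ => false
  | .gauss _ _ _ => true
  | .query _ _ _ => false
  | .ite _ p q => p.random || q.random
  | .loop _ _ p => p.random

theorem foldl_invariant {α β : Type*} {f : β → α → β} {I : β → Prop}
    (h : ∀ b a, I b → I (f b a)) (l : List α) : ∀ b, I b → I (l.foldl f b) := by
  induction l with
  | nil => intro b hb; exact hb
  | cons a l ih => intro b hb; exact ih _ (h b a hb)

section Frame

variable {n : ℕ} (M : EuclideanSpace ℝ (Fin n) → ℕ) (ω : ℕ → ℝ)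

/-- A frame rule. The footprint of a concrete program is an explicit list, so the specifications of
consecutive pieces can be chained by checking non-membership. -/
theorem Prog.run_nat (p : Prog) {r : ℕ} (hr : r ∉ p.regs) (s : State) :
    (p.run M ω s).nat r = s.nat r := by
  induction p generalizing s with
  | skip => rfl
  | seq p q hp hq =>
    simp only [Prog.regs, List.mem_append, not_or] at hr
    simp only [Prog.run]
    rw [hq hr.2, hp hr.1]
  | setN r' e =>
    simp only [Prog.regs, List.mem_singleton] at hr
    simp [Prog.run, State.tick, State.writeN, Function.update_of_ne hr]
  | setR a i j e => rfl
  | gauss a i j => rfl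
  | query r' a i =>
    simp only [Prog.regs, List.mem_singleton] at hr
    simp [Prog.run, State.tick, State.writeN, Function.update_of_ne hr]
  | ite t p q hp hq =>
    simp only [Prog.regs, List.mem_append, not_or] at hr
    simp only [Prog.run]
    split_ifs
    · rw [hp hr.1]; rfl
    · rw [hq hr.2]; rfl
  | loop r' e p hp =>
    simp only [Prog.regs, List.mem_cons, not_or] at hr
    simp only [Prog.run]
    refine foldl_invariant (I := fun s' : State => s'.nat r = s.nat r) (fun b a hb => ?_) _ _ rfl
    rw [hp hr.2, ← hb]
    simp [State.tick, State.writeN, Function.update_of_ne hr.1]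

theorem Prog.run_arr (p : Prog) {a : ℕ} (ha : a ∉ p.arrs) (s : State) :
    (p.run M ω s).arr a = s.arr a := by
  induction p generalizing s with
  | skip => rfl
  | seq p q hp hq =>
    simp only [Prog.arrs, List.mem_append, not_or] at ha
    simp only [Prog.run]
    rw [hq ha.2, hp ha.1]
  | setN r' e => rfl
  | setR a' i j e =>
    simp only [Prog.arrs, List.mem_singleton] at ha
    funext i' j'
    simp [Prog.run, State.tick, State.writeR, ha]
  | gauss a' i j =>
    simp only [Prog.arrs, List.mem_singleton] at ha
    funext i' j'
    simp [Prog.run, State.tick, State.writeR, ha]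
  | query r' a i => rfl
  | ite t p q hp hq =>
    simp only [Prog.arrs, List.mem_append, not_or] at ha
    simp only [Prog.run]
    split_ifs
    · rw [hp ha.1]; rfl
    · rw [hq ha.2]; rfl
  | loop r' e p hp =>
    simp only [Prog.arrs] at ha
    simp only [Prog.run]
    refine foldl_invariant (I := fun s' : State => s'.arr a = s.arr a) (fun b m hb => ?_) _ _ rfl
    rw [hp ha, ← hb]
    rfl

theorem Prog.run_drawn (p : Prog) (h : p.random = false) (s : State) :
    (p.run M ω s).drawn = s.drawn := by
  induction p generalizing s with
  | skip => rfl
  | seq p q hp hq =>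
    simp only [Prog.random, Bool.or_eq_false_iff] at h
    simp only [Prog.run]
    rw [hq h.2, hp h.1]
  | setN r' e => rfl
  | setR a' i j e => rfl
  | gauss a' i j => simp [Prog.random] at h
  | query r' a i => rfl
  | ite t p q hp hq =>
    simp only [Prog.random, Bool.or_eq_false_iff] at h
    simp only [Prog.run]
    split_ifs
    · rw [hp h.1]; rfl
    · rw [hq h.2]; rfl
  | loop r' e p hp =>
    simp only [Prog.random] at h
    simp only [Prog.run]
    refine foldl_invariant (I := fun s' : State => s'.drawn = s.drawn) (fun b m hb => ?_) _ _ rfl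
    rw [hp h, ← hb]
    rfl

theorem Prog.drawn_le_run (p : Prog) (s : State) : s.drawn ≤ (p.run M ω s).drawn := by
  induction p generalizing s with
  | skip => exact le_rfl
  | seq p q hp hq => exact (hp s).trans (hq _)
  | setN r' e => exact le_rfl
  | setR a' i j e => exact le_rfl
  | gauss a' i j => exact Nat.le_succ _
  | query r' a i => exact le_rfl
  | ite t p q hp hq =>
    simp only [Prog.run]
    split_ifs
    · exact hp (s.tick _)
    · exact hq (s.tick _)
  | loop r' e p hp =>
    simp only [Prog.run]
    refine foldl_invariant (I := fun s' : State => s.drawn ≤ s'.drawn) (fun b m hb => ?_) _ _ le_rfl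
    exact hb.trans (hp ((b.writeN r' m).tick 1))

theorem drawn_le_foldl (p : Prog) (r : ℕ) (l : List ℕ) (s : State) :
    s.drawn ≤ (l.foldl (fun s' m => p.run M ω ((s'.writeN r m).tick 1)) s).drawn :=
  foldl_invariant (I := fun s' : State => s.drawn ≤ s'.drawn)
    (fun b m hb => hb.trans (p.drawn_le_run M ω ((b.writeN r m).tick 1))) _ _ le_rfl

/-- A run depends only on the random numbers that it draws. -/
theorem Prog.run_congr (p : Prog) {ω' : ℕ → ℝ} (s : State)
    (h : ∀ i < (p.run M ω s).drawn, ω i = ω' i) : p.run M ω s = p.run M ω' s := by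
  induction p generalizing s with
  | skip => rfl
  | seq p q hp hq =>
    simp only [Prog.run] at h ⊢
    rw [← hp s fun i hi => h i (hi.trans_le (q.drawn_le_run M ω _))]
    exact hq _ h
  | setN r' e => rfl
  | setR a' i j e => rfl
  | gauss a' i j =>
    simp only [Prog.run] at h ⊢
    rw [h s.drawn (Nat.lt_succ_self _)]
  | query r' a i => rfl
  | ite t p q hp hq =>
    simp only [Prog.run] at h ⊢
    split_ifs with ht
    · simp only [if_pos ht] at h
      exact hp _ h
    · simp only [if_neg ht] at h
      exact hq _ h
  | loop r' e p hp =>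
    simp only [Prog.run] at h ⊢
    generalize s.tick (e.cost + 1) = s0 at h ⊢
    generalize List.range (e.eval s) = l at h ⊢
    induction l generalizing s0 with
    | nil => rfl
    | cons a l ih =>
      simp only [List.foldl_cons] at h ⊢
      rw [← hp _ fun i hi => h i (hi.trans_le (drawn_le_foldl M ω p r' l _))]
      exact ih _ h

/-- The invariant rule for loops. -/
theorem run_loop_invariant {r : ℕ} {e : NExp} {p : Prog} {s : State} (I : ℕ → State → Prop)
    (h0 : I 0 (s.tick (e.cost + 1)))
    (hs : ∀ m < e.eval s, ∀ s', I m s' → I (m + 1) (p.run M ω ((s'.writeN r m).tick 1))) :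
    I (e.eval s) ((Prog.loop r e p).run M ω s) := by
  simp only [Prog.run]
  generalize e.eval s = b at hs ⊢
  induction b with
  | zero => exact h0
  | succ b ih =>
    rw [List.range_succ, List.foldl_append]
    exact hs b (Nat.lt_succ_self b) _ (ih fun m hm => hs m (hm.trans (Nat.lt_succ_self b)))

end Frame

/-! ### Deterministic polynomial running time -/

section Time

/-- Expressions whose value depends only on the registers `0, 1, 2`. -/
def NExp.Static : NExp → Prop
  | .const _ => True
  | .reg r => r < 3
  | .add a b => a.Static ∧ b.Static
  | .sub a b => a.Static ∧ b.Static
  | .mul a b => a.Static ∧ b.Static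

/-- Programs all of whose loop bounds depend only on the registers `0, 1, 2`, which are never
written. -/
def Prog.Static : Prog → Prop
  | .skip => True
  | .seq p q => p.Static ∧ q.Static
  | .setN r _ => 3 ≤ r
  | .setR _ _ _ _ => True
  | .gauss _ _ _ => True
  | .query r _ _ => 3 ≤ r
  | .ite _ p q => p.Static ∧ q.Static
  | .loop r e p => 3 ≤ r ∧ e.Static ∧ p.Static

/-- A bound for the running time of a static program. -/
def Prog.timeBound (n : ℕ) (s : State) : Prog → ℕ
  | .skip => 1
  | .seq p q => p.timeBound n s + q.timeBound n s
  | .setN _ e => e.cost + 1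
  | .setR _ i j e => i.cost + j.cost + e.cost + 1
  | .gauss _ i j => i.cost + j.cost + 1
  | .query _ _ i => i.cost + n + 1
  | .ite t p q => t.cost + 1 + (p.timeBound n s + q.timeBound n s)
  | .loop _ e p => e.cost + 1 + e.eval s * (1 + p.timeBound n s)

theorem NExp.Static.eval_eq {e : NExp} (he : e.Static) {s s' : State}
    (h : ∀ r < 3, s.nat r = s'.nat r) : e.eval s = e.eval s' := by
  induction e with
  | const c => rfl
  | reg r => exact h r he
  | add a b ha hb => simp only [NExp.eval, ha he.1, hb he.2]
  | sub a b ha hb => simp only [NExp.eval, ha he.1, hb he.2]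
  | mul a b ha hb => simp only [NExp.eval, ha he.1, hb he.2]

theorem Prog.Static.three_le {p : Prog} (hp : p.Static) : ∀ r ∈ p.regs, 3 ≤ r := by
  induction p with
  | skip => simp [Prog.regs]
  | seq p q ihp ihq =>
    intro r hr
    rcases List.mem_append.1 hr with hr | hr
    exacts [ihp hp.1 r hr, ihq hp.2 r hr]
  | setN r' e => intro r hr; rw [List.mem_singleton.1 hr]; exact hp
  | setR a' i j e => simp [Prog.regs]
  | gauss a' i j => simp [Prog.regs]
  | query r' a i => intro r hr; rw [List.mem_singleton.1 hr]; exact hp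
  | ite t p q ihp ihq =>
    intro r hr
    rcases List.mem_append.1 hr with hr | hr
    exacts [ihp hp.1 r hr, ihq hp.2 r hr]
  | loop r' e p ihp =>
    intro r hr
    rcases List.mem_cons.1 hr with hr | hr
    exacts [hr ▸ hp.1, ihp hp.2.2 r hr]

theorem Prog.Static.run_nat {p : Prog} (hp : p.Static) {n : ℕ}
    (M : EuclideanSpace ℝ (Fin n) → ℕ) (ω : ℕ → ℝ) {r : ℕ} (hr : r < 3) (s : State) :
    (p.run M ω s).nat r = s.nat r :=
  p.run_nat M ω (fun h => absurd (hp.three_le r h) (by omega)) s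

/-- Registers `0, 1, 2` never change, so every loop bound met during the run has the value it has in
the fixed reference state `s₀`, even though the current state `s` evolves. -/
theorem Prog.Static.time_le {p : Prog} (hp : p.Static) {n : ℕ}
    (M : EuclideanSpace ℝ (Fin n) → ℕ) (ω : ℕ → ℝ) (s₀ s : State)
    (h : ∀ r < 3, s.nat r = s₀.nat r) :
    (p.run M ω s).time ≤ s.time + p.timeBound n s₀ := by
  induction p generalizing s with
  | skip => exact le_rfl
  | seq p q ihp ihq =>
    have h1 := ihp hp.1 s h
    have h2 := ihq hp.2 (p.run M ω s) fun r hr => (hp.1.run_nat M ω hr s).trans (h r hr)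
    simp only [Prog.run, Prog.timeBound]
    omega
  | setN r' e => exact le_rfl
  | setR a' i j e => exact le_rfl
  | gauss a' i j => exact le_rfl
  | query r' a i => exact le_rfl
  | ite t p q ihp ihq =>
    have h1 := ihp hp.1 (s.tick (t.cost + 1)) h
    have h2 := ihq hp.2 (s.tick (t.cost + 1)) h
    simp only [Prog.run, Prog.timeBound, State.tick] at h1 h2 ⊢
    split_ifs <;> omega
  | loop r' e p ihp =>
    rw [Prog.timeBound, ← hp.2.1.eval_eq h]
    refine (run_loop_invariant M ω (fun m s' => (∀ r < 3, s'.nat r = s₀.nat r) ∧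
      s'.time ≤ s.time + (e.cost + 1 + m * (1 + p.timeBound n s₀))) ⟨h, ?_⟩ ?_).2
    · simp [State.tick]
    · rintro m - s' ⟨h1, h2⟩
      have h3 : ∀ r < 3, ((s'.writeN r' m).tick 1).nat r = s₀.nat r := fun r hr => by
        have : r ≠ r' := by have := hp.1; omega
        simp [State.tick, State.writeN, Function.update_of_ne this, h1 r hr]
      refine ⟨fun r hr => (hp.2.2.run_nat M ω hr _).trans (h3 r hr), ?_⟩
      refine (ihp hp.2.2 _ h3).trans ?_
      simp only [State.tick, State.writeN, add_mul, one_mul]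
      omega

/-- One number `T` serves as coefficient and as exponent. For `N ≥ 1` bounds of this form are closed
under sums and products, which is all that is needed to propagate them through expressions and
loops. -/
theorem NExp.Static.eval_le_pow {e : NExp} (he : e.Static) : ∃ T : ℕ, ∀ (s : State) (N : ℕ),
    1 ≤ N → (∀ r < 3, s.nat r ≤ N) → e.eval s ≤ T * N ^ T := by
  have mono : ∀ {T T' N : ℕ}, 1 ≤ N → T ≤ T' → T * N ^ T ≤ T' * N ^ T' := fun hN h =>
    Nat.mul_le_mul h (Nat.pow_le_pow_right hN h)
  induction e with
  | const c =>
    refine ⟨c, fun s N hN _ => ?_⟩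
    exact Nat.le_mul_of_pos_right _ (Nat.pow_pos hN)
  | reg r => exact ⟨1, fun s N hN h => by simpa [NExp.eval] using h r he⟩
  | add a b ha hb =>
    obtain ⟨T, hT⟩ := ha he.1
    obtain ⟨T', hT'⟩ := hb he.2
    refine ⟨T + T', fun s N hN h => ?_⟩
    have h1 := hT s N hN h
    have h2 := hT' s N hN h
    have h3 : T * N ^ T ≤ T * N ^ (T + T') :=
      Nat.mul_le_mul_left _ (Nat.pow_le_pow_right hN (by omega))
    have h4 : T' * N ^ T' ≤ T' * N ^ (T + T') :=
      Nat.mul_le_mul_left _ (Nat.pow_le_pow_right hN (by omega))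
    simp only [NExp.eval, add_mul]
    omega
  | sub a b ha hb =>
    obtain ⟨T, hT⟩ := ha he.1
    exact ⟨T, fun s N hN h => (Nat.sub_le _ _).trans (hT s N hN h)⟩
  | mul a b ha hb =>
    obtain ⟨T, hT⟩ := ha he.1
    obtain ⟨T', hT'⟩ := hb he.2
    -- The product has coefficient `T * T'` and exponent `T + T'`; their sum dominates both.
    refine ⟨T * T' + (T + T'), fun s N hN h => ?_⟩
    have h1 := Nat.mul_le_mul (hT s N hN h) (hT' s N hN h)
    refine h1.trans ?_
    calc T * N ^ T * (T' * N ^ T') = T * T' * N ^ (T + T') := by ring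
      _ ≤ _ := Nat.mul_le_mul (by omega) (Nat.pow_le_pow_right hN (by omega))

theorem Prog.Static.timeBound_le_pow {p : Prog} (hp : p.Static) :
    ∃ T : ℕ, ∀ (n : ℕ) (s : State) (N : ℕ),
      1 ≤ N → n ≤ N → (∀ r < 3, s.nat r ≤ N) → p.timeBound n s ≤ T * N ^ T := by
  have const : ∀ {c N : ℕ}, 1 ≤ N → c ≤ c * N ^ c := fun hN =>
    Nat.le_mul_of_pos_right _ (Nat.pow_pos hN)
  have add : ∀ {T T' N : ℕ}, 1 ≤ N → T * N ^ T + T' * N ^ T' ≤ (T + T') * N ^ (T + T') := by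
    intro T T' N hN
    rw [add_mul]
    exact add_le_add (Nat.mul_le_mul_left _ (Nat.pow_le_pow_right hN (by omega)))
      (Nat.mul_le_mul_left _ (Nat.pow_le_pow_right hN (by omega)))
  induction p with
  | skip => exact ⟨1, fun n s N hN _ _ => const hN⟩
  | seq p q ihp ihq =>
    obtain ⟨T, hT⟩ := ihp hp.1
    obtain ⟨T', hT'⟩ := ihq hp.2
    exact ⟨T + T', fun n s N hN hn h =>
      (add_le_add (hT n s N hN hn h) (hT' n s N hN hn h)).trans (add hN)⟩
  | setN r' e => exact ⟨e.cost + 1, fun n s N hN _ _ => const hN⟩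
  | setR a' i j e => exact ⟨i.cost + j.cost + e.cost + 1, fun n s N hN _ _ => const hN⟩
  | gauss a' i j => exact ⟨i.cost + j.cost + 1, fun n s N hN _ _ => const hN⟩
  | query r' a i =>
    refine ⟨(i.cost + 1) + 1, fun n s N hN hn _ => ?_⟩
    refine le_trans ?_ (add hN)
    have := const (c := i.cost + 1) hN
    simp only [Prog.timeBound, one_mul, pow_one]
    omega
  | ite t p q ihp ihq =>
    obtain ⟨T, hT⟩ := ihp hp.1
    obtain ⟨T', hT'⟩ := ihq hp.2
    refine ⟨(t.cost + 1) + (T + T'), fun n s N hN hn h => le_trans ?_ (add hN)⟩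
    exact add_le_add (const hN) ((add_le_add (hT n s N hN hn h) (hT' n s N hN hn h)).trans (add hN))
  | loop r' e p ihp =>
    obtain ⟨T, hT⟩ := ihp hp.2.2
    obtain ⟨T', hT'⟩ := hp.2.1.eval_le_pow
    refine ⟨(e.cost + 1) + (T' * (1 + T) + (T' + (1 + T))), fun n s N hN hn h =>
      le_trans ?_ (add hN)⟩
    refine add_le_add (const hN) ?_
    have h1 : 1 + p.timeBound n s ≤ (1 + T) * N ^ (1 + T) :=
      (add_le_add (by simpa using hN) (hT n s N hN hn h)).trans (add hN)
    refine (Nat.mul_le_mul (hT' s N hN h) h1).trans ?_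
    calc T' * N ^ T' * ((1 + T) * N ^ (1 + T)) = T' * (1 + T) * N ^ (T' + (1 + T)) := by ring
      _ ≤ _ := Nat.mul_le_mul (by omega) (Nat.pow_le_pow_right hN (by omega))

/-- The bound holds for every stream of random numbers, so integrating it against a probability
measure changes nothing. -/
theorem Prog.Static.expectedTime_le {p : Prog} (hp : p.Static) :
    ∃ T : ℕ, ∀ (n : ℕ) (M : EuclideanSpace ℝ (Fin n) → ℕ) (s : State) (N : ℕ),
      1 ≤ N → n ≤ N → (∀ r < 3, s.nat r ≤ N) → s.time = 0 →
      p.expectedTime M s ≤ (T : ENNReal) * (N : ENNReal) ^ T := by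
  obtain ⟨T, hT⟩ := hp.timeBound_le_pow
  refine ⟨T, fun n M s N hN hn h hs => ?_⟩
  have : ∀ ω, ((p.run M ω s).time : ℝ≥0∞) ≤ (T : ENNReal) * (N : ENNReal) ^ T := fun ω => by
    have := (hp.time_le M ω s s fun _ _ => rfl).trans
      (Nat.add_le_add_left (hT n s N hN hn h) s.time)
    rw [hs, zero_add] at this
    exact_mod_cast this
  calc p.expectedTime M s ≤ ∫⁻ _, (T : ENNReal) * (N : ENNReal) ^ T ∂coins := lintegral_mono this
    _ = _ := by
      have : IsProbabilityMeasure coins := by unfold coins; infer_instance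
      simp

end Time

/-! ### Measurability of runs -/

section Measurability

instance : MeasurableSpace State :=
  MeasurableSpace.comap (fun s => (s.nat, s.arr, s.drawn, s.time)) inferInstance

variable {α : Type*} [MeasurableSpace α]

theorem measurable_state_iff {f : α → State} : Measurable f ↔
    (∀ r, Measurable fun x => (f x).nat r) ∧ (∀ a i j, Measurable fun x => (f x).arr a i j) ∧
      (Measurable fun x => (f x).drawn) ∧ Measurable fun x => (f x).time := by
  rw [measurable_comap_iff]
  simp only [Function.comp_def, measurable_fun_prod, measurable_pi_iff]

/-- Array indices, the draw counter and loop lengths may themselves be random; as they range over a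
countable set, substituting them preserves measurability. -/
theorem measurable_nat_index {β : Type*} [MeasurableSpace β] {g : ℕ → α → β}
    (hg : ∀ m, Measurable (g m)) {k : α → ℕ} (hk : Measurable k) :
    Measurable fun x => g (k x) x :=
  (measurable_from_prod_countable_right (f := fun p : ℕ × α => g p.1 p.2) hg).comp
    (hk.prodMk measurable_id)

theorem NExp.measurable_eval (e : NExp) {f : α → State} (hf : Measurable f) :
    Measurable fun x => e.eval (f x) := by
  have bin : ∀ (F : ℕ → ℕ → ℕ) {u v : α → ℕ}, Measurable u → Measurable v →
      Measurable fun x => F (u x) (v x) := fun F u v hu hv =>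
    (Measurable.of_discrete (f := fun p : ℕ × ℕ => F p.1 p.2)).comp (hu.prodMk hv)
  induction e with
  | const c => exact measurable_const
  | reg r => exact (measurable_state_iff.1 hf).1 r
  | add a b ha hb => exact bin (· + ·) ha hb
  | sub a b ha hb => exact bin (· - ·) ha hb
  | mul a b ha hb => exact bin (· * ·) ha hb

theorem measurable_arr_index {f : α → State} (hf : Measurable f) (a : ℕ) {i j : α → ℕ}
    (hi : Measurable i) (hj : Measurable j) : Measurable fun x => (f x).arr a (i x) (j x) :=
  measurable_nat_index (g := fun m x => (f x).arr a m (j x))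
    (fun m => measurable_nat_index (g := fun l x => (f x).arr a m l)
      (fun l => (measurable_state_iff.1 hf).2.1 a m l) hj) hi

theorem RExp.measurable_eval (e : RExp) {f : α → State} (hf : Measurable f) :
    Measurable fun x => e.eval (f x) := by
  induction e with
  | const c => exact measurable_const
  | ofNat a => exact (measurable_of_countable (fun m : ℕ => (m : ℝ))).comp (a.measurable_eval hf)
  | cell a i j => exact measurable_arr_index hf a (i.measurable_eval hf) (j.measurable_eval hf)
  | add a b ha hb => exact ha.add hb
  | sub a b ha hb => exact ha.sub hb
  | mul a b ha hb => exact ha.mul hb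
  | div a b ha hb => exact ha.div hb
  | sqrt a ha => exact ha.sqrt

theorem Test.measurableSet_holds (t : Test) {f : α → State} (hf : Measurable f) :
    MeasurableSet {x | t.holds (f x)} := by
  cases t with
  | le a b => exact measurableSet_le (a.measurable_eval hf) (b.measurable_eval hf)
  | leN a b => exact measurableSet_le (a.measurable_eval hf) (b.measurable_eval hf)

theorem measurable_tick {f : α → State} (hf : Measurable f) {c : ℕ} :
    Measurable fun x => (f x).tick c := by
  rw [measurable_state_iff] at hf ⊢
  exact ⟨hf.1, hf.2.1, hf.2.2.1, (Measurable.of_discrete (f := fun m : ℕ => m + c)).comp hf.2.2.2⟩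

theorem measurable_writeN {f : α → State} (hf : Measurable f) (r : ℕ) {v : α → ℕ}
    (hv : Measurable v) : Measurable fun x => (f x).writeN r (v x) := by
  rw [measurable_state_iff] at hf ⊢
  refine ⟨fun r' => ?_, hf.2⟩
  by_cases h : r' = r
  · subst h; simpa [State.writeN] using hv
  · simpa [State.writeN, Function.update_of_ne h] using hf.1 r'

theorem measurable_writeR {f : α → State} (hf : Measurable f) (a : ℕ) {i j : α → ℕ}
    (hi : Measurable i) (hj : Measurable j) {v : α → ℝ}
    (hv : Measurable v) : Measurable fun x => (f x).writeR a (i x) (j x) (v x) := by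
  rw [measurable_state_iff] at hf ⊢
  refine ⟨hf.1, fun a' i' j' => ?_, hf.2.2⟩
  have hs : MeasurableSet {x | a' = a ∧ i' = i x ∧ j' = j x} :=
    (MeasurableSet.const _).inter ((measurableSet_eq_fun measurable_const hi).inter
      (measurableSet_eq_fun measurable_const hj))
  exact Measurable.ite hs hv (hf.2.1 a' i' j')

theorem measurable_row {f : α → State} (hf : Measurable f) (n a : ℕ) {i : α → ℕ}
    (hi : Measurable i) : Measurable fun x => (f x).row n a (i x) :=
  (WithLp.measurable_toLp 2 _).comp (measurable_pi_iff.2 fun _ =>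
    measurable_arr_index hf a hi measurable_const)

/-- Runs depend measurably on the random numbers and on the initial state. -/
theorem Prog.measurable_run {n : ℕ} {M : EuclideanSpace ℝ (Fin n) → ℕ} (hM : Measurable M)
    (p : Prog) {W : α → ℕ → ℝ} (hW : Measurable W) {f : α → State} (hf : Measurable f) :
    Measurable fun x => p.run M (W x) (f x) := by
  induction p generalizing f with
  | skip => exact measurable_tick hf
  | seq p q ihp ihq => exact ihq (ihp hf)
  | setN r e => exact measurable_tick (measurable_writeN hf r (e.measurable_eval hf))
  | setR a i j e =>
    exact measurable_tick (measurable_writeR hf a (i.measurable_eval hf) (j.measurable_eval hf)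
      (e.measurable_eval hf))
  | gauss a i j =>
    have hd := (measurable_state_iff.1 hf).2.2.1
    have h := measurable_tick (c := i.cost + j.cost + 1) (measurable_writeR hf a
      (i.measurable_eval hf) (j.measurable_eval hf)
      (v := fun x => W x (f x).drawn) (measurable_nat_index (g := fun m x => W x m)
        (fun m => (measurable_pi_apply m).comp hW) hd))
    rw [measurable_state_iff] at h ⊢
    exact ⟨h.1, h.2.1, (Measurable.of_discrete (f := fun m : ℕ => m + 1)).comp hd, h.2.2.2⟩
  | query r a i =>
    exact measurable_tick (measurable_writeN hf r
      (hM.comp (measurable_row hf n a (i.measurable_eval hf))))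
  | ite t p q ihp ihq =>
    simp only [Prog.run]
    exact Measurable.ite (t.measurableSet_holds hf) (ihp (measurable_tick hf))
      (ihq (measurable_tick hf))
  | loop r e p ihp =>
    simp only [Prog.run]
    have key : ∀ (l : List ℕ) {g : α → State}, Measurable g → Measurable fun x =>
        l.foldl (fun s' m => p.run M (W x) ((s'.writeN r m).tick 1)) (g x) := by
      intro l
      induction l with
      | nil => exact fun hg => hg
      | cons a l ih =>
        exact fun hg => ih (ihp (measurable_tick (measurable_writeN hg r measurable_const)))
    exact measurable_nat_index (g := fun m x => (List.range m).foldl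
      (fun s' m => p.run M (W x) ((s'.writeN r m).tick 1)) ((f x).tick (e.cost + 1)))
      (fun m => key _ (measurable_tick hf)) (e.measurable_eval hf)

end Measurability

end RAM

/-! ### Gaussian anticoncentration and tails -/

section Gaussian

/-- The strip is an interval of length `2 * θ / β`, and the Gaussian density is at most `1 / 2`
because `√(2π) ≥ 2`. -/
theorem gaussianReal_strip_le {β θ : ℝ} (hβ : 0 < β) (c : ℝ) :
    gaussianReal 0 1 {t | |c - β * t| ≤ θ} ≤ ENNReal.ofReal (θ / β) := by
  have hset : {t | |c - β * t| ≤ θ} = Set.Icc ((c - θ) / β) ((c + θ) / β) := by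
    ext t
    simp only [Set.mem_ofPred_eq, Set.mem_Icc, abs_le, div_le_iff₀ hβ, le_div_iff₀ hβ]
    constructor <;> rintro ⟨h1, h2⟩ <;> constructor <;> linarith
  have hpdf : ∀ t, gaussianPDF 0 1 t ≤ ENNReal.ofReal (1 / 2) := by
    intro t
    refine ENNReal.ofReal_le_ofReal ?_
    rw [gaussianPDFReal]
    have h1 : (2 : ℝ) ≤ √(2 * Real.pi * (1 : NNReal)) := by
      apply Real.le_sqrt_of_sq_le
      have := Real.pi_gt_three
      norm_num
      linarith
    have h2 : Real.exp (-(t - 0) ^ 2 / (2 * (1 : NNReal))) ≤ 1 := by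
      apply Real.exp_le_one_iff.2
      have := sq_nonneg (t - 0)
      simp only [NNReal.coe_one]
      linarith
    calc _ ≤ (2 : ℝ)⁻¹ * 1 := by gcongr
      _ = 1 / 2 := by norm_num
  rw [gaussianReal_apply 0 one_ne_zero, hset]
  calc ∫⁻ x in Set.Icc ((c - θ) / β) ((c + θ) / β), gaussianPDF 0 1 x
      ≤ ∫⁻ _ in Set.Icc ((c - θ) / β) ((c + θ) / β), ENNReal.ofReal (1 / 2) :=
        lintegral_mono hpdf
    _ = ENNReal.ofReal (θ / β) := by
      rw [setLIntegral_const, Real.volume_Icc, ← ENNReal.ofReal_mul (by norm_num)]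
      congr 1
      field_simp
      ring

variable {E : Type*} [NormedAddCommGroup E] [InnerProductSpace ℝ E] [FiniteDimensional ℝ E]
  [MeasurableSpace E] [BorelSpace E]

/-- A standard Gaussian vector can be resampled in the direction of a unit vector. -/
theorem stdGaussian_resample {b : E} (hb : ‖b‖ = 1) :
    ((stdGaussian E).prod (gaussianReal 0 1)).map
      (fun p => p.1 - inner ℝ b p.1 • b + p.2 • b) = stdGaussian E := by
  have hm : Measurable fun p : E × ℝ => p.1 - inner ℝ b p.1 • b + p.2 • b := by fun_prop
  have : IsProbabilityMeasure (((stdGaussian E).prod (gaussianReal 0 1)).map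
      (fun p => p.1 - inner ℝ b p.1 • b + p.2 • b)) :=
    Measure.isProbabilityMeasure_map hm.aemeasurable
  apply Measure.ext_of_charFun
  ext t
  rw [charFun_stdGaussian, charFun_apply, integral_map hm.aemeasurable
    (Measurable.aestronglyMeasurable (by fun_prop))]
  -- The exponent splits into the part of `t` orthogonal to `b`, seen by the old vector, and `⟪b,
  -- t⟫`, seen by the fresh coordinate. Independence multiplies the two characteristic functions,
  -- and Pythagoras recombines the exponents.
  have key : ∀ p : E × ℝ, Complex.exp (inner ℝ (p.1 - inner ℝ b p.1 • b + p.2 • b) t * Complex.I)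
      = Complex.exp (inner ℝ p.1 (t - inner ℝ b t • b) * Complex.I) *
        Complex.exp (((inner ℝ b t : ℝ) : ℂ) * p.2 * Complex.I) := by
    intro p
    rw [← Complex.exp_add]
    congr 1
    simp only [inner_add_left, inner_sub_left, inner_sub_right, real_inner_smul_left,
      real_inner_smul_right, real_inner_comm p.1 b]
    push_cast
    ring
  simp_rw [key]
  rw [integral_prod_mul (f := fun x : E => Complex.exp (inner ℝ x (t - inner ℝ b t • b) * Complex.I))
    (g := fun x : ℝ => Complex.exp (((inner ℝ b t : ℝ) : ℂ) * x * Complex.I)),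
    ← charFun_apply, ← charFun_apply_real, charFun_stdGaussian, charFun_gaussianReal,
    ← Complex.exp_add]
  congr 1
  have h : ‖t - inner ℝ b t • b‖ ^ 2 = ‖t‖ ^ 2 - (inner ℝ b t) ^ 2 := by
    rw [norm_sub_sq_real, norm_smul, hb, real_inner_smul_right, real_inner_comm]
    simp only [Real.norm_eq_abs, mul_one, sq_abs]
    ring
  have h' : ((‖t - inner ℝ b t • b‖ : ℝ) : ℂ) ^ 2 = (‖t‖ : ℂ) ^ 2 - ((inner ℝ b t : ℝ) : ℂ) ^ 2 := by
    exact_mod_cast h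
  rw [h']
  push_cast
  ring

/-- If a random function of a standard Gaussian vector is affine with slope `-β` along some unit
direction, then it takes values in `[-θ, θ]` with probability at most `θ / β`. -/
theorem stdGaussian_strip_le {b : E} (hb : ‖b‖ = 1) {β θ : ℝ} (hβ : 0 < β) {F : E → ℝ}
    (hF : Measurable F) (h : ∀ x t, F (x + t • b) = F x - β * t) :
    stdGaussian E {x | |F x| ≤ θ} ≤ ENNReal.ofReal (θ / β) := by
  have hm : Measurable fun p : E × ℝ => p.1 - inner ℝ b p.1 • b + p.2 • b := by fun_prop
  have hs : MeasurableSet {x | |F x| ≤ θ} := measurableSet_le (by fun_prop) measurable_const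
  -- Resampling along `b` and conditioning on the old vector reduces the claim to the
  -- one-dimensional strip.
  rw [← stdGaussian_resample hb, Measure.map_apply hm hs, Measure.prod_apply (hm hs)]
  calc _ ≤ ∫⁻ _, ENNReal.ofReal (θ / β) ∂(stdGaussian E) := by
        refine lintegral_mono fun x => ?_
        refine le_trans (le_of_eq ?_) (gaussianReal_strip_le hβ (F (x - inner ℝ b x • b)))
        congr 1
        ext t
        simp [h]
    _ = _ := by simp

/-- Markov's inequality for `‖x‖ ^ 2`, whose mean is `n`. This weak tail suffices because `X` will
be exponential in `N`. -/
theorem stdGaussian_norm_gt_le (n : ℕ) {X : ℝ} (hX : 0 < X) :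
    stdGaussian (EuclideanSpace ℝ (Fin n)) {x | X < ‖x‖} ≤ ENNReal.ofReal (n / X ^ 2) := by
  have hint : ∀ i : Fin n, ∫⁻ x, ENNReal.ofReal (x i ^ 2)
      ∂(stdGaussian (EuclideanSpace ℝ (Fin n))) = 1 := by
    intro i
    rw [← map_pi_eq_stdGaussian, lintegral_map (by fun_prop) (by fun_prop)]
    rw [(measurePreserving_eval (fun _ : Fin n => gaussianReal 0 1) i).lintegral_comp
      (f := fun t => ENNReal.ofReal (t ^ 2)) (by fun_prop)]
    rw [← ofReal_integral_eq_lintegral_ofReal]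
    · have h := variance_id_gaussianReal (μ := 0) (v := 1)
      rw [variance_of_integral_eq_zero (by fun_prop) (by simp)] at h
      simp only [id] at h
      rw [h]; simp
    · exact (memLp_id_gaussianReal' (μ := 0) (v := 1) 2 (by simp)).integrable_sq
    · exact Filter.Eventually.of_forall fun t => sq_nonneg t
  have htot : ∫⁻ x, ENNReal.ofReal (‖x‖ ^ 2) ∂(stdGaussian (EuclideanSpace ℝ (Fin n))) = n := by
    simp_rw [EuclideanSpace.real_norm_sq_eq]
    simp_rw [ENNReal.ofReal_sum_of_nonneg (fun i _ => sq_nonneg _)]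
    rw [lintegral_finsetSum _ (fun i _ => by fun_prop)]
    simp [hint]
  have := mul_meas_ge_le_lintegral (μ := stdGaussian (EuclideanSpace ℝ (Fin n)))
    (f := fun x => ENNReal.ofReal (‖x‖ ^ 2)) (by fun_prop) (ENNReal.ofReal (X ^ 2))
  rw [htot] at this
  have hX2 : 0 < X ^ 2 := by positivity
  rw [ENNReal.ofReal_div_of_pos hX2, ENNReal.le_div_iff_mul_le
    (Or.inl (by simpa using hX.ne')) (Or.inl (by simp)), mul_comm, ENNReal.ofReal_natCast]
  refine le_trans ?_ this
  refine mul_le_mul_right (measure_mono fun x hx => ?_) _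
  exact ENNReal.ofReal_le_ofReal (pow_le_pow_left₀ hX.le (le_of_lt hx) 2)

end Gaussian

/-! ### Splitting the stream of random numbers -/

namespace RAM

instance : IsProbabilityMeasure coins := by unfold coins; infer_instance

/-- The sequence whose first `D` terms are those of `ω`, followed by `ω'`. -/
def glue (D : ℕ) (ω ω' : ℕ → ℝ) : ℕ → ℝ := fun i => if i < D then ω i else ω' (i - D)

/-- The sequence that starts with the coordinates of `g`, followed by `ω`. -/
def prepend {n : ℕ} (g : EuclideanSpace ℝ (Fin n)) (ω : ℕ → ℝ) : ℕ → ℝ :=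
  fun i => if h : i < n then g ⟨i, h⟩ else ω (i - n)

theorem prepend_of_lt {n : ℕ} (g : EuclideanSpace ℝ (Fin n)) (ω : ℕ → ℝ) (i : Fin n) :
    prepend g ω i = g i := by simp [prepend]

theorem prepend_add {n : ℕ} (g : EuclideanSpace ℝ (Fin n)) (ω : ℕ → ℝ) (i : ℕ) :
    prepend g ω (n + i) = ω i := by simp [prepend]

theorem glue_add (D : ℕ) (ω ω' : ℕ → ℝ) (i : ℕ) : glue D ω ω' (D + i) = ω' i := by simp [glue]

theorem measurable_glue (D : ℕ) (ω : ℕ → ℝ) : Measurable (glue D ω) := by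
  refine measurable_pi_iff.2 fun i => ?_
  unfold glue
  split_ifs <;> fun_prop

theorem measurable_prepend {n : ℕ} : Measurable fun p : EuclideanSpace ℝ (Fin n) × (ℕ → ℝ) =>
    prepend p.1 p.2 := by
  refine measurable_pi_iff.2 fun i => ?_
  unfold prepend
  split_ifs <;> fun_prop

/-- This is what allows conditioning on a round: the first `n` draws form a Gaussian vector, and the
remaining stream is independent of it and has the original law. Both laws are compared on finite
boxes, whose coordinates are sorted into those below `n` and those from `n` on. -/
theorem measurePreserving_prepend (n : ℕ) : MeasurePreserving
    (fun p : EuclideanSpace ℝ (Fin n) × (ℕ → ℝ) => prepend p.1 p.2)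
    ((stdGaussian (EuclideanSpace ℝ (Fin n))).prod coins) coins := by
  refine ⟨measurable_prepend, Measure.eq_infinitePi _ fun s t ht => ?_⟩
  classical
  rw [Measure.map_apply measurable_prepend (MeasurableSet.pi s.countable_toSet fun i _ => ht i)]
  set s₂ : Finset ℕ := (s.filter (n ≤ ·)).image (· - n) with hs₂
  have hmem : ∀ i, i ∈ s₂ ↔ n + i ∈ s := by
    intro i
    simp only [hs₂, Finset.mem_image, Finset.mem_filter]
    constructor
    · rintro ⟨j, ⟨hj, hnj⟩, rfl⟩
      rwa [Nat.add_sub_cancel' hnj]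
    · exact fun h => ⟨n + i, ⟨h, by omega⟩, by omega⟩
  have hset : (fun p : EuclideanSpace ℝ (Fin n) × (ℕ → ℝ) => prepend p.1 p.2) ⁻¹'
      (Set.pi s t) = {g | ∀ i : Fin n, (i : ℕ) ∈ s → g i ∈ t i} ×ˢ
        Set.pi s₂ (fun i => t (n + i)) := by
    ext ⟨g, ω⟩
    simp only [Set.mem_preimage, Set.mem_pi, Set.mem_prod, Set.mem_ofPred_eq, Finset.mem_coe, hmem]
    constructor
    · intro h
      exact ⟨fun i hi => prepend_of_lt g ω i ▸ h i hi, fun i hi => prepend_add g ω i ▸ h _ hi⟩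
    · rintro ⟨h1, h2⟩ i hi
      by_cases hin : i < n
      · have := h1 ⟨i, hin⟩ hi
        rwa [← prepend_of_lt g ω ⟨i, hin⟩] at this
      · have h3 : n + (i - n) = i := by omega
        have := h2 (i - n) (h3.symm ▸ hi)
        rw [← prepend_add g ω (i - n)] at this
        rwa [h3] at this
  have hset1 : (WithLp.toLp 2 : (Fin n → ℝ) → EuclideanSpace ℝ (Fin n)) ⁻¹'
      {g | ∀ i : Fin n, (i : ℕ) ∈ s → g i ∈ t i} =
      Set.pi Set.univ fun i : Fin n => if (i : ℕ) ∈ s then t i else Set.univ := by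
    ext g
    simp only [Set.mem_preimage, Set.mem_ofPred_eq, Set.mem_pi, Set.mem_univ, true_implies]
    refine forall_congr' fun i => ?_
    split_ifs with h <;> simp [h]
  have hms : MeasurableSet {g : EuclideanSpace ℝ (Fin n) | ∀ i : Fin n, (i : ℕ) ∈ s → g i ∈ t i} := by
    simp only [Set.ofPred_forall]
    refine MeasurableSet.iInter fun i => MeasurableSet.iInter fun _ => ?_
    exact (ht i).preimage (by fun_prop)
  rw [hset, Measure.prod_prod, ← map_pi_eq_stdGaussian, Measure.map_apply (by fun_prop) hms, hset1,
    Measure.pi_pi, coins, Measure.infinitePi_pi _ (fun i _ => ht _)]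
  have h1 : ∏ i : Fin n, gaussianReal 0 1 (if (i : ℕ) ∈ s then t i else Set.univ) =
      ∏ i ∈ s.filter (· < n), gaussianReal 0 1 (t i) := by
    rw [Fin.prod_univ_eq_prod_range (fun i => gaussianReal 0 1 (if i ∈ s then t i else Set.univ)) n]
    simp only [apply_ite (gaussianReal 0 1), measure_univ]
    rw [← Finset.prod_filter]
    refine Finset.prod_congr ?_ fun _ _ => rfl
    ext i
    simp [and_comm]
  have h2 : ∏ i ∈ s₂, gaussianReal 0 1 (t (n + i)) =
      ∏ i ∈ s.filter (n ≤ ·), gaussianReal 0 1 (t i) := by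
    rw [hs₂, Finset.prod_image]
    · refine Finset.prod_congr rfl fun i hi => ?_
      rw [Nat.add_sub_cancel' (Finset.mem_filter.1 hi).2]
    · intro i hi j hj hij
      have h1 := (Finset.mem_filter.1 (Finset.mem_coe.1 hi)).2
      have h2 := (Finset.mem_filter.1 (Finset.mem_coe.1 hj)).2
      simp only at hij
      omega
  rw [h1, h2, ← Finset.prod_filter_mul_prod_filter_not s (· < n)]
  simp only [not_lt]

end RAM

/-! ### Maps with a uniform first-order Taylor bound -/

/-- `D` is a derivative of `F`, bounded by `Γ`, with quadratic error bounded by `B`. -/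
structure QuadBound {E G : Type*} [NormedAddCommGroup E] [NormedSpace ℝ E]
    [NormedAddCommGroup G] [NormedSpace ℝ G] (F : E → G) (D : E → E →L[ℝ] G) (Γ B : ℝ) : Prop where
  norm_le : ∀ x h, ‖D x h‖ ≤ Γ * ‖h‖
  lip : ∀ x h, ‖F (x + h) - F x‖ ≤ Γ * ‖h‖
  quad : ∀ x h, ‖F (x + h) - F x - D x h‖ ≤ B * ‖h‖ ^ 2

/-- The mean value inequality applied to `φ t - φ' z * t` on the segment, whose derivative is at
most `L * |a|` there since `φ'` is `L`-Lipschitz. No continuity of `φ''` is needed. -/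
theorem abs_taylor_le {φ : ℝ → ℝ} {L : ℝ} (h1 : Differentiable ℝ φ) (h2 : Differentiable ℝ (deriv φ))
    (h3 : ∀ t, |deriv (deriv φ) t| ≤ L) (z a : ℝ) :
    |φ (z + a) - φ z - deriv φ z * a| ≤ L * |a| * |a| := by
  have hlip : ∀ t, |deriv φ t - deriv φ z| ≤ L * |t - z| := fun t => by
    simpa using Convex.norm_image_sub_le_of_norm_deriv_le (f := deriv φ) (s := Set.univ) (C := L)
      (fun x _ => h2 x) (fun x _ => h3 x) convex_univ (Set.mem_univ z) (Set.mem_univ t)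
  have hg : ∀ t, HasDerivAt (fun t => φ t - deriv φ z * t) (deriv φ t - deriv φ z) t := fun t => by
    simpa using (h1 t).hasDerivAt.fun_sub ((hasDerivAt_id t).const_mul (deriv φ z))
  have key := Convex.norm_image_sub_le_of_norm_hasDerivWithin_le
    (f := fun t => φ t - deriv φ z * t) (s := segment ℝ z (z + a)) (C := L * |a|)
    (f' := fun t => deriv φ t - deriv φ z) (fun t _ => (hg t).hasDerivWithinAt)
    (fun t ht => by
      refine (hlip t).trans (mul_le_mul_of_nonneg_left ?_ ((abs_nonneg _).trans (h3 0)))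
      obtain ⟨u, v, hu, hv, huv, rfl⟩ := ht
      have : u • z + v • (z + a) - z = v * a := by
        simp only [smul_eq_mul]; linear_combination (z) * huv
      rw [this, abs_mul, abs_of_nonneg hv]
      exact mul_le_of_le_one_left (abs_nonneg a) (by linarith))
    (convex_segment z (z + a)) (left_mem_segment ℝ z _) (right_mem_segment ℝ z _)
  simp only [Real.norm_eq_abs, add_sub_cancel_left] at key
  convert key using 2
  ring

theorem abs_sub_le_of_deriv {φ : ℝ → ℝ} {L : ℝ} (h1 : Differentiable ℝ φ)
    (h3 : ∀ t, |deriv φ t| ≤ L) (z a : ℝ) : |φ (z + a) - φ z| ≤ L * |a| := by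
  simpa using Convex.norm_image_sub_le_of_norm_deriv_le (f := φ) (s := Set.univ) (C := L)
      (fun x _ => h1 x) (fun x _ => h3 x) convex_univ (Set.mem_univ z) (Set.mem_univ (z + a))

theorem EuclideanSpace.norm_le_of_abs_le {ι : Type*} [Fintype ι] {u a : EuclideanSpace ℝ ι} {c : ℝ}
    (hc : 0 ≤ c) (h : ∀ i, |u i| ≤ c * |a i|) : ‖u‖ ≤ c * ‖a‖ := by
  refine le_of_sq_le_sq ?_ (by positivity)
  rw [mul_pow, EuclideanSpace.real_norm_sq_eq, EuclideanSpace.real_norm_sq_eq, Finset.mul_sum]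
  refine Finset.sum_le_sum fun i _ => ?_
  have := pow_le_pow_left₀ (abs_nonneg _) (h i) 2
  rwa [mul_pow, sq_abs, sq_abs] at this

theorem le_exp_posLog (x : ℝ) : x ≤ Real.exp (Real.posLog x) := by
  rcases le_or_gt x 0 with hx | hx
  · exact hx.trans (Real.exp_pos _).le
  · calc x = Real.exp (Real.log x) := (Real.exp_log hx).symm
      _ ≤ _ := Real.exp_le_exp.2 (le_max_right _ _)

namespace QuadBound

variable {E G : Type*} [NormedAddCommGroup E] [NormedSpace ℝ E]
    [NormedAddCommGroup G] [NormedSpace ℝ G] {F : E → G} {D : E → E →L[ℝ] G} {Γ B : ℝ}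

theorem mono (h : QuadBound F D Γ B) {Γ' B' : ℝ} (hΓ : Γ ≤ Γ') (hB : B ≤ B') :
    QuadBound F D Γ' B' where
  norm_le x v := (h.norm_le x v).trans (by gcongr)
  lip x v := (h.lip x v).trans (by gcongr)
  quad x v := (h.quad x v).trans (by gcongr)

theorem comp_clm (h : QuadBound F D Γ B) {H : Type*} [NormedAddCommGroup H] [NormedSpace ℝ H]
    (T : G →L[ℝ] H) {c : ℝ} (hc : 0 ≤ c) (hT : ∀ v, ‖T v‖ ≤ c * ‖v‖) :
    QuadBound (fun x => T (F x)) (fun x => T ∘L D x) (c * Γ) (c * B) where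
  norm_le x v := by
    rw [mul_assoc]
    exact (hT _).trans (mul_le_mul_of_nonneg_left (h.norm_le x v) hc)
  lip x v := by
    rw [mul_assoc, ← map_sub]
    exact (hT _).trans (mul_le_mul_of_nonneg_left (h.lip x v) hc)
  quad x v := by
    rw [mul_assoc, ContinuousLinearMap.comp_apply, ← map_sub, ← map_sub]
    exact (hT _).trans (mul_le_mul_of_nonneg_left (h.quad x v) hc)

theorem continuous (h : QuadBound F D Γ B) : Continuous F := by
  refine (LipschitzWith.of_dist_le_mul (K := Γ.toNNReal) fun x y => ?_).continuous
  rw [dist_eq_norm, dist_eq_norm]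
  have := h.lip y (x - y)
  rw [add_sub_cancel] at this
  exact this.trans (mul_le_mul_of_nonneg_right (Real.le_coe_toNNReal _) (norm_nonneg _))

theorem hasFDerivAt (h : QuadBound F D Γ B) (x : E) : HasFDerivAt F (D x) x := by
  rw [hasFDerivAt_iff_isLittleO_nhds_zero]
  refine Asymptotics.IsBigO.trans_isLittleO (g := fun v : E => ‖v‖ ^ 2)
    (Asymptotics.IsBigO.of_bound B (Filter.Eventually.of_forall fun v => ?_)) ?_
  · simpa using h.quad x v
  · simpa using Asymptotics.isLittleO_norm_pow_id (E' := E) one_lt_two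

/-- Entrywise application of a function with bounded first and second derivatives. -/
theorem entrywise {m : ℕ} {F : E → EuclideanSpace ℝ (Fin m)} {D : E → E →L[ℝ] EuclideanSpace ℝ (Fin m)}
    (h : QuadBound F D Γ B) {φ : ℝ → ℝ} {L : ℝ} (h1 : Differentiable ℝ φ)
    (h2 : Differentiable ℝ (deriv φ)) (h3 : ∀ t, |deriv φ t| ≤ L)
    (h4 : ∀ t, |deriv (deriv φ) t| ≤ L) :
    ∃ D', QuadBound (fun x => WithLp.toLp 2 fun i => φ (F x i)) D' (L * Γ) (L * (Γ ^ 2 + B)) := by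
  have hL : 0 ≤ L := (abs_nonneg _).trans (h3 0)
  set Δ : E → EuclideanSpace ℝ (Fin m) →L[ℝ] EuclideanSpace ℝ (Fin m) := fun x =>
    (Matrix.toEuclideanLin (Matrix.diagonal fun i => deriv φ (F x i))).toContinuousLinearMap with hΔ
  have hΔa : ∀ x v i, Δ x v i = deriv φ (F x i) * v i := fun x v i => by
    simp [hΔ, Matrix.toLpLin_apply, Matrix.mulVec_diagonal]
  have hΔn : ∀ x v, ‖Δ x v‖ ≤ L * ‖v‖ := fun x v =>
    EuclideanSpace.norm_le_of_abs_le hL fun i => by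
      rw [hΔa, abs_mul]
      exact mul_le_mul_of_nonneg_right (h3 _) (abs_nonneg _)
  refine ⟨fun x => Δ x ∘L D x, ⟨fun x v => ?_, fun x v => ?_, fun x v => ?_⟩⟩
  · rw [mul_assoc]
    exact (hΔn x _).trans (mul_le_mul_of_nonneg_left (h.norm_le x v) hL)
  · rw [mul_assoc]
    refine le_trans ?_ (mul_le_mul_of_nonneg_left (h.lip x v) hL)
    refine EuclideanSpace.norm_le_of_abs_le hL fun i => ?_
    have := abs_sub_le_of_deriv h1 h3 (F x i) (F (x + v) i - F x i)
    simpa using this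
  · set a := F (x + v) - F x with ha
    -- Two sources of error: the Taylor remainder of `φ` for the true increment `a`, and the error
    -- of `F` itself, transported by the diagonal matrix `Δ x` of norm at most `L`.
    have e : (WithLp.toLp 2 fun i => φ (F (x + v) i)) - (WithLp.toLp 2 fun i => φ (F x i)) -
        (Δ x ∘L D x) v = ((WithLp.toLp 2 fun i => φ (F (x + v) i)) -
          (WithLp.toLp 2 fun i => φ (F x i)) - Δ x a) + Δ x (a - D x v) := by
      rw [(Δ x).map_sub a (D x v), ContinuousLinearMap.comp_apply]; abel
    rw [e]
    have b1 : ‖(WithLp.toLp 2 fun i => φ (F (x + v) i)) -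
          (WithLp.toLp 2 fun i => φ (F x i)) - Δ x a‖ ≤ L * ‖a‖ * ‖a‖ := by
      refine EuclideanSpace.norm_le_of_abs_le (by positivity) fun i => ?_
      have t := abs_taylor_le h1 h2 h4 (F x i) (a i)
      have hai : F x i + a i = F (x + v) i := by simp [ha]
      rw [hai] at t
      simp only [PiLp.sub_apply, hΔa]
      refine t.trans (mul_le_mul_of_nonneg_right (mul_le_mul_of_nonneg_left ?_ hL) (abs_nonneg _))
      exact PiLp.norm_apply_le a i
    have b2 := (hΔn x (a - D x v)).trans (mul_le_mul_of_nonneg_left (h.quad x v) hL)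
    have b3 : ‖a‖ ≤ Γ * ‖v‖ := h.lip x v
    have b4 : ‖a‖ * ‖a‖ ≤ (Γ * ‖v‖) * (Γ * ‖v‖) :=
      mul_le_mul b3 b3 (norm_nonneg _) ((norm_nonneg _).trans b3)
    refine (norm_add_le _ _).trans ?_
    nlinarith [mul_le_mul_of_nonneg_left b4 hL]

end QuadBound

/-! ### Smoothness and symmetry of the network -/

namespace Network

variable {n : ℕ} (net : Network n)

theorem specNorm_bound {p q : ℕ} (Q : Matrix (Fin p) (Fin q) ℝ) (v : EuclideanSpace ℝ (Fin q)) :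
    ‖(Matrix.toEuclideanLin Q).toContinuousLinearMap v‖ ≤ Real.exp (Real.posLog (specNorm Q)) * ‖v‖ := by
  refine (ContinuousLinearMap.le_opNorm _ v).trans (mul_le_mul_of_nonneg_right ?_ (norm_nonneg _))
  exact le_exp_posLog _

/-- `layers` consumes its input from the innermost layer outwards, so the induction must allow an
arbitrary inner map `F`. Writing the quadratic constant as `m * Γ ^ 2` makes it propagate simply: an
activation adds a term `Γ ^ 2`, so `m` grows by one per layer, while `Γ` is multiplied by factors `≥
1`. -/
theorem exists_quadBound_layers {L : ℕ → ℝ} {γ η : ℝ} (h : net.Admissible L γ η)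
    {E : Type*} [NormedAddCommGroup E] [NormedSpace ℝ E] (j : ℕ) (hj : j ≤ net.depth) :
    ∀ (F : E → EuclideanSpace ℝ (Fin (net.width j))) (D : E → E →L[ℝ] _) (Γ m : ℝ), 0 ≤ m →
      QuadBound F D Γ (m * Γ ^ 2) →
      ∃ D', QuadBound (fun x => (WithLp.toLp 2 (net.layers j (F x)) : EuclideanSpace ℝ _)) D'
        (Γ * Real.exp (∑ i ∈ Finset.range j, (Real.posLog (L i) + Real.posLog (specNorm (net.W i)))))
        ((m + j) * (Γ * Real.exp (∑ i ∈ Finset.range j,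
          (Real.posLog (L i) + Real.posLog (specNorm (net.W i))))) ^ 2) := by
  induction j with
  | zero =>
    intro F D Γ m hm hF
    refine ⟨D, ?_⟩
    simpa [layers] using hF
  | succ j ih =>
    intro F D Γ m hm hF
    have hj' : j < net.depth := hj
    obtain ⟨D₁, h₁⟩ := hF.entrywise (h.differentiable j hj') (h.differentiable_deriv j hj')
      (h.deriv_le j hj') (h.deriv_deriv_le j hj')
    have h₂ := h₁.comp_clm (Matrix.toEuclideanLin (net.W j)).toContinuousLinearMap
      (Real.exp_pos _).le (specNorm_bound (net.W j))
    set w := Real.exp (Real.posLog (specNorm (net.W j)))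
    set l := Real.exp (Real.posLog (L j)) with hl
    have hw1 : 1 ≤ w := Real.one_le_exp Real.posLog_nonneg
    have hl1 : 1 ≤ l := Real.one_le_exp Real.posLog_nonneg
    have hLl : L j ≤ l := le_exp_posLog _
    have hL0 : 0 ≤ L j := (abs_nonneg _).trans (h.deriv_le j hj' 0)
    -- `0 ≤ Γ` can be read off from the Lipschitz bound only when there is a nonzero vector; on the
    -- zero space every bound is trivial.
    by_cases hE : ∃ v : E, v ≠ 0
    swap
    · push Not at hE
      refine ⟨0, ⟨fun x v => ?_, fun x v => ?_, fun x v => ?_⟩⟩ <;> simp [hE v]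
    obtain ⟨v, hv⟩ := hE
    have hΓ : 0 ≤ Γ := by
      have := (norm_nonneg _).trans (hF.lip 0 v)
      exact nonneg_of_mul_nonneg_left this (norm_pos_iff.2 hv)
    have h₃ := h₂.mono (Γ' := w * l * Γ) (B' := (m + 1) * (w * l * Γ) ^ 2)
      (by rw [mul_assoc]; gcongr)
      (by
        have e1 : w * (L j * (Γ ^ 2 + m * Γ ^ 2)) ≤ w * (l * (Γ ^ 2 + m * Γ ^ 2)) := by gcongr
        have hwl : 1 ≤ w * l := one_le_mul_of_one_le_of_one_le hw1 hl1
        -- The quadratic constant is multiplied by `w * l` only once, but the claimed form needs the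
        -- square; positive logarithms guarantee `w * l ≥ 1`.
        have e2 : w * l ≤ (w * l) ^ 2 := by nlinarith
        have e3 : 0 ≤ (m + 1) * Γ ^ 2 := by positivity
        nlinarith [mul_le_mul_of_nonneg_right e2 e3])
    obtain ⟨D', h'⟩ := ih (Nat.le_of_succ_le hj) _ _ _ (m + 1) (by linarith) h₃
    refine ⟨D', ?_⟩
    have e : w * l * Γ * Real.exp (∑ i ∈ Finset.range j,
        (Real.posLog (L i) + Real.posLog (specNorm (net.W i)))) =
        Γ * Real.exp (∑ i ∈ Finset.range (j + 1),
        (Real.posLog (L i) + Real.posLog (specNorm (net.W i)))) := by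
      rw [Finset.sum_range_succ, Real.exp_add, Real.exp_add]
      ring
    rw [e] at h'
    push_cast
    convert h' using 1
    · funext x
      congr 1
    · ring

/-- The layers give a quadratic constant `depth` times the square of the Lipschitz constant; the
latter is at most `exp S`, and so is `depth`. -/
theorem exists_quadBound {L : ℕ → ℝ} {γ η ε δ : ℝ} (h : net.Admissible L γ η) :
    ∃ D, QuadBound net.sigma D (Real.exp (net.paramSum L γ η ε δ))
      (Real.exp (3 * net.paramSum L γ η ε δ)) := by
  set S := net.paramSum L γ η ε δ
  set A' := (Matrix.toEuclideanLin net.A).toContinuousLinearMap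
  have hA : QuadBound (fun x => A' x) (fun _ => A') (Real.exp (Real.posLog (specNorm net.A)))
      (0 * (Real.exp (Real.posLog (specNorm net.A))) ^ 2) :=
    ⟨fun _ v => specNorm_bound _ v, fun x v => by
      rw [map_add, add_sub_cancel_left]; exact specNorm_bound _ v, fun x v => by simp⟩
  obtain ⟨D, hD⟩ := net.exists_quadBound_layers h net.depth le_rfl _ _ _ 0 le_rfl hA
  have hc := hD.comp_clm (EuclideanSpace.proj (𝕜 := ℝ) (⟨0, by rw [net.width_zero]; exact Nat.one_pos⟩ : Fin (net.width 0)))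
    zero_le_one (fun v => by
      rw [one_mul]; exact PiLp.norm_apply_le v _)
  rw [← Real.exp_add, zero_add, one_mul, one_mul] at hc
  have h1 : 0 ≤ 1 / γ := one_div_nonneg.2 h.γ_pos.le
  have h2 : Real.posLog (specNorm net.A) + ∑ i ∈ Finset.range net.depth,
      (Real.posLog (L i) + Real.posLog (specNorm (net.W i))) + net.depth ≤ S := by
    have h3 : 0 ≤ Real.posLog (1 / η) := Real.posLog_nonneg
    have h4 : 0 ≤ Real.posLog (1 / ε) := Real.posLog_nonneg
    have h5 : 0 ≤ Real.posLog (1 / δ) := Real.posLog_nonneg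
    have h6 : (0 : ℝ) ≤ n := Nat.cast_nonneg n
    have h7 : (0 : ℝ) ≤ net.k := Nat.cast_nonneg _
    simp only [S, paramSum, Finset.sum_add_distrib]
    linarith
  have h0 : (0 : ℝ) ≤ net.depth := Nat.cast_nonneg _
  have h8 : 0 ≤ Real.posLog (specNorm net.A) := Real.posLog_nonneg
  have h9 : 0 ≤ ∑ i ∈ Finset.range net.depth, (Real.posLog (L i) + Real.posLog (specNorm (net.W i))) :=
    Finset.sum_nonneg fun i _ => add_nonneg Real.posLog_nonneg Real.posLog_nonneg
  refine ⟨_, (hc.mono (Real.exp_le_exp.2 (by linarith)) ?_ : QuadBound net.sigma _ _ _)⟩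
  have h10 : (net.depth : ℝ) ≤ Real.exp S :=
    (by linarith : (net.depth : ℝ) ≤ S + 1).trans (Real.add_one_le_exp S)
  calc _ ≤ Real.exp S * Real.exp S ^ 2 := by gcongr; linarith
    _ = Real.exp (3 * S) := by rw [← Real.exp_nat_mul, ← Real.exp_add]; congr 1; push_cast; ring

/-- The origin lies strictly below the threshold, so a segment from `0` to a point with `σ ≥ 1` has
a crossing. With the Lipschitz bound it also keeps such points away from `0`. -/
theorem sigma_zero {L : ℕ → ℝ} {γ η : ℝ} (h : net.Admissible L γ η) : net.sigma 0 = 0 := by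
  have key : ∀ j ≤ net.depth, net.layers j 0 = 0 := by
    intro j
    induction j with
    | zero => intro _; rfl
    | succ j ih =>
      intro hj
      rw [layers]
      have : (fun i => net.φ j ((0 : Fin (net.width (j + 1)) → ℝ) i)) = 0 :=
        funext fun i => h.φ_zero j hj
      rw [this, Matrix.mulVec_zero, ih (Nat.le_of_succ_le hj)]
  rw [sigma]
  have : (net.A *ᵥ fun i => (0 : EuclideanSpace ℝ (Fin n)) i) = 0 :=
    Matrix.mulVec_zero net.A
  rw [this, key _ le_rfl]
  rfl

theorem sigma_add_of_mem_orthogonal {x v : EuclideanSpace ℝ (Fin n)} (hv : v ∈ net.spanAᗮ) :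
    net.sigma (x + v) = net.sigma x := by
  have h : (net.A *ᵥ fun i => v i) = 0 := by
    funext i
    have := (Submodule.mem_orthogonal _ _).1 hv (WithLp.toLp 2 (net.A i))
      (Submodule.subset_span ⟨i, rfl⟩)
    simp only [PiLp.inner_apply, RCLike.inner_apply, conj_trivial] at this
    simp only [Matrix.mulVec, dotProduct, Pi.zero_apply]
    rw [← this]
    exact Finset.sum_congr rfl fun j _ => mul_comm _ _
  have e : (net.A *ᵥ fun i => (x + v) i) = net.A *ᵥ fun i => x i := by
    have : (fun i => (x + v) i) = (fun i => x i) + fun i => v i := rfl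
    rw [this, Matrix.mulVec_add, h, add_zero]
  rw [sigma, e, ← sigma]

end Network

/-! ### Bisection, displacements and the normal estimate -/

noncomputable section

/-- `m` steps of bisection for a `0`-`1`-valued function `f`, from the interval `p`. -/
def bisect (f : ℝ → ℕ) : ℕ → ℝ × ℝ → ℝ × ℝ
  | 0, p => p
  | m + 1, p =>
    if 1 ≤ f (((bisect f m p).1 + (bisect f m p).2) / 2) then
      ((bisect f m p).1, ((bisect f m p).1 + (bisect f m p).2) / 2)
    else (((bisect f m p).1 + (bisect f m p).2) / 2, (bisect f m p).2)

theorem bisect_width (f : ℝ → ℕ) (m : ℕ) (p : ℝ × ℝ) :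
    (bisect f m p).2 - (bisect f m p).1 = (p.2 - p.1) / 2 ^ m := by
  induction m with
  | zero => simp [bisect]
  | succ m ih =>
    rw [bisect]
    split_ifs <;> simp only <;> rw [pow_succ, ← div_div, ← ih] <;> ring

theorem bisect_mem (f : ℝ → ℕ) (m : ℕ) {p : ℝ × ℝ} (hp : p.1 ≤ p.2) :
    p.1 ≤ (bisect f m p).1 ∧ (bisect f m p).1 ≤ (bisect f m p).2 ∧ (bisect f m p).2 ≤ p.2 := by
  induction m with
  | zero => exact ⟨le_rfl, hp, le_rfl⟩
  | succ m ih =>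
    obtain ⟨h1, h2, h3⟩ := ih
    rw [bisect]
    split_ifs <;> refine ⟨?_, ?_, ?_⟩ <;> simp only <;> linarith

theorem bisect_sign (f : ℝ → ℕ) (m : ℕ) {p : ℝ × ℝ} (h1 : ¬ 1 ≤ f p.1) (h2 : 1 ≤ f p.2) :
    ¬ 1 ≤ f (bisect f m p).1 ∧ 1 ≤ f (bisect f m p).2 := by
  induction m with
  | zero => exact ⟨h1, h2⟩
  | succ m ih =>
    rw [bisect]
    split_ifs with h
    · exact ⟨ih.1, h⟩
    · exact ⟨h, ih.2⟩

theorem measurable_bisect {α : Type*} [MeasurableSpace α] {f : α → ℝ → ℕ}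
    (hf : Measurable fun p : α × ℝ => f p.1 p.2) (m : ℕ) (p : ℝ × ℝ) :
    Measurable fun x => bisect (f x) m p := by
  induction m with
  | zero => exact measurable_const
  | succ m ih =>
    have hmid : Measurable fun x => ((bisect (f x) m p).1 + (bisect (f x) m p).2) / 2 :=
      (ih.fst.add ih.snd).div_const 2
    have hs : MeasurableSet {x | 1 ≤ f x (((bisect (f x) m p).1 + (bisect (f x) m p).2) / 2)} :=
      measurableSet_le measurable_const (hf.comp (measurable_id.prodMk hmid))
    exact Measurable.ite hs (ih.fst.prodMk hmid) (hmid.prodMk ih.snd)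

variable {n : ℕ}

/-- The parameter at which the line through `r • z` with direction `y` is found to cross the
decision boundary of `M`, between the parameters `lo` and `hi`. -/
def crossing (M : EuclideanSpace ℝ (Fin n) → ℕ) (I : ℕ) (y : EuclideanSpace ℝ (Fin n)) (r lo hi : ℝ)
    (z : EuclideanSpace ℝ (Fin n)) : ℝ :=
  (bisect (fun t => M (r • z + t • y)) I (lo, hi)).2

/-- The displacement of the crossing caused by moving the line by `r • z`, in multiples of `r`. -/
def displacement (M : EuclideanSpace ℝ (Fin n) → ℕ) (I : ℕ) (y : EuclideanSpace ℝ (Fin n))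
    (r R : ℝ) (z : EuclideanSpace ℝ (Fin n)) : ℝ :=
  (crossing M I y r 0 1 0 - crossing M I y r (crossing M I y r 0 1 0 - R)
    (crossing M I y r 0 1 0 + R) z) / r

/-- The vector of displacements along the coordinate axes. -/
def normalEstimate (M : EuclideanSpace ℝ (Fin n) → ℕ) (I : ℕ) (y : EuclideanSpace ℝ (Fin n))
    (r R : ℝ) : EuclideanSpace ℝ (Fin n) :=
  WithLp.toLp 2 fun l => displacement M I y r R (EuclideanSpace.single l 1)

theorem measurable_displacement {M : EuclideanSpace ℝ (Fin n) → ℕ} (hM : Measurable M) (I : ℕ)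
    (y : EuclideanSpace ℝ (Fin n)) (r R : ℝ) : Measurable (displacement M I y r R) := by
  have : Measurable fun p : EuclideanSpace ℝ (Fin n) × ℝ => M (r • p.1 + p.2 • y) :=
    hM.comp (by fun_prop)
  exact ((measurable_bisect this I _).snd.const_sub _).div_const r

/-- Bisection never leaves its initial interval, whatever the oracle answers. Hence estimates from
bad lines are bounded too, which controls error growth when such an estimate is accepted. -/
theorem abs_displacement_le (M : EuclideanSpace ℝ (Fin n) → ℕ) (I : ℕ)
    (y : EuclideanSpace ℝ (Fin n)) {r R : ℝ} (hr : 0 < r) (hR : 0 ≤ R)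
    (z : EuclideanSpace ℝ (Fin n)) : |displacement M I y r R z| ≤ R / r := by
  rw [displacement, abs_div, abs_of_pos hr]
  gcongr
  set c := crossing M I y r 0 1 0
  obtain ⟨h1, h2, h3⟩ := bisect_mem (fun t => M (r • z + t • y)) I (p := (c - R, c + R))
    (by simp only; linarith)
  simp only at h1 h3
  rw [abs_le, crossing]
  constructor <;> linarith

/-- A vector that predicts the displacement in a random direction is close to any subspace `U`
such that `M` is invariant under `Uᗮ`. -/
theorem stdGaussian_predicts_le {M : EuclideanSpace ℝ (Fin n) → ℕ} (hM : Measurable M) (I : ℕ)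
    {U : Submodule ℝ (EuclideanSpace ℝ (Fin n))}
    (hU : ∀ x, ∀ v ∈ Uᗮ, M (x + v) = M x) (y v : EuclideanSpace ℝ (Fin n)) (r R : ℝ) {θ X : ℝ}
    (hθ : 0 < θ) (hX : 0 < X) (hv : θ * X < ‖v - U.starProjection v‖) :
    stdGaussian (EuclideanSpace ℝ (Fin n))
      {z | |displacement M I y r R z - inner ℝ v z| ≤ θ} ≤ ENNReal.ofReal (1 / X) := by
  set b := v - U.starProjection v with hb
  have hβ : 0 < ‖b‖ := lt_trans (by positivity) hv
  have hbU : b ∈ Uᗮ := U.sub_starProjection_mem_orthogonal v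
  refine (stdGaussian_strip_le (b := ‖b‖⁻¹ • b) (β := ‖b‖) ?_ hβ
    ((measurable_displacement hM I y r R).sub (by fun_prop)) fun x t => ?_).trans ?_
  · rw [norm_smul, norm_inv, norm_norm, inv_mul_cancel₀ hβ.ne']
  -- Moving along `b ∈ Uᗮ` is invisible to `M`, hence to every bisection; only the inner product
  -- reacts, with slope `‖b‖`.
  · have h1 : displacement M I y r R (x + t • ‖b‖⁻¹ • b) = displacement M I y r R x := by
      have : ∀ s : ℝ, M (r • (x + t • ‖b‖⁻¹ • b) + s • y) = M (r • x + s • y) := fun s => by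
        rw [← hU (r • x + s • y) (r • t • ‖b‖⁻¹ • b)
          (Uᗮ.smul_mem _ (Uᗮ.smul_mem _ (Uᗮ.smul_mem _ hbU)))]
        congr 1
        rw [smul_add]; abel
      simp only [displacement, crossing, this]
    have h2 : inner ℝ v b = ‖b‖ ^ 2 := by
      have : v = b + U.starProjection v := by rw [hb]; abel
      nth_rw 1 [this]
      rw [inner_add_left, (Submodule.mem_orthogonal _ _).1 hbU _ (U.starProjection_apply_mem v),
        add_zero, real_inner_self_eq_norm_sq]
    have h3 : inner ℝ v (t • ‖b‖⁻¹ • b) = ‖b‖ * t := by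
      rw [real_inner_smul_right, real_inner_smul_right, h2]
      field_simp
    simp only [Pi.sub_apply]
    rw [h1, inner_add_right, h3]
    ring
  · apply ENNReal.ofReal_le_ofReal
    rw [div_le_div_iff₀ hβ hX]
    linarith

set_option maxHeartbeats 1000000 in
/-- Near a point of the decision boundary at which the directional derivative is not small, the
displacements are almost linear. -/
theorem exists_displacement_approx {σ : EuclideanSpace ℝ (Fin n) → ℝ}
    {D : EuclideanSpace ℝ (Fin n) → EuclideanSpace ℝ (Fin n) →L[ℝ] ℝ} {X r : ℝ}
    (hD : QuadBound σ D X X) (hX : 16 ≤ X) (hr : 0 < r) (hrX : r * X ^ 25 ≤ 1) (h0 : σ 0 = 0)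
    {y : EuclideanSpace ℝ (Fin n)} (hy : ‖y‖ ≤ X) (hy1 : 1 ≤ σ y)
    (hgrad : ∀ c : ℝ, 0 < c → σ (c • y) = 1 → (X ^ 2)⁻¹ ≤ |D (c • y) y|)
    {I : ℕ} (hI : ((2 : ℝ) ^ I)⁻¹ ≤ r ^ 2) :
    ∃ ℓ : EuclideanSpace ℝ (Fin n) →ₗ[ℝ] ℝ, ℓ y = 1 ∧ ∀ z, ‖z‖ ≤ X →
      |displacement (fun x => threshold (σ x)) I y r (r * X ^ 5) z - ℓ z| ≤ r * X ^ 16 := by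
  have hX0 : 0 < X := by linarith
  have hthr : ∀ t : ℝ, 1 ≤ threshold t ↔ 1 ≤ t := fun t => by
    unfold threshold; split_ifs with h <;> simp [h]
  have hr1 : r ≤ 1 / X ^ 25 := by rwa [le_div_iff₀ (by positivity)]
  have hX1 : 1 ≤ X := by linarith
  have small : ∀ m ≤ 25, r * X ^ m ≤ 1 := fun m hm =>
    (mul_le_mul_of_nonneg_left (pow_le_pow_right₀ hX1 hm) hr.le).trans hrX
  set f : ℝ → ℕ := fun t => threshold (σ (r • (0 : EuclideanSpace ℝ (Fin n)) + t • y)) with hf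
  have hfσ : ∀ t, 1 ≤ f t ↔ 1 ≤ σ (t • y) := fun t => by
    simp only [hf, smul_zero, zero_add, hthr]
  have hsg := bisect_sign f I (p := (0, 1)) (by rw [hfσ]; simp [h0]) (by rw [hfσ]; simpa using hy1)
  have hmem := bisect_mem f I (p := (0, 1)) zero_le_one
  have hwid := bisect_width f I (0, 1)
  set lo := (bisect f I (0, 1)).1 with hlo
  set c0 := (bisect f I (0, 1)).2 with hc0
  rw [hfσ, hfσ, not_le] at hsg
  simp only [sub_zero, one_div] at hwid
  have hcont : Continuous fun t : ℝ => σ (t • y) := hD.continuous.comp (by fun_prop)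
  -- A true crossing `c` inside the final bracket, hence within `r ^ 2` of the computed value `c0`.
  obtain ⟨c, ⟨hc1, hc2⟩, hc3⟩ := intermediate_value_Icc hmem.2.1 hcont.continuousOn
    ⟨hsg.1.le, hsg.2⟩
  simp only at hc3 hmem
  have hlc : lo < c := lt_of_le_of_ne hc1 fun h => by rw [← h] at hc3; linarith [hsg.1]
  have hcpos : 0 < c := lt_of_le_of_lt hmem.1 hlc
  set s := D (c • y) y with hs
  have hgr := hgrad c hcpos hc3
  have expand : ∀ (z : EuclideanSpace ℝ (Fin n)) (t T : ℝ), ‖z‖ ≤ X → |t - c| ≤ T →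
      |σ (r • z + t • y) - 1 - (r * D (c • y) z + (t - c) * s)| ≤ X * (r * X + T * X) ^ 2 := by
    intro z t T hz ht
    have e : r • z + t • y = c • y + (r • z + (t - c) • y) := by rw [sub_smul]; abel
    have q := hD.quad (c • y) (r • z + (t - c) • y)
    rw [← e, hc3, map_add, map_smul, map_smul, smul_eq_mul, smul_eq_mul, Real.norm_eq_abs] at q
    refine q.trans (mul_le_mul_of_nonneg_left (pow_le_pow_left₀ (norm_nonneg _) ?_ 2) hX0.le)
    refine (norm_add_le _ _).trans (add_le_add ?_ ?_)
    · rw [norm_smul, Real.norm_eq_abs, abs_of_pos hr]; gcongr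
    · rw [norm_smul, Real.norm_eq_abs]
      exact mul_le_mul ht hy (norm_nonneg _) ((abs_nonneg _).trans ht)
  -- The gradient bound controls only `|s|`. If `s` were negative, `σ` would exceed `1` just before
  -- `c`, but `σ (lo • y) < 1` with `c - lo ≤ r ^ 2`, too close for the quadratic term to
  -- compensate.
  have hspos : (X ^ 2)⁻¹ ≤ s := by
    rcases le_abs'.1 hgr with h | h
    swap
    · exact h
    exfalso
    have q := hD.quad (c • y) ((lo - c) • y)
    have e : c • y + (lo - c) • y = lo • y := by rw [← add_smul]; congr 1; ring
    rw [e, hc3, map_smul, smul_eq_mul, Real.norm_eq_abs, norm_smul, Real.norm_eq_abs, mul_pow,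
      sq_abs] at q
    have q1 := (abs_le.1 q).2
    have q2 := (abs_le.1 q).1
    have hcl : c - lo ≤ r ^ 2 := by linarith
    have hy2 : ‖y‖ ^ 2 ≤ X ^ 2 := pow_le_pow_left₀ (norm_nonneg _) hy 2
    have q3 : (c - lo) * (X ^ 2)⁻¹ ≤ (lo - c) * s := by
      have := mul_le_mul_of_nonneg_left (by linarith : (X ^ 2)⁻¹ ≤ -s) (by linarith : 0 ≤ c - lo)
      linarith
    have q4 : (c - lo) * (X ^ 2)⁻¹ < X * ((lo - c) ^ 2 * X ^ 2) := by
      have : X * ((lo - c) ^ 2 * ‖y‖ ^ 2) ≤ X * ((lo - c) ^ 2 * X ^ 2) := by gcongr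
      linarith [hsg.1]
    have q5 : (X ^ 2)⁻¹ < X * ((c - lo) * X ^ 2) := by
      have : X * ((lo - c) ^ 2 * X ^ 2) = (c - lo) * (X * ((c - lo) * X ^ 2)) := by ring
      rw [this] at q4
      exact lt_of_mul_lt_mul_left q4 (by linarith)
    have q6 : X * ((c - lo) * X ^ 2) ≤ X * (r ^ 2 * X ^ 2) := by gcongr
    have q7 : 1 < X ^ 2 * (X * (r ^ 2 * X ^ 2)) := by
      rw [← inv_mul_lt_iff₀ (by positivity), mul_one]; linarith
    have q8 : X ^ 2 * (X * (r ^ 2 * X ^ 2)) = (r * X ^ 5) * (r * X ^ 0) := by ring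
    have := mul_le_one₀ (small 5 (by norm_num)) (by positivity) (small 0 (by norm_num))
    linarith
  have hs0 : 0 < s := lt_of_lt_of_le (by positivity) hspos
  have hsX : 1 ≤ X ^ 2 * s := by
    rwa [← inv_le_iff_one_le_mul₀' (by positivity)]
  have hR0 : 0 < r * X ^ 5 := by positivity
  have hcc : c0 - c ≤ r ^ 2 := by linarith
  have hrr : r ^ 2 ≤ r * X ^ 5 / 2 := by
    have h1 : r ≤ 1 := by simpa using small 0 (by norm_num)
    have h2 : 16 ≤ X ^ 5 := hX.trans (le_self_pow₀ hX1 (by norm_num))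
    have h3 := mul_le_mul_of_nonneg_left h1 hr.le
    have h4 := mul_le_mul_of_nonneg_left h2 hr.le
    linarith
  have herr : X * (r * X + 2 * (r * X ^ 5) * X) ^ 2 ≤ 9 * r ^ 2 * X ^ 13 := by
    have : r * X ≤ r * X ^ 6 := by
      gcongr; exact le_self_pow₀ hX1 (by norm_num)
    calc X * (r * X + 2 * (r * X ^ 5) * X) ^ 2 ≤ X * (r * X ^ 6 + 2 * (r * X ^ 5) * X) ^ 2 := by gcongr
      _ = _ := by ring
  -- Setting the linearization `r * D (c • y) z + (t - c) * s` to zero gives `c - t = r * D (c • y)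
  -- z / s`.
  refine ⟨s⁻¹ • (D (c • y) : EuclideanSpace ℝ (Fin n) →ₗ[ℝ] ℝ), ?_, fun z hz => ?_⟩
  · simp only [LinearMap.smul_apply, smul_eq_mul, ContinuousLinearMap.coe_coe]
    exact inv_mul_cancel₀ hs0.ne'
  set d := D (c • y) z with hd
  have hdX : |d| ≤ X ^ 2 := by
    have := hD.norm_le (c • y) z
    rw [Real.norm_eq_abs] at this
    exact this.trans (by rw [sq]; gcongr)
  have exp2 : ∀ t, |t - c| ≤ 2 * (r * X ^ 5) →
      |σ (r • z + t • y) - 1 - (r * d + (t - c) * s)| ≤ 9 * r ^ 2 * X ^ 13 := fun t ht =>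
    (expand z t _ hz ht).trans herr
  have hrd : |r * d| ≤ r * X ^ 2 := by rw [abs_mul, abs_of_pos hr]; gcongr
  -- This justifies the search radius `r * X ^ 5`. At both ends of the interval `|t - c|` is at
  -- least half the radius, so the term in `s ≥ X⁻²` is at least `r * X ^ 3 / 2` and dominates `|r *
  -- d| ≤ r * X ^ 2` and the quadratic error. The bisection therefore starts with a sign change.
  have hmain : r * X ^ 2 + 9 * r ^ 2 * X ^ 13 < r * X ^ 3 / 2 := by
    have h1 : 9 * r ^ 2 * X ^ 13 = 9 * r * (r * X ^ 13) := by ring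
    have h2 : 9 * r * (r * X ^ 13) ≤ 9 * r * 1 := by
      gcongr; exact small 13 (by norm_num)
    have h3 : 16 * X ^ 2 ≤ X ^ 3 := by rw [pow_succ X 2, mul_comm]; gcongr
    have h4 : 16 ^ 2 ≤ X ^ 2 := by gcongr
    have h5 := mul_le_mul_of_nonneg_left h3 hr.le
    have h6 := mul_le_mul_of_nonneg_left h4 hr.le
    linarith
  have hRs : r * X ^ 3 ≤ r * X ^ 5 * s := by
    calc r * X ^ 3 = r * X ^ 3 * 1 := by ring
      _ ≤ r * X ^ 3 * (X ^ 2 * s) := by gcongr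
      _ = _ := by ring
  set f' : ℝ → ℕ := fun t => threshold (σ (r • z + t • y)) with hf'
  have hsg' := bisect_sign f' I (p := (c0 - r * X ^ 5, c0 + r * X ^ 5))
    (by
      simp only [hf', hthr, not_le]
      have h1 := abs_le.1 (exp2 (c0 - r * X ^ 5) (abs_le.2 ⟨by linarith, by linarith⟩))
      have h2 : (c0 - r * X ^ 5 - c) * s ≤ (-(r * X ^ 5 / 2)) * s :=
        mul_le_mul_of_nonneg_right (by linarith) hs0.le
      have := (abs_le.1 hrd).2
      linarith [h1.2])
    (by
      simp only [hf', hthr]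
      have h1 := abs_le.1 (exp2 (c0 + r * X ^ 5) (abs_le.2 ⟨by linarith, by linarith⟩))
      have h2 : (r * X ^ 5) * s ≤ (c0 + r * X ^ 5 - c) * s :=
        mul_le_mul_of_nonneg_right (by linarith) hs0.le
      have := (abs_le.1 hrd).1
      have : 0 ≤ r * X ^ 3 := by positivity
      linarith [h1.1])
  have hmem' := bisect_mem f' I (p := (c0 - r * X ^ 5, c0 + r * X ^ 5)) (by simp only; linarith)
  have hwid' := bisect_width f' I (c0 - r * X ^ 5, c0 + r * X ^ 5)
  have hdisp : displacement (fun x => threshold (σ x)) I y r (r * X ^ 5) z =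
      (c0 - (bisect f' I (c0 - r * X ^ 5, c0 + r * X ^ 5)).2) / r := rfl
  rw [hdisp]
  set l' := (bisect f' I (c0 - r * X ^ 5, c0 + r * X ^ 5)).1
  set c1 := (bisect f' I (c0 - r * X ^ 5, c0 + r * X ^ 5)).2
  simp only [hf', hthr, not_le] at hsg' hmem' hwid'
  have w : c1 - l' ≤ 2 * (r * X ^ 5) * r ^ 2 := by
    rw [hwid', div_eq_mul_inv]
    have : c0 + r * X ^ 5 - (c0 - r * X ^ 5) = 2 * (r * X ^ 5) := by ring
    rw [this]
    gcongr
  have u1 := (abs_le.1 (exp2 c1 (abs_le.2 ⟨by linarith, by linarith⟩))).2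
  have u2 := (abs_le.1 (exp2 l' (abs_le.2 ⟨by linarith, by linarith⟩))).1
  have k1 : -(9 * r ^ 2 * X ^ 13) ≤ r * d + (c1 - c) * s := by linarith [hsg'.2]
  have k2 : r * d + (l' - c) * s ≤ 9 * r ^ 2 * X ^ 13 := by linarith [hsg'.1]
  -- Dividing by `s` costs a factor `X ^ 2`. The upper end of the bracket gives this lower bound and
  -- the lower end gives the upper bound, so no uniqueness of the shifted crossing is needed.
  have lowb : -(9 * r ^ 2 * X ^ 15) ≤ r * (s⁻¹ * d) + (c1 - c) := by
    have : r * (s⁻¹ * d) + (c1 - c) = (r * d + (c1 - c) * s) / s := by field_simp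
    rw [this, le_div_iff₀ hs0]
    refine le_trans ?_ k1
    have := mul_le_mul_of_nonneg_left hsX (by positivity : 0 ≤ 9 * r ^ 2 * X ^ 13)
    linarith
  have uppb : r * (s⁻¹ * d) + (l' - c) ≤ 9 * r ^ 2 * X ^ 15 := by
    have : r * (s⁻¹ * d) + (l' - c) = (r * d + (l' - c) * s) / s := by field_simp
    rw [this, div_le_iff₀ hs0]
    refine k2.trans ?_
    have := mul_le_mul_of_nonneg_left hsX (by positivity : 0 ≤ 9 * r ^ 2 * X ^ 13)
    linarith
  -- Linearization error, width of the shifted bracket and inaccuracy of `c0`, absorbed into one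
  -- power of `X` since `9 + 2 + 1 ≤ 16 ≤ X`.
  have fin : 9 * r ^ 2 * X ^ 15 + 2 * (r * X ^ 5) * r ^ 2 + r ^ 2 ≤ r ^ 2 * X ^ 16 := by
    have h1 : 2 * (r * X ^ 5) * r ^ 2 ≤ 2 * 1 * r ^ 2 := by
      gcongr; exact small 5 (by norm_num)
    have h2 : 1 ≤ X ^ 15 := one_le_pow₀ hX1
    have h3 : 16 * X ^ 15 ≤ X ^ 16 := by rw [pow_succ X 15, mul_comm]; gcongr
    have h4 : 0 ≤ r ^ 2 := by positivity
    have h5 := mul_le_mul_of_nonneg_left h2 h4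
    have h6 := mul_le_mul_of_nonneg_left h3 h4
    linarith
  have goal : |(c0 - c1) - r * (s⁻¹ * d)| ≤ r ^ 2 * X ^ 16 := by
    have : 0 ≤ r ^ 2 := by positivity
    have : 0 ≤ 2 * (r * X ^ 5) * r ^ 2 := by positivity
    rw [abs_le]
    constructor <;> linarith
  simp only [LinearMap.smul_apply, smul_eq_mul, ContinuousLinearMap.coe_coe]
  have e : (c0 - c1) / r - s⁻¹ * d = ((c0 - c1) - r * (s⁻¹ * d)) / r := by field_simp
  rw [← hd, e, abs_div, abs_of_pos hr, div_le_iff₀ hr]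
  exact goal.trans (le_of_eq (by ring))

/-- Displacements approximate a linear functional `ℓ` within `r * X ^ 16`. Expanding `z` in the axes
sums `n ≤ X` coordinate errors weighted by `|z l| ≤ X`, giving `r * X ^ 18`; the error for `z`
itself fits into `r * X ^ 20`. The first conclusion comes from `ℓ y = 1`. -/
theorem displacement_predicted {σ : EuclideanSpace ℝ (Fin n) → ℝ}
    {D : EuclideanSpace ℝ (Fin n) → EuclideanSpace ℝ (Fin n) →L[ℝ] ℝ} {X r : ℝ}
    (hD : QuadBound σ D X X) (hX : 16 ≤ X) (hr : 0 < r) (hrX : r * X ^ 25 ≤ 1) (h0 : σ 0 = 0)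
    (hn : (n : ℝ) ≤ X)
    {y : EuclideanSpace ℝ (Fin n)} (hy : ‖y‖ ≤ X) (hy1 : 1 ≤ σ y)
    (hgrad : ∀ c : ℝ, 0 < c → σ (c • y) = 1 → (X ^ 2)⁻¹ ≤ |D (c • y) y|)
    {I : ℕ} (hI : ((2 : ℝ) ^ I)⁻¹ ≤ r ^ 2) :
    1 / 2 ≤ inner ℝ (normalEstimate (fun x => threshold (σ x)) I y r (r * X ^ 5)) y ∧
    ∀ z, ‖z‖ ≤ X → |displacement (fun x => threshold (σ x)) I y r (r * X ^ 5) z -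
      inner ℝ (normalEstimate (fun x => threshold (σ x)) I y r (r * X ^ 5)) z| ≤ r * X ^ 20 := by
  obtain ⟨ℓ, hℓ, happ⟩ := exists_displacement_approx hD hX hr hrX h0 hy hy1 hgrad hI
  set v := normalEstimate (fun x => threshold (σ x)) I y r (r * X ^ 5) with hv
  have hX1 : 1 ≤ X := by linarith
  have key : ∀ z, ‖z‖ ≤ X → |inner ℝ v z - ℓ z| ≤ r * X ^ 18 := by
    intro z hz
    have e1 : ℓ z = ∑ l, z l * ℓ (EuclideanSpace.single l 1) := by
      conv_lhs => rw [← (EuclideanSpace.basisFun (Fin n) ℝ).sum_repr z]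
      simp
    have e2 : inner ℝ v z = ∑ l, z l * v l := by
      simp [PiLp.inner_apply]
    rw [e1, e2, ← Finset.sum_sub_distrib]
    refine (Finset.abs_sum_le_sum_abs _ _).trans ?_
    calc ∑ l, |z l * v l - z l * ℓ (EuclideanSpace.single l 1)|
        ≤ ∑ _l : Fin n, X * (r * X ^ 16) := by
          refine Finset.sum_le_sum fun l _ => ?_
          rw [← mul_sub, abs_mul]
          refine mul_le_mul ((PiLp.norm_apply_le z l).trans hz) ?_ (abs_nonneg _) (by linarith)
          exact happ _ (by simpa using hX1)
      _ = n * (X * (r * X ^ 16)) := by simp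
      _ ≤ X * (X * (r * X ^ 16)) := by gcongr
      _ = r * X ^ 18 := by ring
  have hsm : r * X ^ 18 ≤ 1 / 2 := by
    have : X ≤ X ^ 7 := le_self_pow₀ hX1 (by norm_num)
    have h1 : r * X ^ 18 * 2 ≤ r * X ^ 18 * X ^ 7 := by gcongr; linarith
    have h2 : r * X ^ 18 * X ^ 7 = r * X ^ 25 := by ring
    linarith
  refine ⟨?_, fun z hz => ?_⟩
  · have := (abs_le.1 (key y hy)).1
    rw [hℓ] at this
    linarith
  · have h1 := key z hz
    have h2 := happ z hz
    rw [abs_sub_comm] at h1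
    refine (abs_sub_le _ (ℓ z) _).trans ((add_le_add h2 h1).trans ?_)
    have h3 : r * X ^ 16 ≤ r * X ^ 18 := mul_le_mul_of_nonneg_left
      (pow_le_pow_right₀ hX1 (by norm_num)) hr.le
    have h4 : r * X ^ 20 = r * X ^ 18 * X ^ 2 := by ring
    have h5 : 2 ≤ X ^ 2 := by nlinarith
    have h6 := mul_le_mul_of_nonneg_left h5 (by positivity : 0 ≤ r * X ^ 18)
    linarith

end

/-! ### Gram–Schmidt for degenerate forms and error growth -/

noncomputable section

variable {E : Type*} [NormedAddCommGroup E] [InnerProductSpace ℝ E]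

/-- The first `j` steps of Gram–Schmidt reduction of `t` by the vectors `a 0, a 1, …`, with respect
to the form `⟪P x, y⟫`. -/
def reduce (P : E → E) (a : ℕ → E) : ℕ → E → E
  | 0, t => t
  | j + 1, t => reduce P a j t -
      (inner ℝ (P (a j)) (reduce P a j t) / inner ℝ (P (a j)) (a j)) • a j

/-- The program always reduces by all `k` rows; rows not yet filled are zero and have no effect. -/
theorem reduce_of_eq_zero {P : E → E} {a : ℕ → E} {c k : ℕ} (hck : c ≤ k)
    (h : ∀ i, c ≤ i → i < k → a i = 0) (t : E) : reduce P a k t = reduce P a c t := by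
  induction k, hck using Nat.le_induction with
  | base => rfl
  | succ k hk ih =>
    rw [reduce, h k hk k.lt_succ_self, smul_zero, sub_zero,
      ih fun i h1 h2 => h i h1 (h2.trans k.lt_succ_self)]

section

variable {P : E →ₗ[ℝ] E} (hP : ∀ x y, inner ℝ (P x) y = inner ℝ (P x) (P y)) {a : ℕ → E} {c : ℕ}
  (ha : ∀ i < c, ∀ j < c, i ≠ j → inner ℝ (P (a i)) (P (a j)) = 0)
include hP ha

/-- Successive and simultaneous subtraction agree because the `a i` are orthogonal for the form. The
identity `hP` holds for every orthogonal projection `P`; the form may be degenerate. -/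
theorem reduce_eq_sub_sum {j : ℕ} (hj : j ≤ c) (t : E) : reduce P a j t =
    t - ∑ i ∈ Finset.range j, (inner ℝ (P (a i)) t / inner ℝ (P (a i)) (a i)) • a i := by
  induction j with
  | zero => simp [reduce]
  | succ j ih =>
    have hj' : j < c := hj
    have h0 : inner ℝ (P (a j)) (∑ i ∈ Finset.range j,
        (inner ℝ (P (a i)) t / inner ℝ (P (a i)) (a i)) • a i) = 0 := by
      rw [inner_sum]
      refine Finset.sum_eq_zero fun i hi => ?_
      rw [Finset.mem_range] at hi
      rw [inner_smul_right, hP (a j) (a i), ha j hj' i (hi.trans hj') hi.ne', mul_zero]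
    rw [reduce, ih hj'.le, inner_sub_right, h0, sub_zero, Finset.sum_range_succ]
    abel

theorem inner_reduce {j : ℕ} (hj : j ≤ c) (t : E) {i : ℕ} (hi : i < j) :
    inner ℝ (P (a i)) (reduce P a j t) = 0 := by
  rw [reduce_eq_sub_sum hP ha hj, inner_sub_right, inner_sum, Finset.sum_eq_single i]
  · rw [inner_smul_right]
    -- For a null vector the quotient is a division by zero, but then every inner product with `P (a
    -- i)` vanishes anyway.
    by_cases h : P (a i) = 0
    · simp [h]
    · rw [div_mul_cancel₀, sub_self]
      rw [hP (a i) (a i)]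
      exact inner_self_ne_zero.2 h
  · intro l hl hli
    rw [Finset.mem_range] at hl
    rw [inner_smul_right, hP (a i) (a l), ha i (hi.trans_le hj) l (hl.trans_le hj) hli.symm, mul_zero]
  · intro h
    exact absurd (Finset.mem_range.2 hi) h

end

theorem sub_reduce_mem_span (P : E → E) (a : ℕ → E) (j : ℕ) (t : E) :
    t - reduce P a j t ∈ Submodule.span ℝ (a '' (Finset.range j : Set ℕ)) := by
  induction j with
  | zero => simp [reduce]
  | succ j ih =>
    rw [reduce, ← sub_add]
    refine add_mem (Submodule.span_mono (Set.image_mono ?_) ih)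
      (Submodule.smul_mem _ _ (Submodule.subset_span ⟨j, by simp, rfl⟩))
    intro i hi
    simp only [Finset.coe_range, Set.mem_Iio] at hi ⊢
    omega

/-- The coefficients of an orthogonal expansion transport relative errors. -/
theorem norm_map_sum_coeff_le {F : Type*} [NormedAddCommGroup F] [NormedSpace ℝ F] (Q : E →ₗ[ℝ] F)
    (a : ℕ → E) {c : ℕ} {ρ : ℝ} (hρ : ∀ i < c, ‖Q (a i)‖ ≤ ρ * ‖a i‖) (hρ0 : 0 ≤ ρ) (t : E) :
    ‖Q (∑ i ∈ Finset.range c, (inner ℝ (a i) t / inner ℝ (a i) (a i)) • a i)‖ ≤ c * ρ * ‖t‖ := by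
  rw [map_sum]
  refine (norm_sum_le _ _).trans ?_
  calc _ ≤ ∑ _i ∈ Finset.range c, ρ * ‖t‖ := by
        refine Finset.sum_le_sum fun i hi => ?_
        rw [map_smul, norm_smul, Real.norm_eq_abs, abs_div, real_inner_self_eq_norm_sq,
          abs_of_nonneg (sq_nonneg ‖a i‖)]
        by_cases h : ‖a i‖ = 0
        · simp [h]; positivity
        have h0 : 0 < ‖a i‖ := lt_of_le_of_ne (norm_nonneg _) (Ne.symm h)
        calc _ ≤ ‖a i‖ * ‖t‖ / ‖a i‖ ^ 2 * (ρ * ‖a i‖) := by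
              gcongr
              · exact abs_real_inner_le_norm _ _
              · exact hρ i (Finset.mem_range.1 hi)
          _ = ρ * ‖t‖ := by field_simp
    _ = c * ρ * ‖t‖ := by simp [mul_assoc]

variable [FiniteDimensional ℝ E]

theorem sub_reduce_eq_starProjection {a : ℕ → E} {c : ℕ}
    (ha : ∀ i < c, ∀ j < c, i ≠ j → inner ℝ (a i) (a j) = 0) (t : E) :
    reduce id a c t = t - (Submodule.span ℝ (a '' (Finset.range c : Set ℕ))).starProjection t := by
  have h : (Submodule.span ℝ (a '' (Finset.range c : Set ℕ))).starProjection t =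
      t - reduce id a c t := by
    refine Submodule.eq_starProjection_of_mem_of_inner_eq_zero (sub_reduce_mem_span id a c t) ?_
    intro w hw
    rw [sub_sub_cancel]
    refine Submodule.span_induction ?_ ?_ ?_ ?_ hw
    · rintro _ ⟨i, hi, rfl⟩
      rw [real_inner_comm]
      exact inner_reduce (P := LinearMap.id) (fun _ _ => rfl) ha le_rfl t (by simpa using hi)
    · simp
    · intro x y _ _ hx hy
      rw [inner_add_right, hx, hy, add_zero]
    · intro r x _ hx
      rw [inner_smul_right, hx, mul_zero]
  rw [h, sub_sub_cancel]

/-- `b 0, …, b (c - 1)` are nonzero, orthogonal, and close to the subspace `U`. -/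
structure Found (U : Submodule ℝ E) (r X : ℝ) (b : ℕ → E) (c : ℕ) : Prop where
  ne_zero : ∀ i < c, b i ≠ 0
  eq_zero : ∀ i, c ≤ i → b i = 0
  orth : ∀ i j, i ≠ j → inner ℝ (b i) (b j) = 0
  close : ∀ i < c, ‖b i - U.starProjection (b i)‖ ≤ r * X ^ (24 + 10 * i) * ‖b i‖

/-- The distance from a subspace, as a linear map. -/
def offset (U : Submodule ℝ E) : E →ₗ[ℝ] E := LinearMap.id - (U.starProjection : E →ₗ[ℝ] E)

theorem offset_apply (U : Submodule ℝ E) (x : E) : offset U x = x - U.starProjection x := rfl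

/-- The old vectors contribute at most `X` errors of relative size `r * X ^ (24 + 10 * (c - 1))`,
scaled by `‖v‖ ≤ X ^ 6`, and normalizing by `‖u‖ ≥ X⁻²` costs `X ^ 2`. With one more factor `X` for
adding up, each new vector raises the exponent by `10`, which is the form of the bound in `Found`.
-/
theorem Found.succ {U : Submodule ℝ E} {r X : ℝ} {b : ℕ → E} {c k : ℕ} (h : Found U r X b c)
    (hr : 0 ≤ r) (hX : 16 ≤ X) (hck : c < k) (hk : (k : ℝ) ≤ X) {v : E} (hv : ‖v‖ ≤ X ^ 6)
    (hvU : ‖v - U.starProjection v‖ ≤ r * X ^ 21)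
    (hu : (X ^ 3)⁻¹ ≤ inner ℝ (reduce id b k v) (reduce id b k v)) :
    Found U r X (Function.update b c (reduce id b k v)) (c + 1) := by
  have hX0 : 0 < X := by linarith
  have hX1 : 1 ≤ X := by linarith
  have horth : ∀ i < c, ∀ j < c, i ≠ j → inner ℝ (b i) (b j) = 0 := fun i _ j _ => h.orth i j
  have hred := reduce_of_eq_zero (P := id) hck.le (fun i hi _ => h.eq_zero i hi) v
  set u := reduce id b k v with hudef
  have hu0 : u ≠ 0 := by
    rintro h0
    rw [h0, inner_zero_left] at hu
    exact absurd hu (not_le.2 (by positivity))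
  have hub : ∀ i, inner ℝ (b i) u = 0 := by
    intro i
    rcases lt_or_ge i c with hi | hi
    · rw [hred]
      exact inner_reduce (P := LinearMap.id) (fun _ _ => rfl) horth le_rfl v hi
    · rw [h.eq_zero i hi, inner_zero_left]
  refine ⟨fun i hi => ?_, fun i hi => ?_, fun i j hij => ?_, fun i hi => ?_⟩
  · rcases Nat.lt_succ_iff_lt_or_eq.1 hi with hi | rfl
    · rw [Function.update_of_ne hi.ne]; exact h.ne_zero i hi
    · rw [Function.update_self]; exact hu0
  · rw [Function.update_of_ne (by omega)]; exact h.eq_zero i (by omega)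
  · by_cases hi : i = c
    · subst hi
      rw [Function.update_self, Function.update_of_ne hij.symm, real_inner_comm]
      exact hub j
    · rw [Function.update_of_ne hi]
      by_cases hj : j = c
      · subst hj; rw [Function.update_self]; exact hub i
      · rw [Function.update_of_ne hj]; exact h.orth i j hij
  · rcases Nat.lt_succ_iff_lt_or_eq.1 hi with hi | rfl
    · rw [Function.update_of_ne hi.ne]; exact h.close i hi
    rw [Function.update_self, ← offset_apply]
    have hnu : 1 ≤ X ^ 2 * ‖u‖ := by
      rw [real_inner_self_eq_norm_sq, inv_le_iff_one_le_mul₀ (by positivity)] at hu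
      have h1 : ‖u‖ ^ 2 * X ^ 3 ≤ ‖u‖ ^ 2 * X ^ 4 := mul_le_mul_of_nonneg_left
        (pow_le_pow_right₀ hX1 (by norm_num)) (by positivity)
      have h2 : (1 : ℝ) ^ 2 ≤ (X ^ 2 * ‖u‖) ^ 2 := by rw [mul_pow]; nlinarith
      exact le_of_sq_le_sq h2 (by positivity)
    have hvU' : ‖offset U v‖ ≤ r * X ^ 21 := hvU
    have main : ‖offset U u‖ ≤ r * X ^ (22 + 10 * i) := by
      rw [hred]
      have e := reduce_eq_sub_sum (P := LinearMap.id) (fun _ _ => rfl) horth le_rfl v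
      simp only [LinearMap.id_apply] at e
      have e' : reduce id b i v = reduce (LinearMap.id : E →ₗ[ℝ] E) b i v := rfl
      rw [e', e, map_sub]
      rcases Nat.eq_zero_or_pos i with rfl | hi0
      · simp only [Finset.range_zero, Finset.sum_empty, map_zero, sub_zero]
        refine hvU'.trans ?_
        exact mul_le_mul_of_nonneg_left (pow_le_pow_right₀ hX1 (by norm_num)) hr
      obtain ⟨m, rfl⟩ : ∃ m, i = m + 1 := ⟨i - 1, by omega⟩
      have s := norm_map_sum_coeff_le (offset U) b (c := m + 1) (ρ := r * X ^ (24 + 10 * m))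
        (fun l hl => (h.close l hl).trans (by gcongr; omega)) (by positivity) v
      refine (norm_sub_le _ _).trans ((add_le_add hvU' s).trans ?_)
      have s1 : ((m + 1 : ℕ) : ℝ) ≤ X := le_trans (by exact_mod_cast hck.le) hk
      have s2 : ((m + 1 : ℕ) : ℝ) * (r * X ^ (24 + 10 * m)) * ‖v‖ ≤
          X * (r * X ^ (24 + 10 * m)) * X ^ 6 := by gcongr
      have s3 : X * (r * X ^ (24 + 10 * m)) * X ^ 6 = r * X ^ (31 + 10 * m) := by ring
      have s4 : r * X ^ 21 ≤ r * X ^ (31 + 10 * m) :=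
        mul_le_mul_of_nonneg_left (pow_le_pow_right₀ hX1 (by omega)) hr
      have s5 : r * X ^ (22 + 10 * (m + 1)) = r * X ^ (31 + 10 * m) * X := by ring
      have s6 : 0 ≤ r * X ^ (31 + 10 * m) := by positivity
      have s7 := mul_le_mul_of_nonneg_left hX s6
      linarith
    calc ‖offset U u‖ ≤ r * X ^ (22 + 10 * i) * 1 := by rwa [mul_one]
      _ ≤ r * X ^ (22 + 10 * i) * (X ^ 2 * ‖u‖) := by gcongr
      _ = r * X ^ (24 + 10 * i) * ‖u‖ := by ring

/-- A vector of the span equals its orthogonal expansion, so its error is at most the sum of `k ≤ X`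
relative errors. -/
theorem Found.norm_offset_le {U : Submodule ℝ E} {r X : ℝ} {b : ℕ → E} {k : ℕ}
    (h : Found U r X b k) (hr : 0 ≤ r) (hX : 1 ≤ X) (hk : (k : ℝ) ≤ X) {v : E}
    (hv : v ∈ Submodule.span ℝ (b '' (Finset.range k : Set ℕ))) :
    ‖v - U.starProjection v‖ ≤ r * X ^ (25 + 10 * k) * ‖v‖ := by
  have horth : ∀ i < k, ∀ j < k, i ≠ j → inner ℝ (b i) (b j) = 0 := fun i _ j _ => h.orth i j
  have e := reduce_eq_sub_sum (P := LinearMap.id) (fun _ _ => rfl) horth le_rfl v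
  have e' : reduce (LinearMap.id : E →ₗ[ℝ] E) b k v = reduce id b k v := rfl
  rw [e', sub_reduce_eq_starProjection horth,
    Submodule.starProjection_eq_self_iff.2 hv, sub_self] at e
  have s := norm_map_sum_coeff_le (offset U) b (c := k) (ρ := r * X ^ (24 + 10 * k))
    (fun l hl => (h.close l hl).trans (by gcongr)) (by positivity) v
  simp only [LinearMap.id_apply] at e
  rw [← sub_eq_zero.1 e.symm] at s
  refine s.trans ?_
  calc (k : ℝ) * (r * X ^ (24 + 10 * k)) * ‖v‖ ≤ X * (r * X ^ (24 + 10 * k)) * ‖v‖ := by gcongr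
    _ = _ := by ring

/-- Otherwise the projections would be `k` nonzero orthogonal, hence independent, vectors in a space
of dimension less than `k`. -/
theorem exists_map_eq_zero {V : Submodule ℝ E} {A : ℕ → E} {k : ℕ}
    (hV : Module.finrank ℝ V < k)
    (hA : ∀ i < k, ∀ j < k, i ≠ j → inner ℝ (V.starProjection (A i)) (V.starProjection (A j)) = 0) :
    ∃ i < k, V.starProjection (A i) = 0 := by
  by_contra! hne
  have hli : LinearIndependent ℝ fun i : Fin k => V.orthogonalProjectionOnto (A i) := by
    refine linearIndependent_of_ne_zero_of_inner_eq_zero (fun i => ?_) fun i j hij => ?_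
    · intro h0
      exact hne i i.2 (by rw [Submodule.starProjection_apply, h0]; rfl)
    · exact hA i i.2 j j.2 fun h => hij (Fin.ext h)
  have := hli.fintype_card_le_finrank
  rw [Fintype.card_fin] at this
  omega

end

/-! ### Vector subroutines of the program -/

noncomputable section

namespace RAM

/-- The vector stored in row `i` of a two-dimensional array. -/
def vecOf (n : ℕ) (A : ℕ → ℕ → ℝ) (i : ℕ) : EuclideanSpace ℝ (Fin n) :=
  WithLp.toLp 2 fun j : Fin n => A i j

theorem vecOf_apply (n : ℕ) (A : ℕ → ℕ → ℝ) (i : ℕ) (j : Fin n) : vecOf n A i j = A i j := rfl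

/-- The scalar stored in position `(0, 0)` of an array. -/
def RExp.scalar (a : ℕ) : RExp := .cell a (.const 0) (.const 0)

/-- Store a scalar in position `(0, 0)` of an array. -/
def Prog.setScalar (a : ℕ) (e : RExp) : Prog := .setR a (.const 0) (.const 0) e

/-- Write the `n` values of an expression that may depend on register `5` into a row. -/
def Prog.setRow (a : ℕ) (i : NExp) (e : RExp) : Prog := .loop 5 (.reg 0) (.setR a i (.reg 5) e)

/-- Fill row `0` of an array with `n` random numbers. -/
def Prog.gaussRow (a : ℕ) : Prog := .loop 5 (.reg 0) (.gauss a (.const 0) (.reg 5))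

/-- The inner product of two rows. -/
def Prog.dot (dst a : ℕ) (i : NExp) (a' : ℕ) (i' : NExp) : Prog :=
  .seq (.setScalar dst (.const 0))
    (.loop 5 (.reg 0) (.setScalar dst
      (.add (.scalar dst) (.mul (.cell a i (.reg 5)) (.cell a' i' (.reg 5))))))

/-- Reduce row `0` of `t` by the rows of `a`, where the rows of `z` are their images under the
operator that defines the semi-inner product. -/
def Prog.reduceRow (a z t : ℕ) : Prog :=
  .loop 6 (.reg 1) (.seq (.dot 18 z (.reg 6) t (.const 0)) (.seq (.dot 19 z (.reg 6) a (.reg 6))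
    (.setRow t (.const 0) (.sub (.cell t (.const 0) (.reg 5))
      (.mul (.div (.scalar 18) (.scalar 19)) (.cell a (.reg 6) (.reg 5)))))))

/-- A power of `1 / 2`. -/
def Prog.halfPow (a : ℕ) (e : NExp) : Prog :=
  .seq (.setScalar a (.const 1))
    (.loop 11 e (.setScalar a (.mul (.scalar a) (.const (1 / 2)))))

section

variable {n : ℕ} (M : EuclideanSpace ℝ (Fin n) → ℕ) (ω : ℕ → ℝ)

/-- The invariant rule for loops, for invariants that only concern the arrays. -/
theorem run_loop_arr {r : ℕ} {e : NExp} {p : Prog} {s : State} (I : ℕ → (ℕ → ℕ → ℕ → ℝ) → Prop)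
    (h0 : I 0 s.arr)
    (hs : ∀ m < e.eval s, ∀ s' : State, s'.nat r = m →
      (∀ r' ∉ r :: p.regs, s'.nat r' = s.nat r') → (∀ a ∉ p.arrs, s'.arr a = s.arr a) →
      I m s'.arr → I (m + 1) (p.run M ω s').arr) :
    I (e.eval s) ((Prog.loop r e p).run M ω s).arr := by
  refine (run_loop_invariant M ω (fun m s' => (∀ r' ∉ r :: p.regs, s'.nat r' = s.nat r') ∧
    (∀ a ∉ p.arrs, s'.arr a = s.arr a) ∧ I m s'.arr) ⟨fun _ _ => rfl, fun _ _ => rfl, h0⟩ ?_).2.2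
  rintro m hm s' ⟨h1, h2, h3⟩
  have h1' : ∀ r' ∉ r :: p.regs, ((s'.writeN r m).tick 1).nat r' = s.nat r' := fun r' hr' => by
    rw [← h1 r' hr']
    simp only [List.mem_cons, not_or] at hr'
    simp [State.tick, State.writeN, Function.update_of_ne hr'.1]
  refine ⟨fun r' hr' => ?_, fun a ha => ?_, ?_⟩
  · rw [p.run_nat M ω (fun h => hr' (List.mem_cons_of_mem _ h)), h1' r' hr']
  · rw [p.run_arr M ω ha]; exact h2 a ha
  · exact hs m hm _ (by simp [State.tick, State.writeN]) h1' h2 h3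

theorem run_seq (p q : Prog) (s : State) : (Prog.seq p q).run M ω s = q.run M ω (p.run M ω s) := rfl

theorem run_ite_pos {t : Test} {p q : Prog} {s : State} (h : t.holds s) :
    (Prog.ite t p q).run M ω s = p.run M ω (s.tick (t.cost + 1)) := if_pos h

theorem run_ite_neg {t : Test} {p q : Prog} {s : State} (h : ¬ t.holds s) :
    (Prog.ite t p q).run M ω s = q.run M ω (s.tick (t.cost + 1)) := if_neg h

theorem setN_nat (r : ℕ) (e : NExp) (s : State) :
    ((Prog.setN r e).run M ω s).nat r = e.eval s := by
  simp [Prog.run, State.tick, State.writeN]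

theorem setR_arr (a : ℕ) (i j : NExp) (e : RExp) (s : State) (i' j' : ℕ) :
    ((Prog.setR a i j e).run M ω s).arr a i' j' =
      if i' = i.eval s ∧ j' = j.eval s then e.eval s else s.arr a i' j' := by
  simp [Prog.run, State.tick, State.writeR]

theorem query_nat (r a : ℕ) (i : NExp) (s : State) :
    ((Prog.query r a i).run M ω s).nat r = M (vecOf n (s.arr a) (i.eval s)) := by
  simp [Prog.run, State.tick, State.writeN, State.row, vecOf]

theorem setScalar_arr (a : ℕ) (e : RExp) (s : State) :
    ((Prog.setScalar a e).run M ω s).arr a 0 0 = e.eval s := by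
  simp [Prog.setScalar, Prog.run, State.tick, State.writeR, NExp.eval]

/-- `e` may read the entry that is about to be overwritten, since entry `l` is still the old one
when its turn comes. This is what permits in-place updates such as Gram–Schmidt reduction. -/
theorem setRow_arr {a : ℕ} {i : NExp} {e : RExp} {s : State} (hn : s.nat 0 = n)
    (w : EuclideanSpace ℝ (Fin n))
    (hi : ∀ s' : State, (∀ r ≠ 5, s'.nat r = s.nat r) → i.eval s' = i.eval s)
    (he : ∀ (s' : State) (l : Fin n), s'.nat 5 = l → (∀ r ≠ 5, s'.nat r = s.nat r) →
      (∀ a' ≠ a, s'.arr a' = s.arr a') → s'.arr a (i.eval s) l = s.arr a (i.eval s) l →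
      e.eval s' = w l) :
    vecOf n (((Prog.setRow a i e).run M ω s).arr a) (i.eval s) = w ∧
      ∀ i' ≠ i.eval s, ((Prog.setRow a i e).run M ω s).arr a i' = s.arr a i' := by
  have key := run_loop_arr M ω (r := 5) (e := .reg 0) (p := .setR a i (.reg 5) e) (s := s)
    (fun m A => (∀ j : Fin n, j < m → A a (i.eval s) j = w j) ∧
      (∀ j ≥ m, A a (i.eval s) j = s.arr a (i.eval s) j) ∧
      ∀ i' ≠ i.eval s, A a i' = s.arr a i') ?_ ?_
  · simp only [NExp.eval, hn] at key
    exact ⟨by ext j; exact key.1 j j.2, key.2.2⟩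
  · exact ⟨fun j hj => absurd hj (Nat.not_lt_zero _), fun _ _ => rfl, fun _ _ => rfl⟩
  · rintro m hm s' h5 hr ha ⟨h1, h2, h3⟩
    simp only [NExp.eval, hn] at hm
    simp only [Prog.regs, List.mem_singleton] at hr
    simp only [Prog.arrs, List.mem_singleton] at ha
    have hie := hi s' hr
    have hee := he s' ⟨m, hm⟩ h5 hr ha (h2 m le_rfl)
    simp only [Prog.run, State.tick, State.writeR, NExp.eval, hie, hee, h5, true_and]
    refine ⟨fun j hj => ?_, fun j hj => ?_, fun i' hi' => ?_⟩
    · split_ifs with h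
      · rw [show j = ⟨m, hm⟩ from Fin.ext h]
      · exact h1 j (by omega)
    · rw [if_neg (by omega)]
      exact h2 j (by omega)
    · funext j
      rw [if_neg (fun h => hi' h.1)]
      rw [h3 i' hi']

theorem gaussRow_spec {a : ℕ} {s : State} (hn : s.nat 0 = n) :
    vecOf n (((Prog.gaussRow a).run M ω s).arr a) 0 = WithLp.toLp 2 (fun l : Fin n => ω (s.drawn + l))
      ∧ ((Prog.gaussRow a).run M ω s).drawn = s.drawn + n := by
  have key := run_loop_invariant M ω (r := 5) (e := .reg 0) (p := .gauss a (.const 0) (.reg 5))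
    (s := s) (fun m s' => (∀ j < m, s'.arr a 0 j = ω (s.drawn + j)) ∧ s'.drawn = s.drawn + m)
    ⟨fun j hj => absurd hj (Nat.not_lt_zero _), rfl⟩ ?_
  · simp only [NExp.eval, hn] at key
    exact ⟨by ext j; exact key.1 j j.2, key.2⟩
  · rintro m - s' ⟨h1, h2⟩
    simp only [Prog.run, State.tick, State.writeR, State.writeN, NExp.eval, h2, true_and,
      Function.update_self]
    refine ⟨fun j hj => ?_, by omega⟩
    split_ifs with h
    · rw [h]
    · exact h1 j (by omega)

theorem dot_arr {dst a a' : ℕ} {i i' : NExp} {s : State} (hn : s.nat 0 = n) (h1 : a ≠ dst)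
    (h2 : a' ≠ dst) (hi : ∀ s' : State, (∀ r ≠ 5, s'.nat r = s.nat r) → i.eval s' = i.eval s)
    (hi' : ∀ s' : State, (∀ r ≠ 5, s'.nat r = s.nat r) → i'.eval s' = i'.eval s) :
    ((Prog.dot dst a i a' i').run M ω s).arr dst 0 0 =
      inner ℝ (vecOf n (s.arr a) (i.eval s)) (vecOf n (s.arr a') (i'.eval s)) := by
  have key := run_loop_arr M ω (r := 5) (e := .reg 0) (p := .setScalar dst
      (.add (.scalar dst) (.mul (.cell a i (.reg 5)) (.cell a' i' (.reg 5)))))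
    (s := (Prog.setScalar dst (.const 0)).run M ω s)
    (fun m A => A dst 0 0 = ∑ j ∈ Finset.range m,
      s.arr a (i.eval s) j * s.arr a' (i'.eval s) j) ?_ ?_
  · have h0 : ((Prog.setScalar dst (.const 0)).run M ω s).nat 0 = n := hn
    simp only [NExp.eval, h0] at key
    rw [Prog.dot, Prog.run, key, ← Fin.sum_univ_eq_sum_range
      (fun j => s.arr a (i.eval s) j * s.arr a' (i'.eval s) j)]
    simp only [PiLp.inner_apply, vecOf_apply, RCLike.inner_apply, conj_trivial]
    exact Finset.sum_congr rfl fun j _ => mul_comm _ _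
  · rw [setScalar_arr]
    simp [RExp.eval]
  · intro m hm s' h5 hr ha h
    simp only [Prog.setScalar, Prog.regs, List.mem_singleton] at hr
    simp only [Prog.setScalar, Prog.arrs, List.mem_singleton] at ha
    have e1 : s'.arr a = s.arr a := by
      rw [ha a h1]; exact Prog.run_arr M ω _ (by simpa [Prog.setScalar, Prog.arrs] using h1) s
    have e2 : s'.arr a' = s.arr a' := by
      rw [ha a' h2]; exact Prog.run_arr M ω _ (by simpa [Prog.setScalar, Prog.arrs] using h2) s
    rw [setScalar_arr]
    simp only [RExp.eval, RExp.scalar, NExp.eval, h5, h, hi s' hr, hi' s' hr, e1, e2,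
      Finset.sum_range_succ]

theorem reduceRow_arr {P : EuclideanSpace ℝ (Fin n) → EuclideanSpace ℝ (Fin n)} {a z t k : ℕ}
    {s : State} (hn : s.nat 0 = n) (hk : s.nat 1 = k)
    (ha : a ≠ 18 ∧ a ≠ 19 ∧ a ≠ t) (hz : z ≠ 18 ∧ z ≠ 19 ∧ z ≠ t) (ht : t ≠ 18 ∧ t ≠ 19)
    (hP : ∀ j < k, vecOf n (s.arr z) j = P (vecOf n (s.arr a) j)) :
    vecOf n (((Prog.reduceRow a z t).run M ω s).arr t) 0 =
      reduce P (vecOf n (s.arr a)) k (vecOf n (s.arr t) 0) := by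
  have key := run_loop_arr M ω (r := 6) (e := .reg 1) (p := .seq (.dot 18 z (.reg 6) t (.const 0))
    (.seq (.dot 19 z (.reg 6) a (.reg 6))
    (.setRow t (.const 0) (.sub (.cell t (.const 0) (.reg 5))
      (.mul (.div (.scalar 18) (.scalar 19)) (.cell a (.reg 6) (.reg 5))))))) (s := s)
    (fun m A => vecOf n (A t) 0 = reduce P (vecOf n (s.arr a)) m (vecOf n (s.arr t) 0)) rfl ?_
  · simp only [NExp.eval, hk] at key
    exact key
  · intro m hm s' h6 hr hA h
    simp only [NExp.eval, hk] at hm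
    have m1 : ∀ x, x ≠ 18 → x ≠ 19 → x ≠ t → s'.arr x = s.arr x := fun x h1 h2 h3 => hA x (by
      simp [Prog.dot, Prog.setRow, Prog.setScalar, Prog.arrs, h1, h2, h3])
    have m0 : s'.nat 0 = n := by
      rw [hr 0 (by simp [Prog.dot, Prog.setRow, Prog.setScalar, Prog.regs]), hn]
    simp only [Prog.run]
    set s1 := (Prog.dot 18 z (.reg 6) t (.const 0)).run M ω s' with hs1
    set s2 := (Prog.dot 19 z (.reg 6) a (.reg 6)).run M ω s1 with hs2
    have d1 : s1.arr 18 0 0 = _ := dot_arr M ω (s := s') m0 hz.1 ht.1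
      (fun s'' h => h 6 (by norm_num)) (fun _ _ => rfl)
    have f1 : ∀ x ≠ 18, s1.arr x = s'.arr x := fun x hx =>
      Prog.run_arr M ω _ (by simp [Prog.dot, Prog.setScalar, Prog.arrs, hx]) s'
    have g1 : ∀ r ≠ 5, s1.nat r = s'.nat r := fun r hx =>
      Prog.run_nat M ω _ (by simp [Prog.dot, Prog.setScalar, Prog.regs, hx]) s'
    have d2 : s2.arr 19 0 0 = _ := dot_arr M ω (s := s1) ((g1 0 (by norm_num)).trans m0) hz.2.1 ha.2.1
      (fun s'' h => h 6 (by norm_num)) (fun s'' h => h 6 (by norm_num))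
    have f2 : ∀ x ≠ 19, s2.arr x = s1.arr x := fun x hx =>
      Prog.run_arr M ω _ (by simp [Prog.dot, Prog.setScalar, Prog.arrs, hx]) s1
    have g2 : ∀ r ≠ 5, s2.nat r = s1.nat r := fun r hx =>
      Prog.run_nat M ω _ (by simp [Prog.dot, Prog.setScalar, Prog.regs, hx]) s1
    have n6 : s2.nat 6 = m := by rw [g2 6 (by norm_num), g1 6 (by norm_num), h6]
    refine (setRow_arr M ω (a := t) (i := .const 0) (s := s2) ?_ _ (fun _ _ => rfl) ?_).1
    · rw [g2 0 (by norm_num), g1 0 (by norm_num), m0]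
    · intro s'' l h5 hr'' hA'' hl
      rw [reduce, ← h, ← hP m hm]
      simp only [RExp.eval, RExp.scalar, NExp.eval, h5, hA'' 18 ht.1.symm, hA'' 19 ht.2.symm,
        hA'' a ha.2.2, hr'' 6 (by norm_num), n6]
      simp only [NExp.eval] at hl d1 d2
      rw [hl, d2, f2 18 (by norm_num), d1, f2 t ht.2, f1 t ht.1, f2 a ha.2.1, f1 a ha.1,
        g1 6 (by norm_num), h6, f1 z hz.1, m1 z hz.1 hz.2.1 hz.2.2, m1 a ha.1 ha.2.1 ha.2.2]
      simp [vecOf]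

theorem halfPow_arr {a : ℕ} {e : NExp} (s : State) :
    ((Prog.halfPow a e).run M ω s).arr a 0 0 = ((2 : ℝ) ^ (e.eval s))⁻¹ := by
  have he : e.eval ((Prog.setScalar a (.const 1)).run M ω s) = e.eval s := by
    induction e with
    | const c => rfl
    | reg r => rfl
    | add a b ha hb => simp only [NExp.eval, ha, hb]
    | sub a b ha hb => simp only [NExp.eval, ha, hb]
    | mul a b ha hb => simp only [NExp.eval, ha, hb]
  have key := run_loop_arr M ω (r := 11) (e := e)
    (p := .setScalar a (.mul (.scalar a) (.const (1 / 2))))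
    (s := (Prog.setScalar a (.const 1)).run M ω s) (fun m A => A a 0 0 = ((2 : ℝ) ^ m)⁻¹) ?_ ?_
  · rw [he] at key
    exact key
  · rw [setScalar_arr]; simp [RExp.eval]
  · intro m _ s' _ _ _ h
    rw [setScalar_arr]
    simp only [RExp.eval, RExp.scalar, NExp.eval, h, pow_succ, mul_inv]
    norm_num

end

end RAM

end

/-! ### One round: line, probes, test, acceptance -/

noncomputable section

namespace RAM

/-- Bisection along the line through `r • z` with direction `y`; `y` and `z` are in arrays `20` and
`21`, `r` in `10`, and the current interval in `14` and `15`. -/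
def Prog.bisection : Prog :=
  .loop 7 (.mul (.const 3) (.mul (.reg 2) (.reg 2)))
    (.seq (.setScalar 16 (.div (.add (.scalar 14) (.scalar 15)) (.const 2)))
    (.seq (.setRow 22 (.const 0) (.add (.mul (.scalar 10) (.cell 21 (.const 0) (.reg 5)))
      (.mul (.scalar 16) (.cell 20 (.const 0) (.reg 5)))))
    (.seq (.query 4 22 (.const 0))
    (.ite (.leN (.const 1) (.reg 4)) (.setScalar 15 (.scalar 16)) (.setScalar 14 (.scalar 16))))))

/-- Draw a Gaussian vector and reduce it by the vectors found so far. -/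
def Prog.drawLine : Prog := .seq (.gaussRow 20) (.reduceRow 4 4 20)

/-- Find the crossing on the segment from `0` to `y`. -/
def Prog.baseCrossing : Prog :=
  .seq (.setRow 21 (.const 0) (.const 0)) (.seq (.setScalar 14 (.const 0))
    (.seq (.setScalar 15 (.const 1)) (.seq .bisection (.setScalar 17 (.scalar 15)))))

/-- Find the displacement in direction `z`. -/
def Prog.probe : Prog :=
  .seq (.setScalar 14 (.sub (.scalar 17) (.scalar 11)))
    (.seq (.setScalar 15 (.add (.scalar 17) (.scalar 11))) (.seq .bisection
      (.setScalar 25 (.div (.sub (.scalar 17) (.scalar 15)) (.scalar 10)))))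

/-- Find the displacements along all coordinate axes. -/
def Prog.probeAxes : Prog :=
  .loop 8 (.reg 0) (.seq (.setRow 21 (.const 0) (.const 0))
    (.seq (.setR 21 (.const 0) (.reg 8) (.const 1))
    (.seq .probe (.setR 23 (.const 0) (.reg 8) (.scalar 25)))))

/-- Compare the displacement in a random direction with its prediction. -/
def Prog.probeRandom : Prog :=
  .seq (.gaussRow 21) (.seq .probe (.seq (.dot 18 23 (.const 0) 21 (.const 0))
    (.setScalar 24 (.sub (.scalar 25) (.scalar 18)))))

/-- Reduce the estimate by the vectors found so far. -/
def Prog.reduceEstimate : Prog :=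
  .seq (.reduceRow 4 4 23) (.dot 19 23 (.const 0) 23 (.const 0))

/-- Record the estimate if it passes the tests. -/
def Prog.accept : Prog :=
  .ite (.le (.mul (.scalar 24) (.scalar 24)) (.mul (.scalar 12) (.scalar 12)))
    (.ite (.le (.scalar 13) (.scalar 19))
      (.ite (.leN (.add (.reg 3) (.const 1)) (.reg 1))
        (.seq (.setRow 4 (.reg 3) (.cell 23 (.const 0) (.reg 5)))
          (.setN 3 (.add (.reg 3) (.const 1)))) .skip) .skip) .skip

/-- One attempt at finding a further vector close to the row span. -/
def Prog.attempt : Prog :=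
  .seq .drawLine (.seq .baseCrossing (.seq .probeAxes (.seq .probeRandom
    (.seq .reduceEstimate .accept))))

section

variable {n : ℕ} (M : EuclideanSpace ℝ (Fin n) → ℕ) (ω : ℕ → ℝ)

theorem bisection_arr {s : State} {N : ℕ} (hn : s.nat 0 = n) (hN : s.nat 2 = N) :
    ((Prog.bisection.run M ω s).arr 14 0 0, (Prog.bisection.run M ω s).arr 15 0 0) =
      bisect (fun t => M (s.arr 10 0 0 • vecOf n (s.arr 21) 0 + t • vecOf n (s.arr 20) 0))
        (3 * (N * N)) (s.arr 14 0 0, s.arr 15 0 0) := by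
  set f : ℝ → ℕ := fun t => M (s.arr 10 0 0 • vecOf n (s.arr 21) 0 + t • vecOf n (s.arr 20) 0)
    with hf
  have key := run_loop_arr M ω (r := 7) (e := .mul (.const 3) (.mul (.reg 2) (.reg 2)))
    (p := (.seq (.setScalar 16 (.div (.add (.scalar 14) (.scalar 15)) (.const 2)))
    (.seq (.setRow 22 (.const 0) (.add (.mul (.scalar 10) (.cell 21 (.const 0) (.reg 5)))
      (.mul (.scalar 16) (.cell 20 (.const 0) (.reg 5)))))
    (.seq (.query 4 22 (.const 0))
    (.ite (.leN (.const 1) (.reg 4)) (.setScalar 15 (.scalar 16)) (.setScalar 14 (.scalar 16)))))))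
    (s := s) (fun m A => (A 14 0 0, A 15 0 0) = bisect f m (s.arr 14 0 0, s.arr 15 0 0)) rfl ?_
  · simp only [NExp.eval, hN] at key
    exact key
  · intro m hm s' h7 hr hA h
    have m0 : s'.nat 0 = n := (hr 0 (by decide)).trans hn
    simp only [run_seq]
    set s1 := (Prog.setScalar 16 (.div (.add (.scalar 14) (.scalar 15)) (.const 2))).run M ω s'
      with hs1
    set s2 := (Prog.setRow 22 (.const 0) (.add (.mul (.scalar 10) (.cell 21 (.const 0) (.reg 5)))
      (.mul (.scalar 16) (.cell 20 (.const 0) (.reg 5))))).run M ω s1 with hs2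
    have e1 : s1.arr 16 0 0 = ((bisect f m (s.arr 14 0 0, s.arr 15 0 0)).1 +
        (bisect f m (s.arr 14 0 0, s.arr 15 0 0)).2) / 2 := by
      rw [hs1, setScalar_arr, ← h]
      simp [RExp.eval, RExp.scalar, NExp.eval]
    have f1 : ∀ x ≠ 16, s1.arr x = s'.arr x := fun x hx =>
      Prog.run_arr M ω _ (by simp [Prog.setScalar, Prog.arrs, hx]) s'
    have e2 := (setRow_arr M ω (a := 22) (i := .const 0) (s := s1) (n := n)
      (e := .add (.mul (.scalar 10) (.cell 21 (.const 0) (.reg 5)))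
        (.mul (.scalar 16) (.cell 20 (.const 0) (.reg 5))))
      m0 (s.arr 10 0 0 • vecOf n (s.arr 21) 0 + s1.arr 16 0 0 • vecOf n (s.arr 20) 0)
      (fun _ _ => rfl) (fun s'' l h5 _ hA'' _ => by
        simp only [RExp.eval, RExp.scalar, NExp.eval, h5]
        rw [hA'' 10 (by decide), hA'' 16 (by decide), hA'' 21 (by decide), hA'' 20 (by decide),
          f1 10 (by decide), f1 21 (by decide), f1 20 (by decide), hA 10 (by decide),
          hA 21 (by decide), hA 20 (by decide)]
        simp [vecOf])).1
    rw [← hs2] at e2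
    have f2 : ∀ x ≠ 22, s2.arr x = s1.arr x := fun x hx =>
      Prog.run_arr M ω _ (by simp [Prog.setRow, Prog.arrs, hx]) s1
    set s3 := (Prog.query 4 22 (.const 0)).run M ω s2 with hs3
    have hq : s3.nat 4 = f (s1.arr 16 0 0) := (query_nat M ω 4 22 _ s2).trans (congrArg M e2)
    have f3 : ∀ x, s3.arr x = s2.arr x := fun x => Prog.run_arr M ω _ (by simp [Prog.arrs]) s2
    rw [bisect, ← e1]
    by_cases hif : 1 ≤ f (s1.arr 16 0 0)
    · rw [if_pos hif, run_ite_pos M ω (by simpa [Test.holds, NExp.eval, hq] using hif),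
        setScalar_arr, Prog.run_arr M ω (a := 14) _ (by decide)]
      simp only [RExp.eval, RExp.scalar, NExp.eval, State.tick]
      rw [f3, f3, f2 14 (by decide), f1 14 (by decide), f2 16 (by decide), ← h]
    · rw [if_neg hif, run_ite_neg M ω (by simpa [Test.holds, NExp.eval, hq] using hif),
        setScalar_arr, Prog.run_arr M ω (a := 15) _ (by decide)]
      simp only [RExp.eval, RExp.scalar, NExp.eval, State.tick]
      rw [f3, f3, f2 15 (by decide), f1 15 (by decide), f2 16 (by decide), ← h]

theorem drawLine_spec {s : State} {k : ℕ} (hn : s.nat 0 = n) (hk : s.nat 1 = k) :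
    vecOf n ((Prog.drawLine.run M ω s).arr 20) 0 = reduce id (vecOf n (s.arr 4)) k
      (WithLp.toLp 2 (fun l : Fin n => ω (s.drawn + l))) ∧
    (Prog.drawLine.run M ω s).drawn = s.drawn + n := by
  obtain ⟨h1, h2⟩ := gaussRow_spec M ω (a := 20) hn
  rw [Prog.drawLine, run_seq]
  refine ⟨?_, (Prog.run_drawn M ω _ (by decide) _).trans h2⟩
  have n0 := (Prog.gaussRow 20).run_nat M ω (r := 0) (by decide) s
  have n1 := (Prog.gaussRow 20).run_nat M ω (r := 1) (by decide) s
  rw [reduceRow_arr M ω (P := id) (n0.trans hn) (n1.trans hk) (by decide) (by decide) (by decide)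
    (fun _ _ => rfl), h1, (Prog.gaussRow 20).run_arr M ω (by decide)]

theorem baseCrossing_spec {s : State} {N : ℕ} (hn : s.nat 0 = n) (hN : s.nat 2 = N) :
    (Prog.baseCrossing.run M ω s).arr 17 0 0 =
      crossing M (3 * (N * N)) (vecOf n (s.arr 20) 0) (s.arr 10 0 0) 0 1 0 := by
  simp only [Prog.baseCrossing, run_seq]
  set s1 := (Prog.setRow 21 (.const 0) (.const 0)).run M ω s with hs1
  set s2 := (Prog.setScalar 14 (.const 0)).run M ω s1 with hs2
  set s3 := (Prog.setScalar 15 (.const 1)).run M ω s2 with hs3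
  have n1 : s1.nat 0 = n := (Prog.run_nat M ω _ (by decide) s).trans hn
  have N1 : s1.nat 2 = N := (Prog.run_nat M ω _ (by decide) s).trans hN
  have h := bisection_arr M ω (s := s3) (N := N) n1 N1
  rw [setScalar_arr]
  have e21 : vecOf n (s3.arr 21) 0 = 0 := by
    rw [hs3, Prog.run_arr M ω _ (by decide), hs2, Prog.run_arr M ω _ (by decide), hs1]
    exact (setRow_arr M ω hn 0 (fun _ _ => rfl) (fun s'' l _ _ _ _ => by simp [RExp.eval])).1
  have e15 : s3.arr 15 0 0 = 1 := by rw [hs3, setScalar_arr]; simp [RExp.eval]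
  have e14 : s3.arr 14 0 0 = 0 := by
    rw [hs3, Prog.run_arr M ω _ (by decide), hs2, setScalar_arr]; simp [RExp.eval]
  have e : ∀ x ∉ [21, 14, 15], s3.arr x = s.arr x := fun x hx => by
    simp only [List.mem_cons, List.not_mem_nil, or_false, not_or] at hx
    rw [hs3, Prog.run_arr M ω _ (by simp [Prog.setScalar, Prog.arrs, hx]), hs2,
      Prog.run_arr M ω _ (by simp [Prog.setScalar, Prog.arrs, hx]), hs1,
      Prog.run_arr M ω _ (by simp [Prog.setRow, Prog.arrs, hx])]
  rw [e21, e15, e14, e 10 (by decide), e 20 (by decide)] at h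
  simp only [RExp.eval, RExp.scalar, NExp.eval]
  exact congrArg Prod.snd h

theorem probe_spec {s : State} {N : ℕ} (hn : s.nat 0 = n) (hN : s.nat 2 = N)
    (h17 : s.arr 17 0 0 =
      crossing M (3 * (N * N)) (vecOf n (s.arr 20) 0) (s.arr 10 0 0) 0 1 0) :
    (Prog.probe.run M ω s).arr 25 0 0 =
      displacement M (3 * (N * N)) (vecOf n (s.arr 20) 0) (s.arr 10 0 0) (s.arr 11 0 0)
        (vecOf n (s.arr 21) 0) := by
  simp only [Prog.probe, run_seq]
  set s2 := (Prog.setScalar 14 (.sub (.scalar 17) (.scalar 11))).run M ω s with hs2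
  set s3 := (Prog.setScalar 15 (.add (.scalar 17) (.scalar 11))).run M ω s2 with hs3
  have h := bisection_arr M ω (s := s3) (N := N) hn hN
  rw [setScalar_arr]
  have e2 : ∀ x ≠ 14, s2.arr x = s.arr x := fun x hx => by
    rw [hs2, Prog.run_arr M ω _ (by simp [Prog.setScalar, Prog.arrs, hx])]
  have e : ∀ x ∉ [14, 15], s3.arr x = s.arr x := fun x hx => by
    simp only [List.mem_cons, List.not_mem_nil, or_false, not_or] at hx
    rw [hs3, Prog.run_arr M ω _ (by simp [Prog.setScalar, Prog.arrs, hx]), e2 x hx.1]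
  have e15 : s3.arr 15 0 0 = s.arr 17 0 0 + s.arr 11 0 0 := by
    rw [hs3, setScalar_arr]; simp [RExp.eval, RExp.scalar, NExp.eval, e2]
  have e14 : s3.arr 14 0 0 = s.arr 17 0 0 - s.arr 11 0 0 := by
    rw [hs3, Prog.run_arr M ω _ (by decide), hs2, setScalar_arr]
    simp [RExp.eval, RExp.scalar, NExp.eval]
  rw [e15, e14, e 10 (by decide), e 20 (by decide), e 21 (by decide)] at h
  simp only [RExp.eval, RExp.scalar, NExp.eval]
  rw [Prog.run_arr M ω (a := 17) _ (by decide), Prog.run_arr M ω (a := 10) _ (by decide),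
    e 17 (by decide), e 10 (by decide), displacement, ← h17, crossing, ← h]

theorem probeAxes_spec {s : State} {N : ℕ} (hn : s.nat 0 = n) (hN : s.nat 2 = N)
    (h17 : s.arr 17 0 0 =
      crossing M (3 * (N * N)) (vecOf n (s.arr 20) 0) (s.arr 10 0 0) 0 1 0) :
    vecOf n ((Prog.probeAxes.run M ω s).arr 23) 0 =
      normalEstimate M (3 * (N * N)) (vecOf n (s.arr 20) 0) (s.arr 10 0 0) (s.arr 11 0 0) := by
  have key := run_loop_arr M ω (r := 8) (e := .reg 0)
    (p := .seq (.setRow 21 (.const 0) (.const 0))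
      (.seq (.setR 21 (.const 0) (.reg 8) (.const 1))
      (.seq .probe (.setR 23 (.const 0) (.reg 8) (.scalar 25))))) (s := s)
    (fun m A => ∀ j : Fin n, (j : ℕ) < m → A 23 0 j = displacement M (3 * (N * N))
      (vecOf n (s.arr 20) 0) (s.arr 10 0 0) (s.arr 11 0 0) (EuclideanSpace.single j 1))
    (fun j hj => absurd hj (Nat.not_lt_zero _)) ?_
  · simp only [NExp.eval, hn] at key
    ext j
    exact key j j.2
  · intro m hm s' h8 hr hA h j hj
    have m0 : s'.nat 0 = n := (hr 0 (by decide)).trans hn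
    have m2 : s'.nat 2 = N := (hr 2 (by decide)).trans hN
    simp only [NExp.eval, hn] at hm
    simp only [run_seq]
    set s1 := (Prog.setRow 21 (.const 0) (.const 0)).run M ω s' with hs1
    have n18 : s1.nat 8 = m := (Prog.run_nat M ω _ (by decide) s').trans h8
    set s2 := (Prog.setR 21 (.const 0) (.reg 8) (.const 1)).run M ω s1 with hs2
    set s3 := Prog.probe.run M ω s2 with hs3
    have z1 : vecOf n (s1.arr 21) 0 = 0 :=
      (setRow_arr M ω m0 0 (fun _ _ => rfl) (fun s'' l _ _ _ _ => by simp [RExp.eval])).1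
    have z2 : vecOf n (s2.arr 21) 0 = EuclideanSpace.single ⟨m, hm⟩ 1 := by
      ext l
      have := congrArg (fun v : EuclideanSpace ℝ (Fin n) => v l) z1
      simp only [vecOf_apply, PiLp.zero_apply] at this
      rw [vecOf_apply, hs2, setR_arr, this]
      simp [NExp.eval, RExp.eval, n18, Fin.ext_iff]
    have f2 : ∀ x ∉ [21], s2.arr x = s'.arr x := fun x hx => by
      simp only [List.mem_singleton] at hx
      rw [hs2, Prog.run_arr M ω _ (by simp [Prog.arrs, hx]), hs1, Prog.run_arr M ω _ (by simp [Prog.setRow, Prog.arrs, hx])]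
    have f2' : ∀ x ∉ [21, 14, 15, 16, 22, 23, 25], s2.arr x = s.arr x := fun x hx => by
      simp only [List.mem_cons, List.not_mem_nil, or_false, not_or] at hx
      rw [f2 x (by simpa using hx.1), hA x (by
        simp [Prog.probe, Prog.bisection, Prog.setRow, Prog.setScalar, Prog.arrs, hx])]
    have hp := probe_spec M ω (s := s2) (N := N) ((Prog.run_nat M ω _ (by decide) s').trans m0)
      ((Prog.run_nat M ω _ (by decide) s').trans m2) (by
        rw [f2' 17 (by decide), f2' 20 (by decide), f2' 10 (by decide), h17])
    rw [z2, f2' 20 (by decide), f2' 10 (by decide), f2' 11 (by decide), ← hs3] at hp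
    have n38 : s3.nat 8 = m := (Prog.run_nat M ω _ (by decide) s2).trans n18
    rw [setR_arr]
    simp only [RExp.scalar, NExp.eval, RExp.eval, n38, true_and]
    split_ifs with hjm
    · rw [hp, show j = ⟨m, hm⟩ from Fin.ext hjm]
    · rw [hs3, Prog.run_arr M ω (a := 23) _ (by decide), f2 23 (by decide)]
      exact h j (by omega)

theorem probeRandom_spec {s : State} {N : ℕ} (hn : s.nat 0 = n) (hN : s.nat 2 = N)
    (h17 : s.arr 17 0 0 =
      crossing M (3 * (N * N)) (vecOf n (s.arr 20) 0) (s.arr 10 0 0) 0 1 0) :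
    (Prog.probeRandom.run M ω s).arr 24 0 0 =
      displacement M (3 * (N * N)) (vecOf n (s.arr 20) 0) (s.arr 10 0 0) (s.arr 11 0 0)
        (WithLp.toLp 2 (fun l : Fin n => ω (s.drawn + l))) -
      inner ℝ (vecOf n (s.arr 23) 0) (WithLp.toLp 2 (fun l : Fin n => ω (s.drawn + l))) ∧
    (Prog.probeRandom.run M ω s).drawn = s.drawn + n := by
  obtain ⟨h1, h2⟩ := gaussRow_spec M ω (a := 21) hn
  simp only [Prog.probeRandom, run_seq]
  set s1 := (Prog.gaussRow 21).run M ω s with hs1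
  set s2 := Prog.probe.run M ω s1 with hs2
  set s3 := (Prog.dot 18 23 (.const 0) 21 (.const 0)).run M ω s2 with hs3
  have n1 : s1.nat 0 = n := (Prog.run_nat M ω _ (by decide) s).trans hn
  have N1 : s1.nat 2 = N := (Prog.run_nat M ω _ (by decide) s).trans hN
  have f1 : ∀ x ≠ 21, s1.arr x = s.arr x := fun x hx =>
    Prog.run_arr M ω _ (by simp [Prog.gaussRow, Prog.arrs, hx]) s
  have hp := probe_spec M ω (s := s1) (N := N) n1 N1 (by
    rw [f1 17 (by decide), f1 20 (by decide), f1 10 (by decide), h17])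
  have hd : s3.arr 18 0 0 = _ := dot_arr M ω (s := s2) (n := n)
    ((Prog.run_nat M ω _ (by decide) s1).trans n1) (by decide) (by decide) (fun _ _ => rfl)
    (fun _ _ => rfl)
  refine ⟨?_, ?_⟩
  · rw [setScalar_arr]
    simp only [RExp.eval, RExp.scalar, NExp.eval] at hd ⊢
    rw [hd, hs3, Prog.run_arr M ω _ (by decide), hp, h1, f1 20 (by decide), f1 10 (by decide),
      f1 11 (by decide), hs2, Prog.run_arr M ω (a := 23) _ (by decide), f1 23 (by decide),
      Prog.run_arr M ω (a := 21) _ (by decide), h1]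
  · rw [Prog.run_drawn M ω _ (by decide), hs3, Prog.run_drawn M ω _ (by decide), hs2,
      Prog.run_drawn M ω _ (by decide), h2]

theorem reduceEstimate_spec {s : State} {k : ℕ} (hn : s.nat 0 = n) (hk : s.nat 1 = k) :
    vecOf n ((Prog.reduceEstimate.run M ω s).arr 23) 0 =
      reduce id (vecOf n (s.arr 4)) k (vecOf n (s.arr 23) 0) ∧
    (Prog.reduceEstimate.run M ω s).arr 19 0 0 =
      inner ℝ (reduce id (vecOf n (s.arr 4)) k (vecOf n (s.arr 23) 0))
        (reduce id (vecOf n (s.arr 4)) k (vecOf n (s.arr 23) 0)) := by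
  have h := reduceRow_arr M ω (P := id) (a := 4) (z := 4) (t := 23) hn hk (by decide) (by decide)
    (by decide) (fun _ _ => rfl)
  simp only [Prog.reduceEstimate, run_seq]
  set s1 := (Prog.reduceRow 4 4 23).run M ω s with hs1
  refine ⟨?_, ?_⟩
  · rw [Prog.run_arr M ω _ (by decide), h]
  · rw [dot_arr M ω (n := n) ((Prog.run_nat M ω _ (by decide) s).trans hn) (by decide) (by decide)
      (fun _ _ => rfl) (fun _ _ => rfl)]
    simp only [NExp.eval]
    rw [h]

theorem accept_spec {s : State} {k c : ℕ} (hn : s.nat 0 = n) (hk : s.nat 1 = k) (hc : s.nat 3 = c) :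
    (((s.arr 24 0 0 * s.arr 24 0 0 ≤ s.arr 12 0 0 * s.arr 12 0 0 ∧
        s.arr 13 0 0 ≤ s.arr 19 0 0) ∧ c < k) →
      (Prog.accept.run M ω s).nat 3 = c + 1 ∧ vecOf n ((Prog.accept.run M ω s).arr 4) =
        Function.update (vecOf n (s.arr 4)) c (vecOf n (s.arr 23) 0)) ∧
    (¬ ((s.arr 24 0 0 * s.arr 24 0 0 ≤ s.arr 12 0 0 * s.arr 12 0 0 ∧
        s.arr 13 0 0 ≤ s.arr 19 0 0) ∧ c < k) →
      (Prog.accept.run M ω s).nat 3 = c ∧ (Prog.accept.run M ω s).arr 4 = s.arr 4) := by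
  have t1 : (Test.le (.mul (.scalar 24) (.scalar 24)) (.mul (.scalar 12) (.scalar 12))).holds s ↔
    s.arr 24 0 0 * s.arr 24 0 0 ≤ s.arr 12 0 0 * s.arr 12 0 0 := Iff.rfl
  have t2 : ∀ m, (Test.le (.scalar 13) (.scalar 19)).holds (s.tick m) ↔
    s.arr 13 0 0 ≤ s.arr 19 0 0 := fun _ => Iff.rfl
  have t3 : ∀ m m', (Test.leN (.add (.reg 3) (.const 1)) (.reg 1)).holds ((s.tick m).tick m') ↔
      c < k := fun _ _ => by
    rw [← hc, ← hk]; exact Iff.rfl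
  rw [Prog.accept]
  constructor
  · rintro ⟨⟨h1, h2⟩, h3⟩
    rw [run_ite_pos M ω (t1.2 h1), run_ite_pos M ω ((t2 _).2 h2), run_ite_pos M ω ((t3 _ _).2 h3), run_seq]
    set s1 : State := State.tick _ _ with hs1
    have e3 : (NExp.reg 3).eval s1 = c := hc
    have hr := setRow_arr M ω (a := 4) (i := .reg 3) (e := .cell 23 (.const 0) (.reg 5))
      (s := s1) hn (vecOf n (s.arr 23) 0) (fun s' h => h 3 (by decide)) (fun s' l h5 _ hA _ => by
        simp only [RExp.eval, NExp.eval, h5, hA 23 (by decide)]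
        rfl)
    rw [e3] at hr
    constructor
    · rw [setN_nat]
      simp only [NExp.eval]
      rw [Prog.run_nat M ω _ (by decide)]
      exact congrArg (· + 1) hc
    · rw [Prog.run_arr M ω _ (by decide)]
      funext i
      by_cases hi : i = c
      · subst hi; rw [Function.update_self, hr.1]
      · rw [Function.update_of_ne hi, vecOf, hr.2 i hi]
        rfl
  · intro h
    by_cases h1 : s.arr 24 0 0 * s.arr 24 0 0 ≤ s.arr 12 0 0 * s.arr 12 0 0
    · rw [run_ite_pos M ω (t1.2 h1)]
      by_cases h2 : s.arr 13 0 0 ≤ s.arr 19 0 0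
      · rw [run_ite_pos M ω ((t2 _).2 h2), run_ite_neg M ω (fun h3 => h ⟨⟨h1, h2⟩, (t3 _ _).1 h3⟩)]
        exact ⟨hc, rfl⟩
      · rw [run_ite_neg M ω (fun h3 => h2 ((t2 _).1 h3))]
        exact ⟨hc, rfl⟩
    · rw [run_ite_neg M ω (fun h3 => h1 (t1.1 h3))]
      exact ⟨hc, rfl⟩

/-- The effect of one attempt. -/
theorem attempt_spec {s : State} {k c N : ℕ} (hn : s.nat 0 = n) (hk : s.nat 1 = k)
    (hN : s.nat 2 = N) (hc : s.nat 3 = c) {b : ℕ → EuclideanSpace ℝ (Fin n)}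
    (hb : vecOf n (s.arr 4) = b) {r R θ κ : ℝ} (hr : s.arr 10 0 0 = r) (hR : s.arr 11 0 0 = R)
    (hθ : s.arr 12 0 0 = θ) (hκ : s.arr 13 0 0 = κ) {y v g z : EuclideanSpace ℝ (Fin n)}
    (hg : g = WithLp.toLp 2 fun l : Fin n => ω (s.drawn + l))
    (hz : z = WithLp.toLp 2 fun l : Fin n => ω (s.drawn + n + l))
    (hy : y = reduce id b k g) (hv : v = normalEstimate M (3 * (N * N)) y r R) :
    (Prog.attempt.run M ω s).drawn = s.drawn + n + n ∧
    ((((displacement M (3 * (N * N)) y r R z - inner ℝ v z) *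
        (displacement M (3 * (N * N)) y r R z - inner ℝ v z) ≤ θ * θ ∧
      κ ≤ inner ℝ (reduce id b k v) (reduce id b k v)) ∧ c < k) →
      (Prog.attempt.run M ω s).nat 3 = c + 1 ∧ vecOf n ((Prog.attempt.run M ω s).arr 4) =
        Function.update b c (reduce id b k v)) ∧
    (¬ (((displacement M (3 * (N * N)) y r R z - inner ℝ v z) *
        (displacement M (3 * (N * N)) y r R z - inner ℝ v z) ≤ θ * θ ∧
      κ ≤ inner ℝ (reduce id b k v) (reduce id b k v)) ∧ c < k) →
      (Prog.attempt.run M ω s).nat 3 = c ∧ (Prog.attempt.run M ω s).arr 4 = s.arr 4) := by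
  simp only [Prog.attempt, run_seq]
  obtain ⟨a1, d1⟩ := drawLine_spec M ω hn hk
  have f1 := fun x hx => Prog.drawLine.run_arr M ω (a := x) hx s
  have g1 := fun x hx => Prog.drawLine.run_nat M ω (r := x) hx s
  generalize Prog.drawLine.run M ω s = s1 at a1 d1 f1 g1 ⊢
  have a2 := baseCrossing_spec M ω (s := s1) ((g1 0 (by decide)).trans hn)
    ((g1 2 (by decide)).trans hN)
  have f2 := fun x hx => Prog.baseCrossing.run_arr M ω (a := x) hx s1
  have g2 := fun x hx => Prog.baseCrossing.run_nat M ω (r := x) hx s1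
  have d2 := Prog.baseCrossing.run_drawn M ω (by decide) s1
  generalize Prog.baseCrossing.run M ω s1 = s2 at a2 d2 f2 g2 ⊢
  rw [hb, ← hg, ← hy] at a1
  rw [a1, f1 10 (by decide), hr] at a2
  have y2 : vecOf n (s2.arr 20) 0 = y := by rw [f2 20 (by decide), a1]
  have r2 : s2.arr 10 0 0 = r := by rw [f2 10 (by decide), f1 10 (by decide), hr]
  have R2 : s2.arr 11 0 0 = R := by rw [f2 11 (by decide), f1 11 (by decide), hR]
  have n2 : s2.nat 0 = n := by rw [g2 0 (by decide), g1 0 (by decide), hn]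
  have N2 : s2.nat 2 = N := by rw [g2 2 (by decide), g1 2 (by decide), hN]
  have a3 := probeAxes_spec M ω (s := s2) n2 N2 (by rw [y2, r2, a2])
  rw [y2, r2, R2, ← hv] at a3
  have f3 := fun x hx => Prog.probeAxes.run_arr M ω (a := x) hx s2
  have g3 := fun x hx => Prog.probeAxes.run_nat M ω (r := x) hx s2
  have d3 := Prog.probeAxes.run_drawn M ω (by decide) s2
  generalize Prog.probeAxes.run M ω s2 = s3 at a3 d3 f3 g3 ⊢
  obtain ⟨a4, d4⟩ := probeRandom_spec M ω (s := s3) ((g3 0 (by decide)).trans n2)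
    ((g3 2 (by decide)).trans N2) (by
      rw [f3 17 (by decide), f3 20 (by decide), f3 10 (by decide), y2, r2, a2])
  rw [f3 20 (by decide), f3 10 (by decide), f3 11 (by decide), y2, r2, R2, a3, d3, d2, d1,
    ← hz] at a4
  rw [d3, d2, d1] at d4
  have f4 := fun x hx => Prog.probeRandom.run_arr M ω (a := x) hx s3
  have g4 := fun x hx => Prog.probeRandom.run_nat M ω (r := x) hx s3
  generalize Prog.probeRandom.run M ω s3 = s4 at a4 d4 f4 g4 ⊢
  have A4 : s4.arr 4 = s.arr 4 := by
    rw [f4 4 (by decide), f3 4 (by decide), f2 4 (by decide), f1 4 (by decide)]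
  obtain ⟨a5, b5⟩ := reduceEstimate_spec M ω (s := s4) (n := n) (k := k)
    (by rw [g4 0 (by decide), g3 0 (by decide), n2])
    (by rw [g4 1 (by decide), g3 1 (by decide), g2 1 (by decide), g1 1 (by decide), hk])
  rw [A4, hb, f4 23 (by decide), a3] at a5 b5
  have f5 := fun x hx => Prog.reduceEstimate.run_arr M ω (a := x) hx s4
  have g5 := fun x hx => Prog.reduceEstimate.run_nat M ω (r := x) hx s4
  have d5 := Prog.reduceEstimate.run_drawn M ω (by decide) s4
  generalize Prog.reduceEstimate.run M ω s4 = s5 at a5 b5 d5 f5 g5 ⊢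
  have G5 : ∀ x ∈ [0, 1, 2, 3], s5.nat x = s.nat x := by
    intro x hx
    rw [g5 x (by revert x; decide), g4 x (by revert x; decide), g3 x (by revert x; decide),
      g2 x (by revert x; decide), g1 x (by revert x; decide)]
  have F5 : ∀ x ∈ [4, 12, 13], s5.arr x = s.arr x := by
    intro x hx
    rw [f5 x (by revert x; decide), f4 x (by revert x; decide), f3 x (by revert x; decide),
      f2 x (by revert x; decide), f1 x (by revert x; decide)]
  have fin := accept_spec M ω (s := s5) (n := n) (k := k) (c := c) ((G5 0 (by decide)).trans hn)
    ((G5 1 (by decide)).trans hk) ((G5 3 (by decide)).trans hc)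
  rw [f5 24 (by decide), a4, b5, a5, F5 4 (by decide), F5 12 (by decide), F5 13 (by decide), hθ, hκ,
    hb] at fin
  refine ⟨?_, fin.1, fin.2⟩
  rw [Prog.run_drawn M ω _ (by decide), d5, d4]

end

end RAM

end

/-! ### Intersecting the learnt span with the kernel of the projection -/

noncomputable section

namespace RAM

/-- Write the product of the matrix in array `2` with the vector in array `32` into row `r10` of
array `31`. -/
def Prog.projectRow : Prog :=
  .loop 8 (.reg 0) (.seq (.dot 18 2 (.reg 8) 32 (.const 0))
    (.setR 31 (.reg 10) (.reg 8) (.scalar 18)))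

/-- One step of Gram–Schmidt orthogonalization of the rows of array `4` with respect to the form
defined by the matrix in array `2`; a null vector of this form is written to the output. -/
def Prog.finishStep : Prog :=
  .seq (.setRow 32 (.const 0) (.cell 4 (.reg 10) (.reg 5)))
    (.seq (.reduceRow 30 31 32)
    (.seq (.setRow 30 (.reg 10) (.cell 32 (.const 0) (.reg 5)))
    (.seq .projectRow
    (.seq (.dot 19 31 (.reg 10) 32 (.const 0))
    (.ite (.le (.scalar 19) (.const 0))
      (.setRow 3 (.const 0) (.cell 32 (.const 0) (.reg 5))) .skip)))))

/-- Find a vector in the span of the rows of array `4` that the matrix in array `2` maps to `0`. -/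
def Prog.finish : Prog := .loop 10 (.reg 1) .finishStep

section

variable {n : ℕ} (M : EuclideanSpace ℝ (Fin n) → ℕ) (ω : ℕ → ℝ)

theorem Prog.run_eq_of_not_random (p : Prog) (h : p.random = false) (ω' : ℕ → ℝ) (s : State) :
    p.run M ω s = p.run M ω' s := by
  induction p generalizing s with
  | skip => rfl
  | seq p q hp hq =>
    simp only [Prog.random, Bool.or_eq_false_iff] at h
    simp only [Prog.run]
    rw [hp h.1, hq h.2]
  | setN r' e => rfl
  | setR a' i j e => rfl
  | gauss a' i j => simp [Prog.random] at h
  | query r' a i => rfl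
  | ite t p q hp hq =>
    simp only [Prog.random, Bool.or_eq_false_iff] at h
    simp only [Prog.run, hp h.1, hq h.2]
  | loop r' e p hp =>
    simp only [Prog.random] at h
    simp only [Prog.run, hp h]

theorem Prog.measurable_foldl {α : Type*} [MeasurableSpace α]
    {M : EuclideanSpace ℝ (Fin n) → ℕ} (hM : Measurable M)
    (p : Prog) (r : ℕ) (l : List ℕ) {W : α → ℕ → ℝ} (hW : Measurable W) {f : α → State}
    (hf : Measurable f) : Measurable fun x =>
      l.foldl (fun s' m => p.run M (W x) ((s'.writeN r m).tick 1)) (f x) := by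
  induction l generalizing f with
  | nil => exact hf
  | cons a l ih =>
    exact ih (p.measurable_run hM hW (measurable_tick (measurable_writeN hf r measurable_const)))

theorem projectRow_arr {s : State} {i : ℕ} {P : EuclideanSpace ℝ (Fin n) → EuclideanSpace ℝ (Fin n)}
    (hn : s.nat 0 = n) (hi : s.nat 10 = i)
    (hP : ∀ (l : Fin n) (x : EuclideanSpace ℝ (Fin n)),
      inner ℝ (vecOf n (s.arr 2) l) x = P x l) :
    vecOf n ((Prog.projectRow.run M ω s).arr 31) =
      Function.update (vecOf n (s.arr 31)) i (P (vecOf n (s.arr 32) 0)) := by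
  have key := run_loop_arr M ω (r := 8) (e := .reg 0) (s := s)
    (p := .seq (.dot 18 2 (.reg 8) 32 (.const 0)) (.setR 31 (.reg 10) (.reg 8) (.scalar 18)))
    (fun m A => (∀ j : Fin n, (j : ℕ) < m → A 31 i j = P (vecOf n (s.arr 32) 0) j) ∧
      ∀ i' ≠ i, A 31 i' = s.arr 31 i')
    ⟨fun j hj => absurd hj (Nat.not_lt_zero _), fun _ _ => rfl⟩ ?_
  · simp only [NExp.eval, hn] at key
    funext i'
    by_cases h : i' = i
    · subst h
      rw [Function.update_self]
      ext j
      exact key.1 j j.2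
    · rw [Function.update_of_ne h, vecOf, vecOf, Prog.projectRow, key.2 i' h]
  · rintro m hm s' h8 hr hA ⟨h1, h2⟩
    simp only [NExp.eval, hn] at hm
    rw [run_seq]
    have d := dot_arr M ω (dst := 18) (a := 2) (a' := 32) (i := .reg 8) (i' := .const 0) (s := s')
      (n := n) ((hr 0 (by decide)).trans hn) (by decide) (by decide)
      (fun s'' h => h 8 (by decide)) (fun _ _ => rfl)
    have f := fun x hx => (Prog.dot 18 2 (.reg 8) 32 (.const 0)).run_arr M ω (a := x) hx s'
    have g := fun x hx => (Prog.dot 18 2 (.reg 8) 32 (.const 0)).run_nat M ω (r := x) hx s'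
    generalize (Prog.dot 18 2 (.reg 8) 32 (.const 0)).run M ω s' = s1 at d f g ⊢
    have e10 : s1.nat 10 = i := by rw [g 10 (by decide), hr 10 (by decide), hi]
    have e8 : s1.nat 8 = m := by rw [g 8 (by decide), h8]
    rw [hA 2 (by decide), hA 32 (by decide)] at d
    simp only [NExp.eval, h8] at d
    have hPm := hP ⟨m, hm⟩ (vecOf n (s.arr 32) 0)
    simp only at hPm
    refine ⟨fun j hj => ?_, fun i' hi' => ?_⟩
    · rw [setR_arr]
      simp only [NExp.eval, RExp.eval, RExp.scalar, e10, e8, true_and, d]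
      split_ifs with h
      · rw [hPm, show j = ⟨m, hm⟩ from Fin.ext h]
      · rw [f 31 (by decide)]
        exact h1 j (by omega)
    · funext j
      rw [setR_arr, if_neg (by simp only [NExp.eval, e10]; exact fun h => hi' h.1),
        f 31 (by decide), h2 i' hi']

/-- The state of the orthogonalization after `m` steps. -/
structure Orthogonalized (P : EuclideanSpace ℝ (Fin n) → EuclideanSpace ℝ (Fin n))
    (b : ℕ → EuclideanSpace ℝ (Fin n)) (k m : ℕ) (a z : ℕ → EuclideanSpace ℝ (Fin n))
    (out : EuclideanSpace ℝ (Fin n)) : Prop where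
  eq_zero : ∀ i ≥ m, a i = 0
  image : ∀ i, z i = P (a i)
  mem_span : ∀ i < m, b i - a i ∈ Submodule.span ℝ (b '' (Finset.range i : Set ℕ))
  orth : ∀ i j, i ≠ j → inner ℝ (P (a i)) (P (a j)) = 0
  output : (∃ i < m, P (a i) = 0) →
    out ≠ 0 ∧ P out = 0 ∧ out ∈ Submodule.span ℝ (b '' (Finset.range k : Set ℕ))

/-- The reduced vector differs from `b m` by a combination of earlier `b i`, so it is nonzero and
stays in their span even when the form vanishes on it. Such a null vector is exactly what is sought;
it is sent to the output and does no harm to later reductions. -/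
theorem Orthogonalized.succ {P : EuclideanSpace ℝ (Fin n) →ₗ[ℝ] EuclideanSpace ℝ (Fin n)}
    (hP : ∀ x y, inner ℝ (P x) y = inner ℝ (P x) (P y)) {b a z : ℕ → EuclideanSpace ℝ (Fin n)}
    {k m : ℕ} {out out' : EuclideanSpace ℝ (Fin n)} (h : Orthogonalized P b k m a z out)
    (hm : m < k) (hb0 : b m ≠ 0) (hb : ∀ i j, i ≠ j → inner ℝ (b i) (b j) = 0)
    (h1 : P (reduce P a k (b m)) = 0 → out' = reduce P a k (b m))
    (h2 : P (reduce P a k (b m)) ≠ 0 → out' = out) :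
    Orthogonalized P b k (m + 1) (Function.update a m (reduce P a k (b m)))
      (Function.update z m (P (reduce P a k (b m)))) out' := by
  have horth : ∀ i < m, ∀ j < m, i ≠ j → inner ℝ (P (a i)) (P (a j)) = 0 := fun i _ j _ => h.orth i j
  have hred := reduce_of_eq_zero (P := P) hm.le (fun i hi _ => h.eq_zero i hi) (b m)
  set u := reduce P a k (b m) with hu
  have hspan : ∀ i < m, a i ∈ Submodule.span ℝ (b '' (Finset.range (i + 1) : Set ℕ)) := by
    intro i hi
    have e : a i = b i - (b i - a i) := by abel
    rw [e]
    refine sub_mem (Submodule.subset_span ⟨i, by simp, rfl⟩) ?_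
    refine Submodule.span_mono (Set.image_mono ?_) (h.mem_span i hi)
    simp only [Finset.coe_range]
    exact Set.Iio_subset_Iio (Nat.le_succ i)
  have hmem : b m - u ∈ Submodule.span ℝ (b '' (Finset.range m : Set ℕ)) := by
    rw [hred]
    refine Submodule.span_le.2 ?_ (sub_reduce_mem_span P a m (b m))
    rintro _ ⟨i, hi, rfl⟩
    have hi' : i < m := by simpa using hi
    refine Submodule.span_mono (Set.image_mono ?_) (hspan i hi')
    simp only [Finset.coe_range]
    exact Set.Iio_subset_Iio hi'
  -- If `u = 0`, then `b m` would lie in the span of vectors orthogonal to it.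
  have hu0 : u ≠ 0 := by
    intro h0
    rw [h0, sub_zero] at hmem
    refine hb0 (inner_self_eq_zero (𝕜 := ℝ).1 ?_)
    refine Submodule.span_induction (p := fun x _ => inner ℝ (b m) x = 0) ?_ ?_ ?_ ?_ hmem
    · rintro _ ⟨i, hi, rfl⟩
      have hi' : i < m := by simpa using hi
      exact hb m i hi'.ne'
    · simp
    · intro x y _ _ hx hy
      rw [inner_add_right, hx, hy, add_zero]
    · intro r x _ hx
      rw [inner_smul_right, hx, mul_zero]
  have hPu : ∀ i, inner ℝ (P (a i)) (P u) = 0 := by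
    intro i
    rcases lt_or_ge i m with hi | hi
    · rw [← hP, hred]
      exact inner_reduce hP horth le_rfl (b m) hi
    · rw [h.eq_zero i hi, map_zero, inner_zero_left]
  refine ⟨fun i hi => ?_, fun i => ?_, fun i hi => ?_, fun i j hij => ?_, ?_⟩
  · rw [Function.update_of_ne (by omega)]
    exact h.eq_zero i (by omega)
  · by_cases hi : i = m
    · subst hi; rw [Function.update_self, Function.update_self]
    · rw [Function.update_of_ne hi, Function.update_of_ne hi, h.image]
  · rcases Nat.lt_succ_iff_lt_or_eq.1 hi with hi | rfl
    · rw [Function.update_of_ne hi.ne]; exact h.mem_span i hi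
    · rw [Function.update_self]; exact hmem
  · by_cases hi : i = m
    · subst hi
      rw [Function.update_self, Function.update_of_ne hij.symm, real_inner_comm]
      exact hPu j
    · rw [Function.update_of_ne hi]
      by_cases hj : j = m
      · subst hj; rw [Function.update_self]; exact hPu i
      · rw [Function.update_of_ne hj]; exact h.orth i j hij
  · rintro ⟨i, hi, hPi⟩
    by_cases hPu0 : P u = 0
    · rw [h1 hPu0]
      refine ⟨hu0, hPu0, ?_⟩
      have e : u = b m - (b m - u) := by abel
      rw [e]
      refine sub_mem (Submodule.subset_span ⟨m, by simpa using hm, rfl⟩)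
        (Submodule.span_mono (Set.image_mono ?_) hmem)
      simp only [Finset.coe_range]
      exact Set.Iio_subset_Iio hm.le
    · rw [h2 hPu0]
      rcases Nat.lt_succ_iff_lt_or_eq.1 hi with hi | rfl
      · rw [Function.update_of_ne hi.ne] at hPi
        exact h.output ⟨i, hi, hPi⟩
      · rw [Function.update_self] at hPi
        exact absurd hPi hPu0

theorem finishStep_spec {P : EuclideanSpace ℝ (Fin n) →ₗ[ℝ] EuclideanSpace ℝ (Fin n)}
    (hP : ∀ x y, inner ℝ (P x) y = inner ℝ (P x) (P y)) {s : State} {k m : ℕ}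
    (hn : s.nat 0 = n) (hk : s.nat 1 = k) (hm : s.nat 10 = m)
    (h2 : ∀ (l : Fin n) (x : EuclideanSpace ℝ (Fin n)), inner ℝ (vecOf n (s.arr 2) l) x = P x l)
    (hz : ∀ i, vecOf n (s.arr 31) i = P (vecOf n (s.arr 30) i))
    {u : EuclideanSpace ℝ (Fin n)}
    (hu : u = reduce P (vecOf n (s.arr 30)) k (vecOf n (s.arr 4) m)) :
    vecOf n ((Prog.finishStep.run M ω s).arr 30) = Function.update (vecOf n (s.arr 30)) m u ∧
    vecOf n ((Prog.finishStep.run M ω s).arr 31) = Function.update (vecOf n (s.arr 31)) m (P u) ∧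
    (P u = 0 → vecOf n ((Prog.finishStep.run M ω s).arr 3) 0 = u) ∧
    (P u ≠ 0 → vecOf n ((Prog.finishStep.run M ω s).arr 3) 0 = vecOf n (s.arr 3) 0) := by
  simp only [Prog.finishStep, run_seq]
  have a1 := (setRow_arr M ω (a := 32) (i := .const 0) (e := .cell 4 (.reg 10) (.reg 5)) (s := s) hn
    (vecOf n (s.arr 4) m) (fun _ _ => rfl) (fun s' l h5 hr hA _ => by
      simp only [RExp.eval, NExp.eval, h5, hr 10 (by decide), hA 4 (by decide), hm]
      rfl)).1
  have f1 := fun x hx => (Prog.setRow 32 (.const 0) (.cell 4 (.reg 10) (.reg 5))).run_arr M ω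
    (a := x) hx s
  have g1 := fun x hx => (Prog.setRow 32 (.const 0) (.cell 4 (.reg 10) (.reg 5))).run_nat M ω
    (r := x) hx s
  generalize (Prog.setRow 32 (.const 0) (.cell 4 (.reg 10) (.reg 5))).run M ω s = s1 at a1 f1 g1 ⊢
  simp only [NExp.eval] at a1
  have a2 := reduceRow_arr M ω (P := P) (a := 30) (z := 31) (t := 32) (s := s1) (n := n) (k := k)
    (by rw [g1 0 (by decide), hn]) (by rw [g1 1 (by decide), hk]) (by decide) (by decide) (by decide)
    (fun j _ => by rw [f1 31 (by decide), f1 30 (by decide), hz])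
  have f2 := fun x hx => (Prog.reduceRow 30 31 32).run_arr M ω (a := x) hx s1
  have g2 := fun x hx => (Prog.reduceRow 30 31 32).run_nat M ω (r := x) hx s1
  rw [f1 30 (by decide), a1, ← hu] at a2
  generalize (Prog.reduceRow 30 31 32).run M ω s1 = s2 at a2 f2 g2 ⊢
  have n2 : s2.nat 0 = n := by rw [g2 0 (by decide), g1 0 (by decide), hn]
  have m2 : s2.nat 10 = m := by rw [g2 10 (by decide), g1 10 (by decide), hm]
  have a3 := setRow_arr M ω (a := 30) (i := .reg 10) (e := .cell 32 (.const 0) (.reg 5)) (s := s2) n2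
    u (fun s' h => h 10 (by decide)) (fun s' l h5 _ hA _ => by
      simp only [RExp.eval, NExp.eval, h5, hA 32 (by decide)]
      exact congrArg (fun v : EuclideanSpace ℝ (Fin n) => v l) a2)
  have f3 := fun x hx => (Prog.setRow 30 (.reg 10) (.cell 32 (.const 0) (.reg 5))).run_arr M ω
    (a := x) hx s2
  have g3 := fun x hx => (Prog.setRow 30 (.reg 10) (.cell 32 (.const 0) (.reg 5))).run_nat M ω
    (r := x) hx s2
  simp only [NExp.eval, m2] at a3
  generalize (Prog.setRow 30 (.reg 10) (.cell 32 (.const 0) (.reg 5))).run M ω s2 = s3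
    at a3 f3 g3 ⊢
  have n3 : s3.nat 0 = n := by rw [g3 0 (by decide), n2]
  have m3 : s3.nat 10 = m := by rw [g3 10 (by decide), m2]
  have e3 : vecOf n (s3.arr 30) = Function.update (vecOf n (s.arr 30)) m u := by
    funext i
    by_cases hi : i = m
    · subst hi; rw [Function.update_self, a3.1]
    · rw [Function.update_of_ne hi, vecOf, vecOf, a3.2 i hi, f2 30 (by decide), f1 30 (by decide)]
  have a4 := projectRow_arr M ω (s := s3) (i := m) (P := P) n3 m3 (fun l x => by
    rw [f3 2 (by decide), f2 2 (by decide), f1 2 (by decide), h2])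
  rw [f3 32 (by decide), a2, f3 31 (by decide), f2 31 (by decide), f1 31 (by decide)] at a4
  have f4 := fun x hx => Prog.projectRow.run_arr M ω (a := x) hx s3
  have g4 := fun x hx => Prog.projectRow.run_nat M ω (r := x) hx s3
  generalize Prog.projectRow.run M ω s3 = s4 at a4 f4 g4 ⊢
  have a5 := dot_arr M ω (dst := 19) (a := 31) (a' := 32) (i := .reg 10) (i' := .const 0) (s := s4)
    (n := n) (by rw [g4 0 (by decide), n3]) (by decide) (by decide)
    (fun s'' h => h 10 (by decide)) (fun _ _ => rfl)
  have m4 : s4.nat 10 = m := by rw [g4 10 (by decide), m3]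
  simp only [NExp.eval, m4] at a5
  rw [a4, Function.update_self, f4 32 (by decide), f3 32 (by decide), a2, hP,
    real_inner_self_eq_norm_sq] at a5
  have f5 := fun x hx => (Prog.dot 19 31 (.reg 10) 32 (.const 0)).run_arr M ω (a := x) hx s4
  have g5 := fun x hx => (Prog.dot 19 31 (.reg 10) 32 (.const 0)).run_nat M ω (r := x) hx s4
  generalize (Prog.dot 19 31 (.reg 10) 32 (.const 0)).run M ω s4 = s5 at a5 f5 g5 ⊢
  -- The tested number is `⟪P u, u⟫ = ‖P u‖ ^ 2`, so with exact arithmetic comparing it with `0`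
  -- decides `P u = 0`.
  have ht : (Test.le (.scalar 19) (.const 0)).holds s5 ↔ P u = 0 := by
    simp only [Test.holds, RExp.eval, RExp.scalar, NExp.eval, a5]
    rw [Rat.cast_zero, sq_nonpos_iff, norm_eq_zero]
  refine ⟨?_, ?_, fun h => ?_, fun h => ?_⟩
  · rw [Prog.run_arr M ω _ (by decide), f5 30 (by decide), f4 30 (by decide), e3]
  · rw [Prog.run_arr M ω _ (by decide), f5 31 (by decide), a4]
  · rw [run_ite_pos M ω (ht.2 h)]
    refine (setRow_arr M ω (a := 3) (i := .const 0) (e := .cell 32 (.const 0) (.reg 5)) ?_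
      u (fun _ _ => rfl) (fun s' l h5 _ hA _ => ?_)).1
    · change s5.nat 0 = n
      rw [g5 0 (by decide), g4 0 (by decide), n3]
    · simp only [RExp.eval, NExp.eval, h5, hA 32 (by decide), State.tick]
      rw [f5 32 (by decide), f4 32 (by decide), f3 32 (by decide)]
      exact congrArg (fun v : EuclideanSpace ℝ (Fin n) => v l) a2
  · rw [run_ite_neg M ω (fun h' => h (ht.1 h'))]
    change vecOf n (s5.arr 3) 0 = _
    rw [f5 3 (by decide), f4 3 (by decide), f3 3 (by decide), f2 3 (by decide), f1 3 (by decide)]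

/-- After `k` steps there are `k` vectors with orthogonal images in `V`; since `dim V < k` one image
is zero, and such a vector has been written to the output. It is annihilated by `P_V` exactly. -/
theorem finish_spec {V : Submodule ℝ (EuclideanSpace ℝ (Fin n))} {s : State} {k : ℕ}
    (hV : Module.finrank ℝ V < k) (hn : s.nat 0 = n) (hk : s.nat 1 = k)
    (h2 : ∀ (l : Fin n) (x : EuclideanSpace ℝ (Fin n)),
      inner ℝ (vecOf n (s.arr 2) l) x = V.starProjection x l)
    (h30 : ∀ i, vecOf n (s.arr 30) i = 0) (h31 : ∀ i, vecOf n (s.arr 31) i = 0)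
    (hb0 : ∀ i < k, vecOf n (s.arr 4) i ≠ 0)
    (hb : ∀ i j, i ≠ j → inner ℝ (vecOf n (s.arr 4) i) (vecOf n (s.arr 4) j) = 0) :
    (Prog.finish.run M ω s).output n ≠ 0 ∧ V.starProjection ((Prog.finish.run M ω s).output n) = 0 ∧
      (Prog.finish.run M ω s).output n ∈
        Submodule.span ℝ (vecOf n (s.arr 4) '' (Finset.range k : Set ℕ)) := by
  set P : EuclideanSpace ℝ (Fin n) →ₗ[ℝ] EuclideanSpace ℝ (Fin n) :=
    (V.starProjection : EuclideanSpace ℝ (Fin n) →L[ℝ] EuclideanSpace ℝ (Fin n)).toLinearMap with hPdef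
  have hP : ∀ x y, inner ℝ (P x) y = inner ℝ (P x) (P y) := fun x y => by
    have : inner ℝ (P x) (y - P y) = 0 :=
      (Submodule.mem_orthogonal _ _).1 (V.sub_starProjection_mem_orthogonal y) _
        (V.starProjection_apply_mem x)
    rw [inner_sub_right] at this
    linarith
  have key := run_loop_arr M ω (r := 10) (e := .reg 1) (p := .finishStep) (s := s)
    (fun m A => Orthogonalized P (vecOf n (s.arr 4)) k m (vecOf n (A 30)) (vecOf n (A 31))
      (vecOf n (A 3) 0)) ?_ ?_
  · simp only [NExp.eval, hk] at key
    obtain ⟨i, hi, h0⟩ := exists_map_eq_zero hV fun i _ j _ hij => key.orth i j hij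
    exact key.output ⟨i, hi, h0⟩
  · refine ⟨fun i _ => h30 i, fun i => by rw [h30, h31, map_zero],
      fun i hi => absurd hi (Nat.not_lt_zero _), fun i j _ => by rw [h30, map_zero, inner_zero_left],
      fun ⟨i, hi, _⟩ => absurd hi (Nat.not_lt_zero _)⟩
  · intro m hm s' h10 hr hA h
    simp only [NExp.eval, hk] at hm
    obtain ⟨k1, k2, k3, k4⟩ := finishStep_spec M ω hP (s := s') (k := k) (m := m)
      ((hr 0 (by decide)).trans hn) ((hr 1 (by decide)).trans hk) h10
      (by rw [hA 2 (by decide)]; exact h2) h.image rfl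
    rw [k1, k2]
    rw [hA 4 (by decide)] at k3 k4 ⊢
    exact h.succ hP hm (hb0 m hm) hb k3 k4

end

end RAM

end

/-! ### Success probability of repeated rounds -/

noncomputable section

/-- `G` need not be measurable: it is replaced by the measurable set `{h ≤ a}` that contains it. -/
theorem lintegral_le_of_le_on {α : Type*} [MeasurableSpace α] {μ : Measure α}
    [IsProbabilityMeasure μ] {h : α → ℝ≥0∞} (hm : Measurable h) {G : Set α} {β a e : ℝ≥0∞}
    (hG : β ≤ μ G) (h1 : ∀ g, h g ≤ a + e) (h2 : ∀ g ∈ G, h g ≤ a) :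
    ∫⁻ g, h g ∂μ ≤ a + e * (1 - β) := by
  have hs : MeasurableSet {g | h g ≤ a} := measurableSet_le hm measurable_const
  calc ∫⁻ g, h g ∂μ ≤ ∫⁻ g, a + {g | h g ≤ a}ᶜ.indicator (fun _ => e) g ∂μ := by
        refine lintegral_mono fun g => ?_
        by_cases hg : h g ≤ a
        · exact hg.trans le_self_add
        · rw [Set.indicator_of_mem (show g ∈ {g | h g ≤ a}ᶜ from hg)]
          exact h1 g
    _ = a + e * (1 - μ {g | h g ≤ a}) := by
        rw [lintegral_add_left measurable_const, lintegral_const, measure_univ, mul_one,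
          lintegral_indicator_const hs.compl, prob_compl_eq_one_sub hs]
    _ ≤ _ := by gcongr; exact hG.trans (measure_mono h2)

namespace RAM

variable {n : ℕ}

theorem measurable_coins_prepend {F : Set (ℕ → ℝ)} (hF : MeasurableSet F) :
    Measurable fun g : EuclideanSpace ℝ (Fin n) => coins (prepend g ⁻¹' F) :=
  measurable_measure_prodMk_left (measurable_prepend hF)

theorem coins_eq_lintegral (n : ℕ) {F : Set (ℕ → ℝ)} (hF : MeasurableSet F) :
    coins F = ∫⁻ g, coins (prepend g ⁻¹' F) ∂(stdGaussian (EuclideanSpace ℝ (Fin n))) := by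
  rw [← (measurePreserving_prepend n).measure_preimage hF.nullMeasurableSet,
    Measure.prod_apply (measurable_prepend hF)]
  rfl

theorem measurable_prepend_left (g : EuclideanSpace ℝ (Fin n)) : Measurable (prepend g) :=
  measurable_prepend.comp measurable_prodMk_left

/-- If the repeated program draws two vectors `g` and `z` per round and, with good probability,
makes progress in the counter `c`, then `k` is reached with high probability. -/
theorem coins_foldl_le {M : EuclideanSpace ℝ (Fin n) → ℕ} (hM : Measurable M) (p : Prog) (r : ℕ)
    {k : ℕ} {I : ℕ → State → Prop} {Q : State → Prop} (hQm : MeasurableSet {s | ¬ Q s})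
    (hIQ : ∀ s, I k s → Q s) (htick : ∀ c s m, I c s → I c ((s.writeN r m).tick 1))
    (stable : ∀ s ω, I k s → I k (p.run M ω s)) {q β lam : ℝ≥0∞}
    (hlam : 1 + (1 / 2 + 1 / 2 * (1 - β)) ≤ 2 * lam)
    (step : ∀ c < k, ∀ s, I c s →
      ∃ (Bad Stay : EuclideanSpace ℝ (Fin n) → Set (EuclideanSpace ℝ (Fin n)))
        (G : Set (EuclideanSpace ℝ (Fin n))),
        (∀ g, MeasurableSet (Bad g)) ∧ (∀ g, MeasurableSet (Stay g)) ∧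
        (∀ g, stdGaussian _ (Bad g) ≤ q) ∧ β ≤ stdGaussian _ G ∧
        (∀ g ∈ G, stdGaussian _ (Stay g) ≤ 1 / 2) ∧
        ∀ ω g z, g = WithLp.toLp 2 (fun l : Fin n => ω (s.drawn + l)) →
          z = WithLp.toLp 2 (fun l : Fin n => ω (s.drawn + n + l)) →
          (p.run M ω s).drawn = s.drawn + n + n ∧ (z ∉ Bad g → z ∈ Stay g → I c (p.run M ω s)) ∧
          (z ∉ Bad g → z ∉ Stay g → I (c + 1) (p.run M ω s)))
    (l : List ℕ) {c : ℕ} (hc : c ≤ k) {s : State} (hs : I c s) (ω₀ : ℕ → ℝ) :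
    coins {ω | ¬ Q (l.foldl (fun s' m => p.run M (glue s.drawn ω₀ ω) ((s'.writeN r m).tick 1)) s)} ≤
      l.length * q + 2 ^ (k - c) * lam ^ l.length := by
  induction l generalizing c s ω₀ with
  | nil =>
    simp only [List.length_nil, Nat.cast_zero, zero_mul, zero_add, pow_zero, mul_one]
    exact prob_le_one.trans (one_le_pow₀ (by norm_num))
  | cons a l ih =>
    -- Once the counter is `k`, further rounds preserve the invariant and failure is impossible.
    rcases hc.eq_or_lt with rfl | hc
    · have : {ω | ¬ Q ((a :: l).foldl
          (fun s' m => p.run M (glue s.drawn ω₀ ω) ((s'.writeN r m).tick 1)) s)} = ∅ := by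
        refine Set.eq_empty_iff_forall_notMem.2 fun ω h => h (hIQ _ ?_)
        exact foldl_invariant (I := I c) (fun s' m h => stable _ _ (htick _ _ _ h)) _ _ hs
      rw [this, measure_empty]
      exact zero_le
    set s' := (s.writeN r a).tick 1 with hs'
    obtain ⟨Bad, Stay, G, hBm, hSm, hBad, hG, hGS, hrun⟩ := step c hc s' (htick c s a hs)
    have hD : s'.drawn = s.drawn := rfl
    rw [hD] at hrun
    set D := s.drawn
    set F := {ω | ¬ Q ((a :: l).foldl
      (fun s' m => p.run M (glue D ω₀ ω) ((s'.writeN r m).tick 1)) s)} with hF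
    have hFm : MeasurableSet F :=
      (p.measurable_foldl hM r (a :: l) (measurable_glue D ω₀) measurable_const) hQm
    -- Apart from the false acceptances, failure has bound `2 * e` for the remaining rounds if the
    -- counter stays at `c`, and `e` if it advances.
    set e : ℝ≥0∞ := 2 ^ (k - (c + 1)) * lam ^ l.length with he
    have h2e : (2 : ℝ≥0∞) ^ (k - c) * lam ^ l.length = 2 * e := by
      rw [he, show k - c = k - (c + 1) + 1 by omega, pow_succ]; ring
    have hone : (2 : ℝ≥0∞) * e = e + e := two_mul e
    have slice : ∀ g z, coins (prepend z ⁻¹' (prepend g ⁻¹' F)) ≤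
        (Bad g).indicator 1 z + (l.length * q + e) + (Stay g).indicator (fun _ => e) z := by
      intro g z
      by_cases hb : z ∈ Bad g
      · rw [Set.indicator_of_mem hb]
        exact prob_le_one.trans (le_self_add.trans le_self_add)
      set ω₁ := glue D ω₀ (prepend g (prepend z 0)) with hω₁
      have hg : ∀ ω', g = WithLp.toLp 2 (fun l : Fin n =>
          glue D ω₀ (prepend g (prepend z ω')) (D + l)) := fun ω' => by
        ext l; simp only [glue_add, prepend_of_lt]
      have hz : ∀ ω', z = WithLp.toLp 2 (fun l : Fin n =>
          glue D ω₀ (prepend g (prepend z ω')) (D + n + l)) := fun ω' => by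
        ext l; simp only [add_assoc, glue_add, prepend_add, prepend_of_lt]
      obtain ⟨hd, hstay, hnext⟩ := hrun ω₁ g z (hg 0) (hz 0)
      set s₁ := p.run M ω₁ s' with hs₁
      -- The `2 * n` numbers used in this round join the frozen prefix, so the induction hypothesis
      -- applies to the rest of the stream.
      have hglue : ∀ ω', glue D ω₀ (prepend g (prepend z ω')) = glue s₁.drawn ω₁ ω' := by
        intro ω'
        funext i
        rw [hd]
        simp only [glue, hω₁, prepend]
        split_ifs <;> first | rfl | omega | (congr 1; omega)
      have hfirst : ∀ ω', p.run M (glue D ω₀ (prepend g (prepend z ω'))) s' = s₁ := by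
        intro ω'
        refine (p.run_congr M ω₁ s' fun i hi => ?_).symm
        rw [hglue, glue, if_pos hi]
      have hset : prepend z ⁻¹' (prepend g ⁻¹' F) = {ω' | ¬ Q (l.foldl
          (fun s' m => p.run M (glue s₁.drawn ω₁ ω') ((s'.writeN r m).tick 1)) s₁)} := by
        ext ω'
        simp only [hF, Set.mem_preimage, Set.mem_ofPred_eq, List.foldl_cons]
        rw [← hs', hfirst, hglue]
      rw [hset, Set.indicator_of_notMem hb, zero_add]
      by_cases hst : z ∈ Stay g
      · rw [Set.indicator_of_mem hst, add_assoc, ← hone, ← h2e]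
        exact ih hc.le (hstay hb hst) ω₁
      · rw [Set.indicator_of_notMem hst, add_zero]
        exact ih hc (hnext hb hst) ω₁
    have inner : ∀ g, coins (prepend g ⁻¹' F) ≤
        q + (l.length * q + e) + e * stdGaussian _ (Stay g) := by
      intro g
      rw [coins_eq_lintegral n (measurable_prepend_left g hFm)]
      refine (lintegral_mono (slice g)).trans ?_
      rw [lintegral_add_right _ (measurable_const.indicator (hSm g)),
        lintegral_add_right _ measurable_const, lintegral_const, measure_univ, mul_one,
        lintegral_indicator_const (hSm g), lintegral_indicator_one (hBm g)]
      gcongr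
      exact hBad g
    have hhalf : e * (1 / 2) + e * (1 / 2) = e := by
      rw [← mul_add, one_div, ENNReal.inv_two_add_inv_two, mul_one]
    -- A good `g` pays `e / 2` for staying, any other `g` pays `e`; averaging over `g` gives the
    -- factor bounded by `2 * lam`.
    calc coins F = ∫⁻ g, coins (prepend g ⁻¹' F) ∂(stdGaussian (EuclideanSpace ℝ (Fin n))) :=
          coins_eq_lintegral n hFm
      _ ≤ (q + (l.length * q + e) + e * (1 / 2)) + e * (1 / 2) * (1 - β) := by
          refine lintegral_le_of_le_on (measurable_coins_prepend hFm) hG (fun g => ?_) fun g hg => ?_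
          · rw [add_assoc _ (e * (1 / 2)), hhalf]
            refine (inner g).trans ?_
            gcongr
            exact mul_le_of_le_one_right' prob_le_one
          · refine (inner g).trans ?_
            gcongr
            exact hGS g hg
      _ = (l.length + 1) * q + e * (1 + (1 / 2 + 1 / 2 * (1 - β))) := by ring
      _ ≤ (l.length + 1) * q + e * (2 * lam) := by gcongr
      _ = _ := by
          rw [List.length_cons, Nat.cast_add, Nat.cast_one, pow_succ, ← mul_assoc (2 ^ (k - c)), h2e]
          ring

end RAM

end

/-! ### Analysis of a single round -/

noncomputable section

/-- The numerical relations between the scale `r` of the probes, the bound `X` on all parameters,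
and the number `I` of bisection steps. -/
structure Scale (n k I : ℕ) (X r : ℝ) : Prop where
  sixteen_le : 16 ≤ X
  pos : 0 < r
  small : r * X ^ 25 ≤ 1
  dim_le : (n : ℝ) ≤ X
  width_le : (k : ℝ) ≤ X
  fine : ((2 : ℝ) ^ I)⁻¹ ≤ r ^ 2

/-- The estimate made from the line through `0` in direction `g`, after removing the `b i`. -/
def lineEstimate {n : ℕ} (M : EuclideanSpace ℝ (Fin n) → ℕ) (I k : ℕ) (X r : ℝ)
    (b : ℕ → EuclideanSpace ℝ (Fin n)) (g : EuclideanSpace ℝ (Fin n)) : EuclideanSpace ℝ (Fin n) :=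
  normalEstimate M I (reduce id b k g) r (r * X ^ 5)

/-- The test passed by a line estimate that predicts the displacement in direction `z`. -/
def Predicts {n : ℕ} (M : EuclideanSpace ℝ (Fin n) → ℕ) (I k : ℕ) (X r : ℝ)
    (b : ℕ → EuclideanSpace ℝ (Fin n)) (g z : EuclideanSpace ℝ (Fin n)) : Prop :=
  |displacement M I (reduce id b k g) r (r * X ^ 5) z - inner ℝ (lineEstimate M I k X r b g) z| ≤
    r * X ^ 20

/-- The reduced line estimate is not too short. -/
def IsLarge {n : ℕ} (M : EuclideanSpace ℝ (Fin n) → ℕ) (I k : ℕ) (X r : ℝ)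
    (b : ℕ → EuclideanSpace ℝ (Fin n)) (g : EuclideanSpace ℝ (Fin n)) : Prop :=
  (X ^ 3)⁻¹ ≤ inner ℝ (reduce id b k (lineEstimate M I k X r b g))
    (reduce id b k (lineEstimate M I k X r b g))

variable {n : ℕ}

theorem measurableSet_predicts {M : EuclideanSpace ℝ (Fin n) → ℕ} (hM : Measurable M) (I k : ℕ)
    (X r : ℝ) (b : ℕ → EuclideanSpace ℝ (Fin n)) (g : EuclideanSpace ℝ (Fin n)) :
    MeasurableSet {z | Predicts M I k X r b g z} := by
  refine measurableSet_le ?_ measurable_const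
  exact ((measurable_displacement hM _ _ _ _).sub (by fun_prop)).abs

theorem norm_lineEstimate_le {k I : ℕ} {X r : ℝ} (hs : Scale n k I X r)
    (M : EuclideanSpace ℝ (Fin n) → ℕ) (b : ℕ → EuclideanSpace ℝ (Fin n))
    (g : EuclideanSpace ℝ (Fin n)) : ‖lineEstimate M I k X r b g‖ ≤ X ^ 6 := by
  have hX : 0 < X := by linarith [hs.sixteen_le]
  have h1 : ∀ l, |lineEstimate M I k X r b g l| ≤ X ^ 5 := fun l => by
    have := abs_displacement_le M I (reduce id b k g) hs.pos
      (R := r * X ^ 5) (mul_nonneg hs.pos.le (by positivity)) (EuclideanSpace.single l 1)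
    rwa [mul_div_cancel_left₀ _ hs.pos.ne'] at this
  have h2 : ‖lineEstimate M I k X r b g‖ ^ 2 ≤ (X ^ 6) ^ 2 := by
    rw [EuclideanSpace.real_norm_sq_eq]
    calc ∑ l, lineEstimate M I k X r b g l ^ 2 ≤ ∑ _l : Fin n, (X ^ 5) ^ 2 :=
          Finset.sum_le_sum fun l _ => sq_le_sq' (abs_le.1 (h1 l)).1 (abs_le.1 (h1 l)).2
      _ = n * X ^ 10 := by simp [← pow_mul]
      _ ≤ X * X ^ 10 := by gcongr; exact hs.dim_le
      _ = X ^ 11 := by ring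
      _ ≤ X ^ 12 := pow_le_pow_right₀ (by linarith [hs.sixteen_le]) (by norm_num)
      _ = _ := by ring
  exact le_of_sq_le_sq h2 (by positivity)

/-- Restricted to the ray of `g`, `σ_V` is `σ` on the ray of `y = g - P_V g`, and its derivative
along `g / ‖g‖` is `D (t • y) y / ‖g‖`. So the gradient assumption gives `|D (t • y) y| ≥ η * ‖g‖`,
where `‖g‖ ≥ 1 / X` because `σ 0 = 0` and `σ y ≥ 1`. -/
theorem Network.attempt_succeeds (net : Network n) {L : ℕ → ℝ} {γ η : ℝ} (h : net.Admissible L γ η)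
    {D : EuclideanSpace ℝ (Fin n) → EuclideanSpace ℝ (Fin n) →L[ℝ] ℝ} {k I c : ℕ} {X r : ℝ}
    (hs : Scale n k I X r) (hD : QuadBound net.sigma D X X) (hη : η⁻¹ ≤ X)
    {b : ℕ → EuclideanSpace ℝ (Fin n)} (hb : ∀ i j, i ≠ j → inner ℝ (b i) (b j) = 0)
    (hb0 : ∀ i, c ≤ i → b i = 0) (hck : c ≤ k) {V : Submodule ℝ (EuclideanSpace ℝ (Fin n))}
    (hV : V = Submodule.span ℝ (b '' (Finset.range c : Set ℕ)))
    {g : EuclideanSpace ℝ (Fin n)} (hg : ‖g‖ ≤ X)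
    (hgrad : ∀ c : ℝ, 0 < c → net.sigmaV V (c • g) = 1 →
      η ≤ |lineDeriv ℝ (net.sigmaV V) (c • g) (‖g‖⁻¹ • g)|) (hg1 : 1 ≤ net.sigmaV V g) :
    IsLarge net.M I k X r b g ∧ ∀ z, ‖z‖ ≤ X → Predicts net.M I k X r b g z := by
  have hX : 16 ≤ X := hs.sixteen_le
  have hX0 : 0 < X := by linarith
  have horth : ∀ i < c, ∀ j < c, i ≠ j → inner ℝ (b i) (b j) = 0 := fun i _ j _ => hb i j
  have hred : ∀ t, reduce id b k t = t - V.starProjection t := fun t => by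
    rw [reduce_of_eq_zero hck (fun i hi _ => hb0 i hi), sub_reduce_eq_starProjection horth, hV]
  set y := reduce id b k g with hy
  have hyg : y = g - V.starProjection g := hred g
  have hscale : ∀ t : ℝ, t • g - V.starProjection (t • g) = t • y := fun t => by
    rw [map_smul, ← smul_sub, ← hyg]
  have hynorm : ‖y‖ ≤ ‖g‖ := by
    have h1 := V.norm_sq_eq_add_norm_sq_starProjection g
    have h2 : Vᗮ.starProjection g = y := by
      rw [hyg, Submodule.starProjection_orthogonal_val]
    rw [h2] at h1
    exact le_of_sq_le_sq (by nlinarith [sq_nonneg ‖V.starProjection g‖]) (norm_nonneg _)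
  have hy1 : 1 ≤ net.sigma y := by rw [hyg]; exact hg1
  have hgX : X⁻¹ ≤ ‖g‖ := by
    have h1 := hD.lip 0 y
    rw [zero_add, net.sigma_zero h, sub_zero, Real.norm_eq_abs] at h1
    rw [inv_le_iff_one_le_mul₀' hX0]
    calc (1 : ℝ) ≤ |net.sigma y| := hy1.trans (le_abs_self _)
      _ ≤ X * ‖y‖ := h1
      _ ≤ _ := by gcongr
  have hg0 : 0 < ‖g‖ := (inv_pos.2 hX0).trans_le hgX
  have hηX : X⁻¹ ≤ η := inv_le_of_inv_le₀ h.η_pos hη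
  have hgrad' : ∀ t : ℝ, 0 < t → net.sigma (t • y) = 1 → (X ^ 2)⁻¹ ≤ |D (t • y) y| := by
    intro t ht h1
    have h2 := hgrad t ht (by rw [Network.sigmaV, hscale, h1])
    have hder : HasFDerivAt (net.sigmaV V)
        ((D (t • y)) ∘L (ContinuousLinearMap.id ℝ _ - V.starProjection)) (t • g) := by
      have := hD.hasFDerivAt (t • y)
      rw [← hscale t] at this ⊢
      exact HasFDerivAt.comp (t • g) this
        (ContinuousLinearMap.id ℝ _ - V.starProjection).hasFDerivAt
    rw [(hder.hasLineDerivAt _).lineDeriv] at h2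
    have h3 : ((D (t • y)) ∘L (ContinuousLinearMap.id ℝ _ - V.starProjection)) (‖g‖⁻¹ • g) =
        ‖g‖⁻¹ * D (t • y) y := by
      have : (ContinuousLinearMap.id ℝ (EuclideanSpace ℝ (Fin n)) -
          (V.starProjection : EuclideanSpace ℝ (Fin n) →L[ℝ] EuclideanSpace ℝ (Fin n)))
            (‖g‖⁻¹ • g) = ‖g‖⁻¹ • y := hscale _
      rw [ContinuousLinearMap.comp_apply, this, map_smul, smul_eq_mul]
    rw [h3, abs_mul, abs_of_pos (inv_pos.2 hg0), ← div_eq_inv_mul, le_div_iff₀ hg0] at h2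
    calc (X ^ 2)⁻¹ = X⁻¹ * X⁻¹ := by rw [pow_two, mul_inv]
      _ ≤ η * ‖g‖ := mul_le_mul hηX hgX (inv_pos.2 hX0).le h.η_pos.le
      _ ≤ _ := h2
  obtain ⟨h1, h2⟩ := displacement_predicted hD hX hs.pos hs.small (net.sigma_zero h) hs.dim_le
    (hynorm.trans hg) hy1 hgrad' hs.fine
  refine ⟨?_, h2⟩
  have hv : lineEstimate net.M I k X r b g =
    normalEstimate (fun x => threshold (net.sigma x)) I y r (r * X ^ 5) := rfl
  unfold IsLarge
  rw [hv]
  set v := normalEstimate (fun x => threshold (net.sigma x)) I y r (r * X ^ 5)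
  -- Since `y` is orthogonal to `V`, removing the `V`-part of `v` keeps `⟪v, y⟫ ≥ 1 / 2`; hence the
  -- new direction has norm at least `1 / (2 * X)`.
  have huy : inner ℝ (reduce id b k v) y = inner ℝ v y := by
    have hzero : inner ℝ (V.starProjection v) y = 0 := by
      rw [hyg]
      exact (Submodule.mem_orthogonal _ _).1 (V.sub_starProjection_mem_orthogonal g) _
        (V.starProjection_apply_mem v)
    rw [hred, inner_sub_left, hzero, sub_zero]
  set u := reduce id b k v
  have hu : 1 / 2 ≤ ‖u‖ * X := by
    refine h1.trans (huy ▸ (real_inner_le_norm u y).trans ?_)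
    gcongr
    exact hynorm.trans hg
  rw [real_inner_self_eq_norm_sq, inv_le_iff_one_le_mul₀' (by positivity)]
  calc (1 : ℝ) ≤ X * (1 / 2 * (1 / 2)) := by linarith
    _ ≤ X * ((‖u‖ * X) * (‖u‖ * X)) := by gcongr
    _ = _ := by ring

namespace RAM

/-- The part of the state that the attempts rely on: parameters unchanged from `s₀`, and `c`
orthogonal vectors close to `U` found so far. -/
structure Ready (n : ℕ) (U : Submodule ℝ (EuclideanSpace ℝ (Fin n))) (X r : ℝ) (k : ℕ) (s₀ : State)
    (c : ℕ) (s : State) : Prop where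
  nat : ∀ i < 3, s.nat i = s₀.nat i
  count : s.nat 3 = c
  arr : ∀ a ∈ [2, 3, 10, 11, 12, 13, 30, 31], s.arr a = s₀.arr a
  le : c ≤ k
  found : Found U r X (vecOf n (s.arr 4)) c

theorem Ready.next {U : Submodule ℝ (EuclideanSpace ℝ (Fin n))} {X r : ℝ} {k c : ℕ} {s₀ s : State}
    (h : Ready n U X r k s₀ c s) {a : ℕ} (ha : 9 ≤ a) (m : ℕ) :
    Ready n U X r k s₀ c ((s.writeN a m).tick 1) where
  nat i hi := by
    rw [← h.nat i hi]
    exact Function.update_of_ne (by omega) _ _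
  count := by
    rw [← h.count]
    exact Function.update_of_ne (by omega) _ _
  arr := h.arr
  le := h.le
  found := h.found

/-- The parameters stored before the attempts start. -/
structure Params (n k N : ℕ) (X r : ℝ) (s₀ : State) : Prop where
  dim : s₀.nat 0 = n
  width : s₀.nat 1 = k
  size : s₀.nat 2 = N
  scale : s₀.arr 10 0 0 = r
  radius : s₀.arr 11 0 0 = r * X ^ 5
  tolerance : s₀.arr 12 0 0 = r * X ^ 20
  cutoff : s₀.arr 13 0 0 = (X ^ 3)⁻¹

theorem Ready.attempt {U : Submodule ℝ (EuclideanSpace ℝ (Fin n))} {X r : ℝ} {k c N : ℕ}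
    {s₀ s : State} (hp : Params n k N X r s₀) (hs : Scale n k (3 * (N * N)) X r)
    (h : Ready n U X r k s₀ c s) (M : EuclideanSpace ℝ (Fin n) → ℕ) (ω : ℕ → ℝ)
    {g z : EuclideanSpace ℝ (Fin n)} (hg : g = WithLp.toLp 2 fun l : Fin n => ω (s.drawn + l))
    (hz : z = WithLp.toLp 2 fun l : Fin n => ω (s.drawn + n + l)) {b : ℕ → EuclideanSpace ℝ (Fin n)}
    (hb : vecOf n (s.arr 4) = b) :
    (Prog.attempt.run M ω s).drawn = s.drawn + n + n ∧
    (Predicts M (3 * (N * N)) k X r b g z → IsLarge M (3 * (N * N)) k X r b g → c < k →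
      ‖lineEstimate M (3 * (N * N)) k X r b g -
        U.starProjection (lineEstimate M (3 * (N * N)) k X r b g)‖ ≤ r * X ^ 21 →
      Ready n U X r k s₀ (c + 1) (Prog.attempt.run M ω s)) ∧
    (¬ (Predicts M (3 * (N * N)) k X r b g z ∧ IsLarge M (3 * (N * N)) k X r b g ∧ c < k) →
      Ready n U X r k s₀ c (Prog.attempt.run M ω s)) := by
  have hX : 0 < X := by linarith [hs.sixteen_le]
  have hθ : 0 ≤ r * X ^ 20 := mul_nonneg hs.pos.le (by positivity)
  have key := attempt_spec M ω (s := s) ((h.nat 0 (by decide)).trans hp.dim)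
    ((h.nat 1 (by decide)).trans hp.width) ((h.nat 2 (by decide)).trans hp.size) h.count hb
    (by rw [h.arr 10 (by decide), hp.scale]) (by rw [h.arr 11 (by decide), hp.radius])
    (by rw [h.arr 12 (by decide), hp.tolerance]) (by rw [h.arr 13 (by decide), hp.cutoff])
    hg hz rfl rfl
  have hN : ∀ i < 3, (Prog.attempt.run M ω s).nat i = s₀.nat i := fun i hi => by
    rw [← h.nat i hi]
    interval_cases i <;> exact Prog.run_nat M ω _ (by decide) s
  have hA : ∀ a ∈ [2, 3, 10, 11, 12, 13, 30, 31], (Prog.attempt.run M ω s).arr a = s₀.arr a := by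
    intro a ha
    rw [← h.arr a ha]
    refine Prog.run_arr M ω _ ?_ s
    revert a
    decide
  -- The instruction set has no absolute value, so the program compares squares.
  have hiff : ∀ d : ℝ, d * d ≤ r * X ^ 20 * (r * X ^ 20) ↔ |d| ≤ r * X ^ 20 := fun d => by
    rw [← abs_mul_abs_self d]
    exact (mul_self_le_mul_self_iff (abs_nonneg d) hθ).symm
  rw [hiff] at key
  obtain ⟨k1, k2, k3⟩ := key
  refine ⟨k1, fun h1 h2 h3 h4 => ?_, fun h1 => ?_⟩
  · obtain ⟨e1, e2⟩ := k2 ⟨⟨h1, h2⟩, h3⟩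
    refine ⟨hN, e1, hA, h3, ?_⟩
    rw [e2]
    exact (hb ▸ h.found).succ hs.pos.le hs.sixteen_le h3 hs.width_le
      (norm_lineEstimate_le hs M b g) h4 h2
  · obtain ⟨e1, e2⟩ := k3 fun h2 => h1 ⟨h2.1.1, h2.1.2, h2.2⟩
    exact ⟨hN, e1, hA, h.le, e2 ▸ h.found⟩

end RAM

end

/-! ### Probability of learning the whole row span -/

noncomputable section

namespace Network

variable {n : ℕ} (net : Network n)

theorem M_add_of_mem_orthogonal (x : EuclideanSpace ℝ (Fin n)) :
    ∀ v ∈ net.spanAᗮ, net.M (x + v) = net.M x := fun v hv => by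
  rw [M, M, net.sigma_add_of_mem_orthogonal hv]

theorem measurable_M {D : EuclideanSpace ℝ (Fin n) → EuclideanSpace ℝ (Fin n) →L[ℝ] ℝ} {Γ B : ℝ}
    (hD : QuadBound net.sigma D Γ B) : Measurable net.M := by
  have : Measurable threshold :=
    Measurable.ite (measurableSet_le measurable_const measurable_id) measurable_const
      measurable_const
  exact this.comp hD.continuous.measurable

theorem Admissible.γ_le_one {L : ℕ → ℝ} {γ η : ℝ} {net : Network n} (h : net.Admissible L γ η)
    (hk : 0 < net.k) : γ ≤ 1 := by
  have := (h.nonzero ⊥ (by simpa using hk)).trans prob_le_one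
  simpa using this

end Network

namespace RAM

variable {n : ℕ} (net : Network n)

theorem coins_attempts_le {L : ℕ → ℝ} {γ η : ℝ} (h : net.Admissible L γ η)
    {D : EuclideanSpace ℝ (Fin n) → EuclideanSpace ℝ (Fin n) →L[ℝ] ℝ} {N : ℕ} {X r : ℝ}
    (hs : Scale n net.k (3 * (N * N)) X r) (hD : QuadBound net.sigma D X X) (hη : η⁻¹ ≤ X)
    (hγ : n / X ^ 2 ≤ γ / 2) {s₀ : State} (hp : Params n net.k N X r s₀) {Q : State → Prop}
    (hQm : MeasurableSet {s | ¬ Q s}) (hQ : ∀ s, Ready n net.spanA X r net.k s₀ net.k s → Q s)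
    (l : List ℕ) {s : State} (hs0 : Ready n net.spanA X r net.k s₀ 0 s) (hd : s.drawn = 0) :
    coins {ω | ¬ Q (l.foldl
        (fun s' m => Prog.attempt.run net.M ω ((s'.writeN 9 m).tick 1)) s)} ≤
      l.length * ENNReal.ofReal (1 / X) +
        2 ^ net.k * ENNReal.ofReal (1 - γ / 8) ^ l.length := by
  have hX : 0 < X := by linarith [hs.sixteen_le]
  -- For `k = 0` nothing has to be found, and `γ ≤ 1` would not be available.
  rcases Nat.eq_zero_or_pos net.k with hk | hk
  · have : {ω | ¬ Q (l.foldl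
        (fun s' m => Prog.attempt.run net.M ω ((s'.writeN 9 m).tick 1)) s)} = ∅ := by
      refine Set.eq_empty_iff_forall_notMem.2 fun ω h' => h' (hQ _ ?_)
      rw [hk] at hp hs ⊢
      rw [hk] at hs0
      refine foldl_invariant (I := Ready n net.spanA X r 0 s₀ 0) (fun s' m h1 => ?_) _ _ hs0
      exact ((h1.next le_rfl m).attempt hp hs net.M ω rfl rfl rfl).2.2
        fun h => absurd h.2.2 (Nat.lt_irrefl 0)
    rw [this, measure_empty]
    exact zero_le
  have hγ1 : γ ≤ 1 := h.γ_le_one hk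
  have hγ0 := h.γ_pos
  have hM := net.measurable_M hD
  -- A good line has probability at least `γ / 2` and fails the test with probability at most `1 /
  -- 2`. The counter therefore stays with probability at most `1 - γ / 4`, and the mean potential
  -- shrinks by `1 - γ / 8`.
  have hlam : 1 + (1 / 2 + 1 / 2 * (1 - ENNReal.ofReal (γ / 2))) ≤
      2 * ENNReal.ofReal (1 - γ / 8) := by
    have h1 : (1 : ℝ≥0∞) = ENNReal.ofReal 1 := ENNReal.ofReal_one.symm
    have h2 : (2 : ℝ≥0∞) = ENNReal.ofReal 2 := (ENNReal.ofReal_ofNat 2).symm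
    have h3 : (1 / 2 : ℝ≥0∞) = ENNReal.ofReal (1 / 2) := by
      rw [ENNReal.ofReal_div_of_pos two_pos, ← h1, ← h2]
    rw [h3, h1, ← ENNReal.ofReal_sub _ (by linarith), h2, ← ENNReal.ofReal_mul (by norm_num),
      ← ENNReal.ofReal_mul (by norm_num), ← ENNReal.ofReal_add (by norm_num) (by linarith),
      ← ENNReal.ofReal_add (by norm_num) (by linarith)]
    exact ENNReal.ofReal_le_ofReal (by linarith)
  have key := coins_foldl_le (n := n) hM Prog.attempt 9 (k := net.k)
    (I := Ready n net.spanA X r net.k s₀) hQm hQ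
    (fun c s m h1 => h1.next le_rfl m) (fun s ω h1 => (h1.attempt hp hs net.M ω rfl rfl rfl).2.2
        fun h => absurd h.2.2 (Nat.lt_irrefl _)) hlam
    (q := ENNReal.ofReal (1 / X)) ?_ l (Nat.zero_le _) hs0 (fun _ => 0)
  · have hglue : ∀ ω, glue s.drawn (fun _ => 0) ω = ω := fun ω => by
      funext i
      simp [glue, hd]
    simpa only [hglue, Nat.sub_zero] using key
  intro c hc s h1
  set b := vecOf n (s.arr 4) with hb
  set I := 3 * (N * N)
  set V := Submodule.span ℝ (b '' (Finset.range c : Set ℕ)) with hV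
  have hVk : Module.finrank ℝ V < net.k := by
    refine lt_of_le_of_lt ?_ hc
    have h2 := finrank_span_finset_le_card (R := ℝ) ((Finset.range c).image b)
    rw [Finset.coe_image] at h2
    exact h2.trans (Finset.card_image_le.trans (Finset.card_range c).le)
  have htail : stdGaussian (EuclideanSpace ℝ (Fin n)) {x | X < ‖x‖} ≤ ENNReal.ofReal (γ / 2) :=
    (stdGaussian_norm_gt_le n hX).trans (ENNReal.ofReal_le_ofReal hγ)
  -- `Bad`: a far estimate passes the prediction test. `Stay`: a test is failed. `G`: the event of
  -- the gradient assumption for the span of the vectors found so far, restricted to `‖g‖ ≤ X`.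
  refine ⟨fun g => {z | r * X ^ 20 * X < ‖lineEstimate net.M I net.k X r b g -
      net.spanA.starProjection (lineEstimate net.M I net.k X r b g)‖ ∧
        Predicts net.M I net.k X r b g z},
    fun g => {z | ¬ (Predicts net.M I net.k X r b g z ∧ IsLarge net.M I net.k X r b g)},
    {g | (∀ c : ℝ, 0 < c → net.sigmaV V (c • g) = 1 →
      η ≤ |lineDeriv ℝ (net.sigmaV V) (c • g) (‖g‖⁻¹ • g)|) ∧ 1 ≤ net.sigmaV V g} ∩
      {g | ‖g‖ ≤ X}, fun g => ?_, fun g => ?_, fun g => ?_, ?_, fun g hg => ?_,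
    fun ω g z hg hz => ?_⟩
  · exact (MeasurableSet.const _).inter (measurableSet_predicts hM I net.k X r b g)
  · exact ((measurableSet_predicts hM I net.k X r b g).inter (MeasurableSet.const _)).compl
  · by_cases hfar : r * X ^ 20 * X < ‖lineEstimate net.M I net.k X r b g -
      net.spanA.starProjection (lineEstimate net.M I net.k X r b g)‖
    · exact (measure_mono fun z hz => hz.2).trans (stdGaussian_predicts_le hM I
        net.M_add_of_mem_orthogonal _ _ _ _ (mul_pos hs.pos (by positivity)) hX hfar)
    · refine (measure_mono_null (fun z hz => hfar hz.1) measure_empty).le.trans zero_le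
  -- Half of `γ` pays for the Gaussian tail.
  · have h2 := (h.gradient V hVk).trans (measure_le_inter_add_sdiff _ _ {g | ‖g‖ ≤ X})
    have h4 := h2.trans (add_le_add_right ((measure_mono (t := {x | X < ‖x‖})
      fun g hg => not_le.1 (show ¬ ‖g‖ ≤ X from hg.2)).trans htail) _)
    nth_rw 1 [← add_halves γ] at h4
    rw [ENNReal.ofReal_add (by linarith) (by linarith)] at h4
    exact ENNReal.le_of_add_le_add_right ENNReal.ofReal_ne_top h4
  · obtain ⟨h2, h3⟩ := net.attempt_succeeds h hs hD hη h1.found.orth h1.found.eq_zero hc.le hV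
      hg.2 hg.1.1 hg.1.2
    refine (measure_mono (t := {x | X < ‖x‖}) fun z hz => ?_).trans (htail.trans ?_)
    · by_contra hzX
      exact hz ⟨h3 z (not_lt.1 hzX), h2⟩
    · rw [← ENNReal.ofReal_one, ← ENNReal.ofReal_ofNat 2, ← ENNReal.ofReal_div_of_pos two_pos]
      exact ENNReal.ofReal_le_ofReal (by linarith)
  · obtain ⟨k1, k2, k3⟩ := h1.attempt hp hs net.M ω hg hz hb.symm
    refine ⟨k1, fun _ h3 => k3 fun h4 => h3 ⟨h4.1, h4.2.1⟩, fun h2 h3 => ?_⟩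
    obtain ⟨h4, h5⟩ := not_not.1 h3
    refine k2 h4 h5 hc (not_lt.1 fun h6 => h2 ⟨?_, h4⟩)
    calc r * X ^ 20 * X = r * X ^ 21 := by ring
      _ < _ := h6

end RAM

end

/-! ### Numerical estimates and the complete program -/

noncomputable section

namespace Network

variable {n : ℕ} (net : Network n) {L : ℕ → ℝ} {γ η ε δ : ℝ}

theorem Admissible.bounds {net : Network n} (h : net.Admissible L γ η) :
    1 ≤ net.paramSum L γ η ε δ ∧ (n : ℝ) ≤ net.paramSum L γ η ε δ ∧
      (net.k : ℝ) ≤ net.paramSum L γ η ε δ ∧ 1 / γ ≤ net.paramSum L γ η ε δ ∧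
      Real.posLog (1 / η) ≤ net.paramSum L γ η ε δ ∧
      Real.posLog (1 / ε) ≤ net.paramSum L γ η ε δ := by
  have h1 : (0 : ℝ) ≤ n := n.cast_nonneg
  have h2 : (0 : ℝ) ≤ net.k := net.k.cast_nonneg
  have h3 : (1 : ℝ) ≤ net.depth := by exact_mod_cast net.depth_pos
  have h4 : 0 < 1 / γ := one_div_pos.2 h.γ_pos
  have h5 : 0 ≤ ∑ i ∈ Finset.range net.depth, Real.posLog (L i) :=
    Finset.sum_nonneg fun _ _ => Real.posLog_nonneg
  have h6 : 0 ≤ ∑ i ∈ Finset.range net.depth, Real.posLog (specNorm (net.W i)) :=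
    Finset.sum_nonneg fun _ _ => Real.posLog_nonneg
  have h7 : 0 ≤ Real.posLog (specNorm net.A) := Real.posLog_nonneg
  have h8 : 0 ≤ Real.posLog (1 / η) := Real.posLog_nonneg
  have h9 : 0 ≤ Real.posLog (1 / ε) := Real.posLog_nonneg
  have h10 : 0 ≤ Real.posLog (1 / δ) := Real.posLog_nonneg
  unfold paramSum
  refine ⟨?_, ?_, ?_, ?_, ?_, ?_⟩ <;> linarith

end Network

theorem exp_le_two_pow {t : ℝ} {N : ℕ} (h : 2 * t ≤ N) : Real.exp t ≤ 2 ^ N := by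
  rw [← Real.exp_log (by positivity : (0 : ℝ) < 2 ^ N), Real.exp_le_exp, Real.log_pow]
  have := Real.log_two_gt_d9
  nlinarith [(Nat.cast_nonneg N : (0 : ℝ) ≤ N)]

theorem two_pow_inv_eq (N : ℕ) : ((2 : ℝ) ^ N)⁻¹ = Real.exp (-(N * Real.log 2)) := by
  rw [Real.exp_neg, mul_comm, Real.exp_mul, Real.exp_log two_pos, Real.rpow_natCast]

/-- As `n ≥ 2`, the target is at least `2 ^ (-N / 4)`, and each term takes half of it. In the first,
`N²` is absorbed by `exp (N / 2)`; in the second, `γ * N ≥ 1000` makes the power at most `exp (-125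
* N)`, which beats `2 ^ k`. -/
theorem error_terms_le {n k N : ℕ} {γ : ℝ} (hn : 2 ≤ n) (hN : 1000 ≤ N) (hk : k + 1 ≤ N)
    (hγ1 : γ ≤ 1) (hγ : 1000 ≤ γ * N) :
    (N * N : ℝ) * (1 / 2 ^ N) + 2 ^ k * (1 - γ / 8) ^ (N * N) ≤
      (2 : ℝ) ^ (-((N : ℝ) / (n : ℝ) ^ 2)) := by
  have l1 := Real.log_two_gt_d9
  have l2 := Real.log_two_lt_d9
  have hN' : (1000 : ℝ) ≤ N := by exact_mod_cast hN
  have hn' : (2 : ℝ) ≤ n := by exact_mod_cast hn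
  have target : Real.exp (-(N / 4 * Real.log 2)) ≤ (2 : ℝ) ^ (-((N : ℝ) / (n : ℝ) ^ 2)) := by
    rw [Real.rpow_def_of_pos two_pos, Real.exp_le_exp, mul_comm, mul_neg, neg_le_neg_iff]
    gcongr
    nlinarith
  have first : (N * N : ℝ) * (1 / 2 ^ N) ≤ 1 / 2 * Real.exp (-(N / 4 * Real.log 2)) := by
    have h1 : (N * N : ℝ) ≤ 1 / 2 * Real.exp (N / 2) := by
      have := Real.pow_div_factorial_le_exp (N / 2 : ℝ) (by positivity) 3
      have h3 : (N / 2 : ℝ) ^ 3 / (Nat.factorial 3 : ℕ) = N * N * (N / 48) := by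
        norm_num [Nat.factorial]; ring
      rw [h3] at this
      nlinarith [mul_nonneg (by linarith : (0 : ℝ) ≤ N) (by linarith : (0 : ℝ) ≤ N)]
    rw [one_div (2 ^ N : ℝ), two_pow_inv_eq]
    calc _ ≤ 1 / 2 * Real.exp (N / 2) * Real.exp (-(N * Real.log 2)) := by gcongr
      _ = 1 / 2 * Real.exp (N / 2 + -(N * Real.log 2)) := by rw [Real.exp_add]; ring
      _ ≤ _ := by gcongr; nlinarith
  have second : (2 : ℝ) ^ k * (1 - γ / 8) ^ (N * N) ≤ 1 / 2 * Real.exp (-(N / 4 * Real.log 2)) := by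
    have h1 : (1 - γ / 8) ^ (N * N) ≤ Real.exp (-(125 * N)) := by
      calc (1 - γ / 8) ^ (N * N) ≤ Real.exp (-(γ / 8)) ^ (N * N) := by
            refine pow_le_pow_left₀ (by linarith) ?_ _
            exact Real.one_sub_le_exp_neg _
        _ = Real.exp (-(γ * N / 8 * N)) := by
            rw [← Real.exp_nat_mul]; congr 1; push_cast; ring
        _ ≤ _ := by
            rw [Real.exp_le_exp, neg_le_neg_iff]
            gcongr
            linarith
    have h2 : (2 : ℝ) ^ k ≤ 1 / 2 * Real.exp (N * Real.log 2) := by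
      have h3 : (2 : ℝ) ^ (k + 1) ≤ 2 ^ N := pow_le_pow_right₀ (by norm_num) hk
      have h4 : Real.exp (N * Real.log 2) = 2 ^ N := by
        rw [mul_comm, Real.exp_mul, Real.exp_log two_pos, Real.rpow_natCast]
      rw [h4]
      rw [pow_succ] at h3
      linarith
    calc _ ≤ 1 / 2 * Real.exp (N * Real.log 2) * Real.exp (-(125 * N)) := by
          refine mul_le_mul h2 h1 (pow_nonneg (by linarith) _) (by positivity)
      _ = 1 / 2 * Real.exp (N * Real.log 2 + -(125 * N)) := by rw [Real.exp_add]; ring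
      _ ≤ _ := by gcongr; nlinarith
  linarith

namespace RAM

theorem sum_error_terms_le {n k N : ℕ} {γ : ℝ} (hn : 2 ≤ n) (hN : 1000 ≤ N) (hk : k + 1 ≤ N)
    (hγ1 : γ ≤ 1) (hγ : 1000 ≤ γ * N) :
    ((N * N : ℕ) : ℝ≥0∞) * ENNReal.ofReal (1 / 2 ^ N) +
      2 ^ k * ENNReal.ofReal (1 - γ / 8) ^ (N * N) ≤
      ENNReal.ofReal ((2 : ℝ) ^ (-((N : ℝ) / (n : ℝ) ^ 2))) := by
  have h2 : (2 : ℝ≥0∞) = ENNReal.ofReal 2 := (ENNReal.ofReal_ofNat 2).symm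
  have h0 : 0 ≤ 1 - γ / 8 := by linarith
  rw [h2, ← ENNReal.ofReal_natCast, ← ENNReal.ofReal_pow zero_le_two, ← ENNReal.ofReal_pow h0,
    ← ENNReal.ofReal_mul (by positivity), ← ENNReal.ofReal_mul (by positivity),
    ← ENNReal.ofReal_add (by positivity) (mul_nonneg (by positivity) (pow_nonneg h0 _))]
  refine ENNReal.ofReal_le_ofReal ?_
  rw [Nat.cast_mul]
  exact error_terms_le hn hN hk hγ1 hγ

/-- Store the scale, the radius, the tolerance and the cutoff. -/
def Prog.prepare : Prog :=
  .seq (.halfPow 10 (.mul (.reg 2) (.reg 2)))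
    (.seq (.halfPow 11 (.sub (.mul (.reg 2) (.reg 2)) (.mul (.const 5) (.reg 2))))
    (.seq (.halfPow 12 (.sub (.mul (.reg 2) (.reg 2)) (.mul (.const 20) (.reg 2))))
    (.halfPow 13 (.mul (.const 3) (.reg 2)))))

/-- Learn the row span from repeated attempts and intersect it with the orthogonal complement. -/
def Prog.learn : Prog :=
  .seq .prepare (.seq (.loop 9 (.mul (.reg 2) (.reg 2)) .attempt) .finish)

theorem Prog.static_learn : Prog.learn.Static := by
  simp [Prog.learn, Prog.prepare, Prog.finish, Prog.finishStep, Prog.projectRow, Prog.attempt,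
    Prog.accept, Prog.reduceEstimate, Prog.probeRandom, Prog.probeAxes, Prog.probe,
    Prog.baseCrossing, Prog.drawLine, Prog.bisection, Prog.halfPow, Prog.reduceRow, Prog.dot,
    Prog.gaussRow, Prog.setRow, Prog.setScalar, Prog.Static, NExp.Static]

variable {n : ℕ}

/-- The stored powers of `1 / 2` realize `r = 2 ^ (-N²)` and `X = 2 ^ N`. The condition `20 ≤ N`
keeps the truncated subtractions in the exponents exact. -/
theorem prepare_spec (M : EuclideanSpace ℝ (Fin n) → ℕ) (ω : ℕ → ℝ) {s : State} {k N : ℕ}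
    (hn : s.nat 0 = n) (hk : s.nat 1 = k) (hN : s.nat 2 = N) (h20 : 20 ≤ N) :
    Params n k N (2 ^ N) (((2 : ℝ) ^ (N * N))⁻¹) (Prog.prepare.run M ω s) := by
  have hpow : ∀ m, m ≤ 20 → ((2 : ℝ) ^ (N * N - m * N))⁻¹ = ((2 : ℝ) ^ (N * N))⁻¹ * (2 ^ N) ^ m := by
    intro m hm
    have h1 : m * N ≤ N * N := Nat.mul_le_mul_right N (hm.trans h20)
    rw [← pow_mul, mul_comm N m, eq_inv_mul_iff_mul_eq₀ (by positivity), ← div_eq_mul_inv,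
      div_eq_iff (by positivity), ← pow_add, Nat.add_sub_cancel' h1]
  have hnat : ∀ i < 3, (Prog.prepare.run M ω s).nat i = s.nat i := fun i hi => by
    interval_cases i <;> exact Prog.run_nat M ω _ (by decide) s
  refine ⟨(hnat 0 (by decide)).trans hn, (hnat 1 (by decide)).trans hk,
    (hnat 2 (by decide)).trans hN, ?_, ?_, ?_, ?_⟩ <;>
    simp only [Prog.prepare, run_seq]
  · rw [Prog.run_arr M ω _ (by decide), Prog.run_arr M ω _ (by decide),
      Prog.run_arr M ω _ (by decide), halfPow_arr]
    simp only [NExp.eval, hN]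
  · rw [Prog.run_arr M ω _ (by decide), Prog.run_arr M ω _ (by decide), halfPow_arr]
    simp only [NExp.eval]
    rw [Prog.run_nat M ω _ (by decide), hN, hpow 5 (by norm_num)]
  · rw [Prog.run_arr M ω _ (by decide), halfPow_arr]
    simp only [NExp.eval]
    rw [Prog.run_nat M ω _ (by decide), Prog.run_nat M ω _ (by decide), hN, hpow 20 (by norm_num)]
  · rw [halfPow_arr]
    simp only [NExp.eval]
    rw [Prog.run_nat M ω _ (by decide), Prog.run_nat M ω _ (by decide),
      Prog.run_nat M ω _ (by decide), hN, mul_comm 3 N, pow_mul]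

theorem inner_input_row {k N : ℕ} {ε δ γ η ε₀ : ℝ} {x : EuclideanSpace ℝ (Fin n)}
    {V : Submodule ℝ (EuclideanSpace ℝ (Fin n))} (l : Fin n) (y : EuclideanSpace ℝ (Fin n)) :
    inner ℝ (vecOf n ((input k N ε δ γ η ε₀ x V).arr 2) l) y = V.starProjection y l := by
  have h1 : ∀ z : EuclideanSpace ℝ (Fin n), inner ℝ (EuclideanSpace.single l (1 : ℝ)) z = z l :=
    fun z => by simp [EuclideanSpace.inner_single_left]
  have h2 : vecOf n ((input k N ε δ γ η ε₀ x V).arr 2) l =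
      V.starProjection (EuclideanSpace.single l (1 : ℝ)) := by
    ext j
    have : vecOf n ((input k N ε δ γ η ε₀ x V).arr 2) l j =
        V.starProjection (EuclideanSpace.single j (1 : ℝ)) l := by
      simp [vecOf, input]
    rw [this, ← h1, ← Submodule.inner_starProjection_left_eq_right, real_inner_comm]
    simp [EuclideanSpace.inner_single_left]
  rw [h2, Submodule.inner_starProjection_left_eq_right, h1]

theorem vecOf_input_eq_zero {k N : ℕ} {ε δ γ η ε₀ : ℝ} {x : EuclideanSpace ℝ (Fin n)}
    {V : Submodule ℝ (EuclideanSpace ℝ (Fin n))} {a : ℕ} (ha : 3 ≤ a) (i : ℕ) :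
    vecOf n ((input k N ε δ γ η ε₀ x V).arr a) i = 0 := by
  ext j
  simp only [vecOf_apply, input]
  rw [if_neg (by omega), if_neg (by omega), if_neg (by omega)]
  rfl

end RAM

end

/-! ### Correctness of the program and choice of constants -/

noncomputable section

namespace RAM

variable {n : ℕ}

theorem failProb_learn_le (net : Network n) {L : ℕ → ℝ} {γ η ε : ℝ} (h : net.Admissible L γ η)
    (hε : 0 < ε) {D : EuclideanSpace ℝ (Fin n) → EuclideanSpace ℝ (Fin n) →L[ℝ] ℝ} {N : ℕ}
    (h20 : 20 ≤ N) (hkN : 26 + 10 * net.k ≤ N)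
    (hs : Scale n net.k (3 * (N * N)) (2 ^ N) (((2 : ℝ) ^ (N * N))⁻¹))
    (hD : QuadBound net.sigma D (2 ^ N) (2 ^ N)) (hη : η⁻¹ ≤ 2 ^ N) (hεN : ε⁻¹ ≤ 2 ^ N)
    (hγ : n / ((2 : ℝ) ^ N) ^ 2 ≤ γ / 2) (δ ε₀ : ℝ) (x : EuclideanSpace ℝ (Fin n))
    {V : Submodule ℝ (EuclideanSpace ℝ (Fin n))} (hV : Module.finrank ℝ V < net.k) :
    Prog.learn.failProb net.M (input net.k N ε δ γ η ε₀ x V)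
      (fun v => v ≠ 0 ∧ (1 - ε) * ‖v‖ ≤ ‖net.spanA.starProjection v‖ ∧
        ‖V.starProjection v‖ ≤ ε * ‖v‖) ≤
      ((N * N : ℕ) : ℝ≥0∞) * ENNReal.ofReal (1 / 2 ^ N) +
        2 ^ net.k * ENNReal.ofReal (1 - γ / 8) ^ (N * N) := by
  have hM := net.measurable_M hD
  set P : EuclideanSpace ℝ (Fin n) → Prop := fun v => v ≠ 0 ∧
    (1 - ε) * ‖v‖ ≤ ‖net.spanA.starProjection v‖ ∧ ‖V.starProjection v‖ ≤ ε * ‖v‖ with hP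
  have hi2 : ∀ (l : Fin n) y, inner ℝ (vecOf n ((input net.k N ε δ γ η ε₀ x V).arr 2) l) y =
      V.starProjection y l := fun l y => inner_input_row l y
  have hi0 : ∀ a, 3 ≤ a → ∀ i, vecOf n ((input net.k N ε δ γ η ε₀ x V).arr a) i = 0 :=
    fun a ha i => vecOf_input_eq_zero ha i
  have hi3 : (input net.k N ε δ γ η ε₀ x V).nat 3 = 0 := rfl
  have hid : (input net.k N ε δ γ η ε₀ x V).drawn = 0 := rfl
  have hp := prepare_spec net.M 0 (k := net.k) (N := N)
    (s := input net.k N ε δ γ η ε₀ x V) rfl rfl rfl h20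
  generalize input net.k N ε δ γ η ε₀ x V = i₀ at hi2 hi0 hi3 hid hp ⊢
  have hcount := (Prog.prepare.run_nat net.M 0 (r := 3) (by decide) i₀).trans hi3
  have hdrawn := (Prog.prepare.run_drawn net.M 0 (by decide) i₀).trans hid
  have harrs : ∀ x ∈ Prog.prepare.arrs, x ∈ [10, 11, 12, 13] := by decide
  have ha : ∀ a ∉ [10, 11, 12, 13], (Prog.prepare.run net.M 0 i₀).arr a = i₀.arr a := fun a ha =>
    Prog.prepare.run_arr net.M 0 (fun h => ha (harrs a h)) i₀
  have hprep := fun ω => Prog.prepare.run_eq_of_not_random net.M ω (by decide) 0 i₀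
  generalize Prog.prepare.run net.M 0 i₀ = s₀ at hp hcount hdrawn ha hprep
  have hrun : ∀ ω, Prog.learn.run net.M ω i₀ = Prog.finish.run net.M 0
      ((List.range (N * N)).foldl (fun s' m => Prog.attempt.run net.M ω ((s'.writeN 9 m).tick 1))
        (s₀.tick ((NExp.mul (.reg 2) (.reg 2)).cost + 1))) := by
    intro ω
    rw [Prog.learn, run_seq, run_seq, Prog.finish.run_eq_of_not_random net.M ω (by decide) 0,
      hprep]
    simp only [Prog.run, NExp.eval, hp.size]
  have hPm : MeasurableSet {v | ¬ P v} := by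
    refine MeasurableSet.compl (MeasurableSet.inter ?_ (MeasurableSet.inter ?_ ?_))
    · exact (measurableSet_singleton _).compl
    · exact measurableSet_le (f := fun v => (1 - ε) * ‖v‖)
        (g := fun v => ‖net.spanA.starProjection v‖) (by fun_prop) (by fun_prop)
    · exact measurableSet_le (f := fun v => ‖V.starProjection v‖) (g := fun v => ε * ‖v‖)
        (by fun_prop) (by fun_prop)
  have key := coins_attempts_le net h hs hD hη hγ (s₀ := s₀) hp
    (Q := fun s => P ((Prog.finish.run net.M 0 s).output n))
    ((measurable_row (Prog.finish.measurable_run hM measurable_const measurable_id) n 3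
      measurable_const) hPm) (fun s hr => ?_) (List.range (N * N))
    (s := s₀.tick ((NExp.mul (.reg 2) (.reg 2)).cost + 1)) ⟨fun _ _ => rfl, ?_, fun _ _ => rfl,
      Nat.zero_le _, ?_⟩ ?_
  · rw [List.length_range] at key
    simpa only [Prog.failProb, hrun] using key
  · have hzero : ∀ a, 3 ≤ a → a ∉ [10, 11, 12, 13] → a ∈ [2, 3, 10, 11, 12, 13, 30, 31] →
        ∀ i, vecOf n (s.arr a) i = 0 := fun a h1 h2 h3 i => by
      rw [hr.arr a h3, ha a h2]
      exact hi0 a h1 i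
    obtain ⟨h1, h2, h3⟩ := finish_spec net.M 0 hV ((hr.nat 0 (by decide)).trans hp.dim)
      ((hr.nat 1 (by decide)).trans hp.width)
      (fun l y => by rw [hr.arr 2 (by decide), ha 2 (by decide)]; exact hi2 l y)
      (hzero 30 (by decide) (by decide) (by decide)) (hzero 31 (by decide) (by decide) (by decide))
      hr.found.ne_zero hr.found.orth
    set v := (Prog.finish.run net.M 0 s).output n
    have h4 := hr.found.norm_offset_le hs.pos.le (by linarith [hs.sixteen_le]) hs.width_le h3
    -- In powers of `2` the exponent is `N * (25 + 10 * k) - N * N ≤ -N`, because `26 + 10 * k ≤ N`.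
    have h5 : ((2 : ℝ) ^ (N * N))⁻¹ * (2 ^ N) ^ (25 + 10 * net.k) ≤ ε := by
      refine le_trans ?_ (inv_le_of_inv_le₀ hε hεN)
      rw [inv_mul_le_iff₀ (by positivity), ← div_eq_mul_inv, le_div_iff₀ (by positivity), ← pow_succ,
        ← pow_mul]
      exact pow_le_pow_right₀ (by norm_num) (Nat.mul_le_mul_left N (by omega))
    refine ⟨h1, ?_, ?_⟩
    · have h6 := norm_sub_norm_le v (net.spanA.starProjection v)
      have h7 := h4.trans (mul_le_mul_of_nonneg_right h5 (norm_nonneg v))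
      linarith
    · rw [h2, norm_zero]
      positivity
  · exact hcount
  · have hb : vecOf n (s₀.arr 4) = fun _ => 0 := by
      funext i
      rw [ha 4 (by decide)]
      exact hi0 4 (by norm_num) i
    change Found net.spanA _ _ (vecOf n (s₀.arr 4)) 0
    rw [hb]
    exact ⟨fun i hi => absurd hi (Nat.not_lt_zero i), fun _ _ => rfl,
      fun _ _ _ => inner_zero_left _, fun i hi => absurd hi (Nat.not_lt_zero i)⟩
  · exact hdrawn

end RAM

end

theorem lemma4p2 :
    ∃ K : ℕ, ∀ c₁ c₂ : ℝ, 0 < c₁ → 0 < c₂ →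
    ∃ C₀ : ℕ, ∀ C : ℕ, C₀ ≤ C →
    ∃ (prog : RAM.Prog) (T : ℕ),
    ∀ (n : ℕ) (net : Network n) (L : ℕ → ℝ) (γ η ε δ : ℝ),
      net.Admissible L γ η → 0 < ε → 0 < δ →
    ∀ N : ℕ, (K : ℝ) * (net.paramSum L γ η ε δ) ^ K ≤ (N : ℝ) →
    ∀ ε₀ : ℝ, c₁ * ((2 : ℝ) ^ (N ^ C))⁻¹ / ε ≤ ε₀ → ε₀ ≤ c₂ * ((2 : ℝ) ^ (N ^ C))⁻¹ / ε →
    ∀ (V : Submodule ℝ (EuclideanSpace ℝ (Fin n))) (x : EuclideanSpace ℝ (Fin n)),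
      Module.finrank ℝ V < net.k →
      ε₀ * η * ((2 : ℝ) ^ N)⁻¹ ≤ net.sigmaV V x - 1 →
      net.sigmaV V x - 1 ≤ 2 * ε₀ →
      η / 2 < lineDeriv ℝ (net.sigmaV V) x (‖x‖⁻¹ • x) →
      prog.expectedTime net.M (RAM.input net.k N ε δ γ η ε₀ x V)
          ≤ (T : ENNReal) * (N : ENNReal) ^ T ∧
      prog.failProb net.M (RAM.input net.k N ε δ γ η ε₀ x V)
          (fun v => v ≠ 0 ∧
            (1 - ε) * ‖v‖ ≤ ‖net.spanA.starProjection v‖ ∧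
            ‖V.starProjection v‖ ≤ ε * ‖v‖)
          ≤ ENNReal.ofReal ((2 : ℝ) ^ (-((N : ℝ) / (n : ℝ) ^ 2))) := by
  -- The argument uses only `N ≥ 1000 * S`, so `K = 1000` is ample and any `C` will do.
  refine ⟨1000, fun c₁ c₂ _ _ => ⟨0, fun C _ => ?_⟩⟩
  obtain ⟨T, hT⟩ := RAM.Prog.static_learn.expectedTime_le
  refine ⟨RAM.Prog.learn, T, fun n net L γ η ε δ h hε _ N hN ε₀ _ _ V x hV _ _ _ => ?_⟩
  obtain ⟨D, hD⟩ := net.exists_quadBound (ε := ε) (δ := δ) h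
  obtain ⟨hS1, hnS, hkS, hγS, hηS, hεS⟩ := h.bounds (ε := ε) (δ := δ)
  set S := net.paramSum L γ η ε δ
  have hNS : 1000 * S ≤ N := by
    refine le_trans ?_ hN
    push_cast
    gcongr
    exact le_self_pow₀ hS1 (by norm_num)
  have hN1000 : 1000 ≤ N := by
    have : (1000 : ℝ) ≤ N := by linarith
    exact_mod_cast this
  -- `dim V < k` forces `k ≥ 1`, and `n > k`.
  have hn2 : 2 ≤ n := by have := h.k_lt; omega
  have hkN : 1000 * net.k ≤ N := by
    have : (1000 : ℝ) * net.k ≤ N := by linarith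
    exact_mod_cast this
  have hnN : n ≤ N := by
    have : (n : ℝ) ≤ N := by linarith
    exact_mod_cast this
  have hX : (N : ℝ) ≤ 2 ^ N := by exact_mod_cast Nat.lt_two_pow_self.le
  have hX3 : Real.exp (3 * S) ≤ 2 ^ N := exp_le_two_pow (by linarith)
  have hX1 : Real.exp S ≤ 2 ^ N := exp_le_two_pow (by linarith)
  have hinv : ∀ {t : ℝ}, Real.posLog (1 / t) ≤ S → t⁻¹ ≤ 2 ^ N := fun {t} ht => by
    rw [← one_div]
    exact (le_exp_posLog _).trans ((Real.exp_le_exp.2 ht).trans hX1)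
  have hs : Scale n net.k (3 * (N * N)) (2 ^ N) (((2 : ℝ) ^ (N * N))⁻¹) := by
    refine ⟨?_, by positivity, ?_, by linarith, by linarith, ?_⟩
    · linarith
    · rw [inv_mul_le_iff₀ (by positivity), mul_one, ← pow_mul]
      exact pow_le_pow_right₀ (by norm_num) (Nat.mul_le_mul_left N (by omega))
    · rw [inv_pow, ← pow_mul]
      exact inv_anti₀ (by positivity) (pow_le_pow_right₀ (by norm_num) (by omega))
  have hk0 : 0 < net.k := (Nat.zero_le _).trans_lt hV
  have hγN : 1000 ≤ γ * N := by
    have h1 : 1 ≤ S * γ := (div_le_iff₀ h.γ_pos).1 hγS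
    nlinarith [h.γ_pos]
  have hγ : n / ((2 : ℝ) ^ N) ^ 2 ≤ γ / 2 := by
    rw [div_le_iff₀ (by positivity)]
    have h1 : (n : ℝ) ≤ 2 ^ N := by linarith
    have h2 : 2 ≤ γ * 2 ^ N := by nlinarith [h.γ_pos]
    nlinarith [(by positivity : (0 : ℝ) < 2 ^ N)]
  refine ⟨hT n net.M _ N (by omega) hnN (fun r hr => ?_) rfl, ?_⟩
  · interval_cases r
    · exact hnN
    · change net.k ≤ N
      omega
    · exact le_rfl
  · exact (RAM.failProb_learn_le net h hε (by omega) (by omega) hs (hD.mono hX1 hX3) (hinv hηS)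
      (hinv hεS) hγ δ ε₀ x hV).trans
        (RAM.sum_error_terms_le hn2 hN1000 (by omega) (h.γ_le_one hk0) hγN)
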